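/- Let $k$ be a field, $\otimes=\otimes_k$, and let $A=B\oplus M$ be a split extension of $k$-algebras: $B\subset A$ is a subalgebra and $M$ is a two-sided ideal of $A$, so that $M$ is the kernel of an algebra retraction $A\to B$. Let $X$ be an $A$-bimodule and $B^e=B\otimes B^{op}$. Let $C_*(A,X)$, with $C_n(A,X)=X\otimes A^{\otimes n}$ and boundary $b$, be the Hochschild chain complex, and likewise $C_*(B,X)$. Write $a_M$ for the $M$-component of $a\in A$. Let $C^M_*$ be the complex with $C^M_n=X\otimes_{B^e}M^{\otimes_B n}$ for $n\ge 1$ and $C_0^M=0$, whose boundary in degrees $n\geq 2$ is induced by $b$. Let $\iota:C_*(B,X)\to C_*(A,X)$ be the inclusion and let $\kappa:C_*(A,X)\to C_*^M$ be given by $\kappa(x\otimes a_1\otimes\cdots\otimes a_n)=x\otimes_{B^e}\left[(a_1)_M\otimes_B\cdots\otimes_B(a_n)_M\right]$ for $n\ge 1$ and $\kappa=0$ for $n=0$. After the standard change of signs, the sequence $$0\to C_*(B,X)\xrightarrow{\iota}C_*(A,X)\xrightarrow{\kappa}C^M_*\to 0$$ is a double complex with $C^M_*$, $C_*(A,X)$,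 $C_*(B,X)$ as columns $0,1,2$. Let $E^2_{1,*}$ be the column $1$ of the second page of the spectral sequence of its filtration by rows. For $p,q\ge 0$ let $[M_pB_q]\subset A^{\otimes (p+q)}$ be the sum of the direct summands with exactly $p$ tensorands in $M$ and $q$ tensorands in $B$, and for $p>0$ let $K_{p,0}=\mathrm{Ker}\,(X\otimes M^{\otimes p}\to X\otimes_{B^e}M^{\otimes_B p})$. Let $C_{*,*}$ be the double complex with $$C_{p,q}=X\otimes[M_pB_q]\ (p,q>0),\qquad C_{p,0}=K_{p,0}\ (p>0),\qquad C_{0,q}=0\ (q\ge 0),$$ whose vertical differentials $C_{p,q}\to C_{p,q-1}$ and horizontal differentials $C_{p,q}\to C_{p-1,q}$ are the corresponding components of $b$. Then: 1. For every $n\ge 0$, the homology in degree $n$ of the total complex of $C_{*,*}$ is isomorphic to $E^2_{1,n}$. 2. Suppose that $\mathrm{Tor}^B_i(M,M^{\otimes_B n})=0$ for all $i>0$ and all $n$. Then the first page of the spectral sequence of the filtration by columns of $C_{*,*}$ is $$F^1_{p,q}\cong\mathrm{Tor}^{B^e}_{q}(X,M^{\otimes_B p})\quad\text{for }p,q>0,\qquad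 F^1_{p,q}=0\quad\text{otherwise.}$$ -/

import Mathlib

open scoped TensorProduct
open CategoryTheory
universe u

set_option linter.unusedSectionVars false

namespace HochschildComplex

section Faces

variable (k : Type u) {R X : Type u} [Field k] [Ring R] [AddCommGroup X] [Module R X]
  [Module Rᵐᵒᵖ X]

/-- Coefficient part of the `i`-th face of `x ⊗ a₁ ⊗ ⋯ ⊗ aₙ₊₁`: it is `x a₁` for `i = 0`,
`aₙ₊₁ x` for the last `i`, and `x` otherwise. -/
def coeffFace {n : ℕ} (i : Fin (n + 2)) (x : X) (a : Fin (n + 1) → R) : X :=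
  if (i : ℕ) = 0 then MulOpposite.op (a 0) • x
  else if (i : ℕ) = n + 1 then a (Fin.last n) • x
  else x

/-- Algebra part of the `i`-th face of `x ⊗ a₁ ⊗ ⋯ ⊗ aₙ₊₁`: drop `a₁` for `i = 0`, drop `aₙ₊₁`
for the last `i`, and replace the neighbours `aᵢ, aᵢ₊₁` by `aᵢ aᵢ₊₁` otherwise. -/
def algFace {α : Type*} (op : α → α → α) {n : ℕ} (i : Fin (n + 2)) (a : Fin (n + 1) → α)
    (j : Fin n) : α :=
  if (j : ℕ) + 1 < i then a j.castSucc
  else if (j : ℕ) + 1 = i then op (a j.castSucc) (a j.succ)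
  else a j.succ

/-- The function-level simplicial identities. -/
theorem algFace_algFace {n : ℕ} (i j : Fin (n + 2)) (h : i ≤ j)
    (a : Fin (n + 2) → R) :
    algFace (· * ·) i (algFace (· * ·) j.succ a) =
      algFace (· * ·) j (algFace (· * ·) i.castSucc a) := by
  funext l
  have h' : (i : ℕ) ≤ j := h
  simp only [algFace, Fin.val_succ, Fin.val_castSucc]
  split_ifs <;> first | omega | rfl | simp [mul_assoc]

theorem coeffFace_coeffFace [SMulCommClass R Rᵐᵒᵖ X] {n : ℕ} (i j : Fin (n + 2)) (h : i ≤ j)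
    (x : X) (a : Fin (n + 2) → R) :
    coeffFace i (coeffFace j.succ x a) (algFace (· * ·) j.succ a) =
      coeffFace j (coeffFace i.castSucc x a) (algFace (· * ·) i.castSucc a) := by
  have h' : (i : ℕ) ≤ j := h
  have e0 : (Fin.castSucc (0 : Fin (n + 1))) = 0 := rfl
  have e1 : (Fin.succ (0 : Fin (n + 1))) = 1 := rfl
  have e2 : (Fin.last n).succ = Fin.last (n + 1) := rfl
  have hj := j.2
  simp only [coeffFace, algFace, Fin.val_succ, Fin.val_castSucc, Fin.val_last,
    Fin.val_zero, e0, e1, e2]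
  by_cases hi0 : (i : ℕ) = 0 <;> by_cases hjl : (j : ℕ) = n + 1 <;>
    by_cases hj0 : (j : ℕ) = 0 <;> by_cases hil : (i : ℕ) = n + 1 <;>
    first
    | omega
    | (simp [hi0, hjl, hj0, hil, mul_smul, smul_comm]; done)
    | (have h1 : ¬(i : ℕ) = n + 1 + 1 := by omega
       have h2 : ¬(n + 1 < (i : ℕ)) := by omega
       have h3 : ¬(n + 1 = (i : ℕ)) := by omega
       simp [hi0, hjl, hj0, hil, h1, h2, h3]
       done)
    | (have h1 : 0 < j := Nat.pos_of_ne_zero hj0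
       simp [hi0, hjl, hj0, h1])

variable [Algebra k R] [Module k X] [IsScalarTower k R X] [IsScalarTower k Rᵐᵒᵖ X]

variable (R X) in
/-- The space `X ⊗ R ⊗ ⋯ ⊗ R` (with `n` factors `R`) of Hochschild `n`-chains. -/
abbrev Chain (n : ℕ) : Type u := X ⊗[k] (⨂[k] _ : Fin n, R)

variable (R X) in
/-- The pure tensor `x ⊗ a₁ ⊗ ⋯ ⊗ aₙ`. -/
abbrev pureTensor {n : ℕ} (x : X) (a : Fin n → R) : Chain k R X n := x ⊗ₜ PiTensorProduct.tprod k a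

theorem algFace_update {n : ℕ} (i : Fin (n + 2)) (a : Fin (n + 1) → R) (l : Fin (n + 1))
    (h0 : ¬((i : ℕ) = 0 ∧ (l : ℕ) = 0)) (h1 : ¬((i : ℕ) = n + 1 ∧ (l : ℕ) = n)) :
    ∃ (l' : Fin n) (g : R →ₗ[k] R), ∀ v, algFace (· * ·) i (Function.update a l v) =
      Function.update (algFace (· * ·) i a) l' (g v) := by
  have hl := l.2
  have hi := i.2
  by_cases hli : (l : ℕ) < i
  · refine ⟨⟨l, by omega⟩, if h : (l : ℕ) + 1 = i then
      LinearMap.mulRight k (a ⟨l + 1, by omega⟩) else LinearMap.id, fun v => ?_⟩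
    funext j
    have e1 : j.castSucc = l ↔ (j : ℕ) = l := by simp [Fin.ext_iff]
    have e2 : j.succ = l ↔ (j : ℕ) + 1 = l := by simp [Fin.ext_iff]
    simp only [algFace, Function.update_apply, e1, e2, Fin.ext_iff]
    by_cases hj : (j : ℕ) = l
    · have e3 : (⟨l + 1, by omega⟩ : Fin (n + 1)) = j.succ := by simp [Fin.ext_iff, hj]
      split_ifs <;> first | omega | simp_all
    · split_ifs <;> first | omega | simp_all
  · refine ⟨⟨l - 1, by omega⟩, if h : (l : ℕ) = i then
      LinearMap.mulLeft k (a ⟨l - 1, by omega⟩) else LinearMap.id, fun v => ?_⟩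
    funext j
    have e1 : j.castSucc = l ↔ (j : ℕ) = l := by simp [Fin.ext_iff]
    have e2 : j.succ = l ↔ (j : ℕ) + 1 = l := by simp [Fin.ext_iff]
    simp only [algFace, Function.update_apply, e1, e2, Fin.ext_iff]
    by_cases hj : (j : ℕ) + 1 = l
    · have e3 : (⟨l - 1, by omega⟩ : Fin (n + 1)) = j.castSucc := by
        simp only [Fin.ext_iff, Fin.val_castSucc]; omega
      split_ifs <;> first | omega | simp_all
    · split_ifs <;> first | omega | simp_all

theorem face_linear_in_each {n : ℕ} (i : Fin (n + 2)) [inst : DecidableEq (Fin (n + 1))]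
    (a : Fin (n + 1) → R) (l : Fin (n + 1)) :
    ∃ φ : R →ₗ[k] (X →ₗ[k] Chain k R X n), ∀ v x,
      pureTensor k R X (coeffFace i x (Function.update a l v))
        (algFace (· * ·) i (Function.update a l v)) = φ v x := by
  obtain rfl : inst = instDecidableEqFin (n + 1) := Subsingleton.elim _ _
  by_cases h0 : (i : ℕ) = 0 ∧ (l : ℕ) = 0
  · obtain ⟨hi, hl⟩ := h0
    obtain rfl : l = 0 := Fin.ext hl
    refine ⟨LinearMap.mk₂ k (fun v x => pureTensor k R X (MulOpposite.op v • x)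
      (algFace (· * ·) i a)) ?_ ?_ ?_ ?_, fun v x => ?_⟩
    · intro v w x; simp [add_smul, TensorProduct.add_tmul]
    · intro c v x; simp [TensorProduct.smul_tmul']
    · intro v x y; simp [TensorProduct.add_tmul]
    · intro c v x; simp only [pureTensor]; rw [smul_comm, TensorProduct.smul_tmul']
    · have : algFace (· * ·) i (Function.update a 0 v) = algFace (· * ·) i a := by
        funext j
        simp [algFace, hi]
      simp only [this]; simp [coeffFace, hi]; rfl
  by_cases h1 : (i : ℕ) = n + 1 ∧ (l : ℕ) = n
  · obtain ⟨hi, hl⟩ := h1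
    obtain rfl : l = Fin.last n := Fin.ext hl
    refine ⟨LinearMap.mk₂ k (fun v x => pureTensor k R X (v • x)
      (algFace (· * ·) i a)) ?_ ?_ ?_ ?_, fun v x => ?_⟩
    · intro v w x; simp [add_smul, TensorProduct.add_tmul]
    · intro c v x; simp [TensorProduct.smul_tmul']
    · intro v x y; simp [TensorProduct.add_tmul]
    · intro c v x; simp only [pureTensor]; rw [smul_comm, TensorProduct.smul_tmul']
    · have : algFace (· * ·) i (Function.update a (Fin.last n) v) = algFace (· * ·) i a := by
        funext j
        have hj := j.2
        simp [algFace, hi, Fin.ext_iff, hj.ne]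
      simp only [this]; simp [coeffFace, hi]; rfl
  obtain ⟨l', g, hg⟩ := algFace_update k i a l h0 h1
  refine ⟨LinearMap.mk₂ k (fun v x => pureTensor k R X (coeffFace i x a)
    (Function.update (algFace (· * ·) i a) l' (g v))) ?_ ?_ ?_ ?_, fun v x => ?_⟩
  · intro v w x; simp [pureTensor, TensorProduct.tmul_add]
  · intro c v x; simp [pureTensor]
  · intro v x y; simp only [coeffFace]; split_ifs <;> simp [TensorProduct.add_tmul]
  · intro c v x
    simp only [coeffFace]
    split_ifs
    · rw [smul_comm, TensorProduct.smul_tmul']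
    · rw [smul_comm, TensorProduct.smul_tmul']
    · rw [TensorProduct.smul_tmul']
  · have : coeffFace i x (Function.update a l v) = coeffFace i x a := by
      simp only [coeffFace, Function.update_apply, Fin.ext_iff, Fin.val_zero, Fin.val_last]
      split_ifs <;> first | rfl | omega
    simp [hg, this]

/-- The `i`-th face map `X ⊗ R^{⊗ (n+1)} → X ⊗ R^{⊗ n}`. -/
noncomputable def face {n : ℕ} (i : Fin (n + 2)) : Chain k R X (n + 1) →ₗ[k] Chain k R X n :=
  TensorProduct.lift (LinearMap.flip (PiTensorProduct.lift
    { toFun := fun a =>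
        { toFun := fun x => pureTensor k R X (coeffFace i x a) (algFace (· * ·) i a)
          map_add' := by
            intro x y
            simp only [coeffFace]
            split_ifs <;> simp [TensorProduct.add_tmul]
          map_smul' := by
            intro c x
            simp only [coeffFace, RingHom.id_apply]
            split_ifs
            · rw [smul_comm, TensorProduct.smul_tmul']
            · rw [smul_comm, TensorProduct.smul_tmul']
            · rw [TensorProduct.smul_tmul'] }
      map_update_add' := by
        intro _ a l v w
        obtain ⟨φ, hφ⟩ := face_linear_in_each k (X := X) i a l
        ext x
        simp [hφ]
      map_update_smul' := by
        intro _ a l c v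
        obtain ⟨φ, hφ⟩ := face_linear_in_each k (X := X) i a l
        ext x
        simp [hφ] }))

@[simp]
theorem face_pureTensor {n : ℕ} (i : Fin (n + 2)) (x : X) (a : Fin (n + 1) → R) :
    face k i (pureTensor k R X x a) = pureTensor k R X (coeffFace i x a) (algFace (· * ·) i a) := by
  simp [face]

theorem chain_ext {n : ℕ} {Z : Type*} [AddCommGroup Z] [Module k Z]
    {f g : Chain k R X n →ₗ[k] Z} (h : ∀ x a, f (pureTensor k R X x a) = g (pureTensor k R X x a)) : f = g := by
  refine TensorProduct.ext' fun x t => ?_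
  have : f ∘ₗ TensorProduct.mk k X _ x = g ∘ₗ TensorProduct.mk k X _ x := by
    refine PiTensorProduct.ext (MultilinearMap.ext fun a => ?_)
    exact h x a
  exact LinearMap.congr_fun this t

theorem face_face [SMulCommClass R Rᵐᵒᵖ X] {n : ℕ} (i j : Fin (n + 2)) (h : i ≤ j) :
    (face k i ∘ₗ face k j.succ : Chain k R X (n + 2) →ₗ[k] _) = face k j ∘ₗ face k i.castSucc := by
  refine chain_ext k fun x a => ?_
  simp only [LinearMap.comp_apply, face_pureTensor]
  rw [algFace_algFace i j h, coeffFace_coeffFace i j h]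

variable (R X) in
/-- The Hochschild boundary `b = ∑ (-1)ⁱ (i-th face)`. -/
noncomputable def boundary (n : ℕ) : Chain k R X (n + 1) →ₗ[k] Chain k R X n :=
  ∑ i : Fin (n + 2), (-1 : k) ^ (i : ℕ) • face k i

theorem boundary_boundary [SMulCommClass R Rᵐᵒᵖ X] (n : ℕ) :
    boundary k R X n ∘ₗ boundary k R X (n + 1) = 0 := by
  refine LinearMap.ext fun t => ?_
  simp only [boundary, LinearMap.comp_apply, LinearMap.sum_apply, LinearMap.smul_apply, map_sum,
    map_smul, smul_smul, LinearMap.zero_apply, Finset.smul_sum]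
  rw [Finset.sum_comm, ← Finset.sum_product']
  let P := Fin (n + 2) × Fin (n + 3)
  let S : Finset P := {ij : P | (ij.2 : ℕ) ≤ (ij.1 : ℕ)}
  rw [Finset.univ_product_univ, ← Finset.sum_add_sum_compl S, ← eq_neg_iff_add_eq_zero,
    ← Finset.sum_neg_distrib]
  let φ : ∀ ij : P, ij ∈ S → P := fun ij hij =>
    (Fin.castLT ij.2 (lt_of_le_of_lt (Finset.mem_filter.mp hij).right (Fin.is_lt ij.1)), ij.1.succ)
  apply Finset.sum_bij φ
  · intro ij hij
    simp_rw [S, φ, Finset.compl_filter, Finset.mem_filter_univ, Fin.val_succ,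
      Fin.val_castLT] at hij ⊢
    lia
  · rintro ⟨i, j⟩ hij ⟨i', j'⟩ hij' h
    rw [Prod.mk_inj]
    exact ⟨by simpa [φ] using! congr_arg Prod.snd h,
      by simpa [φ, Fin.castSucc_castLT] using! congr_arg Fin.castSucc (congr_arg Prod.fst h)⟩
  · rintro ⟨i', j'⟩ hij'
    simp_rw [S, Finset.compl_filter, Finset.mem_filter_univ, not_le] at hij'
    refine ⟨(j'.pred <| ?_, Fin.castSucc i'), ?_, ?_⟩
    · rintro rfl
      simp only [Fin.val_zero, not_lt_zero] at hij'
    · simpa [S] using! Nat.le_sub_one_of_lt hij'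
    · simp only [φ, Fin.castLT_castSucc, Fin.succ_pred]
  · rintro ⟨i, j⟩ hij
    have hle : (j : ℕ) ≤ i := by simpa [S] using! hij
    have key := LinearMap.congr_fun (face_face k (R := R) (X := X)
      (j.castLT (lt_of_le_of_lt hle i.2)) i hle) t
    simp only [LinearMap.comp_apply, Fin.castSucc_castLT] at key
    simp only [φ, key, ← neg_smul, Fin.val_succ, Fin.val_castLT]
    congr 1
    ring

end Faces
end HochschildComplex

namespace HochschildComplex
variable (k R X : Type u) [Field k] [Ring R] [AddCommGroup X] [Module R X]
  [Module Rᵐᵒᵖ X] [Algebra k R] [Module k X] [IsScalarTower k R X] [IsScalarTower k Rᵐᵒᵖ X]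
  [SMulCommClass R Rᵐᵒᵖ X]

/-- The Hochschild chain complex `C_*(R, X)` of a `k`-algebra `R` with coefficients in an
`R`-bimodule `X`. -/
noncomputable def complex : ChainComplex (ModuleCat.{u} k) ℕ :=
  ChainComplex.of (fun n => ModuleCat.of k (Chain k R X n))
    (fun n => ModuleCat.ofHom (boundary k R X n))
    (fun n => by rw [← ModuleCat.ofHom_comp, boundary_boundary]; rfl)

theorem complex_d (n : ℕ) :
    (complex k R X).d (n + 1) n = ModuleCat.ofHom (boundary k R X n) := by
  exact ChainComplex.of_d (fun n => ModuleCat.of k (Chain k R X n))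
    (fun n => ModuleCat.ofHom (boundary k R X n)) n

end HochschildComplex

section NoncommutativeTensor

variable (k R X : Type u) [Field k] [Ring R] [Algebra k R] [AddCommGroup X] [Module k X]
  [Module Rᵐᵒᵖ X]

/-- The relations `x r ⊗ y = x ⊗ r y`. -/
def balancedRel (Y : Type u) [AddCommGroup Y] [Module k Y] [Module R Y] :
    Submodule k (X ⊗[k] Y) :=
  Submodule.span k {t | ∃ (x : X) (r : R) (y : Y),
    t = (MulOpposite.op r • x) ⊗ₜ[k] y - x ⊗ₜ[k] (r • y)}

/-- The tensor product `X ⊗_R Y` of a right module and a left module over a `k`-algebra `R`. -/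
abbrev TensorOver (Y : Type u) [AddCommGroup Y] [Module k Y] [Module R Y] : Type u :=
  (X ⊗[k] Y) ⧸ balancedRel k R X Y

attribute [local instance] ModuleCat.moduleOfAlgebraModule
  ModuleCat.isScalarTower_of_algebra_moduleCat

/-- The functor `X ⊗_R -`. -/
noncomputable def tensorOverFunctor : ModuleCat.{u} R ⥤ ModuleCat.{u} k where
  obj Y := ModuleCat.of k (TensorOver k R X Y)
  map {Y Z} f := ModuleCat.ofHom <| Submodule.mapQ _ _ ((f.hom.restrictScalars k).lTensor X) <| by
    refine Submodule.span_le.2 ?_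
    rintro _ ⟨x, r, y, rfl⟩
    refine Submodule.subset_span ⟨x, r, f.hom y, ?_⟩
    simp
  map_id Y := by
    ext : 1
    refine Submodule.linearMap_qext _ (TensorProduct.ext' fun x y => ?_)
    simp
  map_comp f g := by
    ext : 1
    exact Submodule.linearMap_qext _ (TensorProduct.ext' fun x y => rfl)

instance : (tensorOverFunctor k R X).Additive where
  map_add {Y Z f g} := by
    ext : 1
    refine Submodule.linearMap_qext _ (TensorProduct.ext' fun x y => ?_)
    exact congrArg (balancedRel k R X Z).mkQ (TensorProduct.tmul_add x (f.hom y) (g.hom y))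

/-- `Tor^R_n(X, Y)`: the `n`-th left derived functor of `X ⊗_R -`, evaluated at `Y`. -/
noncomputable def TorOver (Y : Type u) [AddCommGroup Y] [Module R Y] (n : ℕ) : ModuleCat.{u} k :=
  ((tensorOverFunctor k R X).leftDerived n).obj (ModuleCat.of R Y)

end NoncommutativeTensor

section Enveloping

variable (k B : Type u) [Field k] [Ring B] [Algebra k B]
  (X : Type u) [AddCommGroup X] [Module k X] [Module B X] [Module Bᵐᵒᵖ X]
  [SMulCommClass B Bᵐᵒᵖ X] [IsScalarTower k B X] [IsScalarTower k Bᵐᵒᵖ X]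

/-- The enveloping algebra `B^e = B ⊗ B^op`. -/
abbrev Env : Type u := B ⊗[k] Bᵐᵒᵖ

/-- A `B`-bimodule as a left `B^e`-module: `(b ⊗ b') x = b x b'`. -/
noncomputable abbrev leftEnvModule : Module (Env k B) X := TensorProduct.Algebra.module

/-- The anti-automorphism `b ⊗ b' ↦ b' ⊗ b` of `B^e`. -/
noncomputable def envSwap : (Env k B)ᵐᵒᵖ ≃ₐ[k] Env k B :=
  (Algebra.TensorProduct.opAlgEquiv k k B Bᵐᵒᵖ).symm.trans
    ((Algebra.TensorProduct.comm k Bᵐᵒᵖ Bᵐᵒᵖᵐᵒᵖ).trans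
      (Algebra.TensorProduct.congr (AlgEquiv.opOp k B).symm AlgEquiv.refl))

@[simp]
theorem envSwap_op_tmul (b c : B) :
    envSwap k B (MulOpposite.op (b ⊗ₜ MulOpposite.op c)) = c ⊗ₜ MulOpposite.op b := by
  simp [envSwap]

/-- A `B`-bimodule as a right `B^e`-module: `x (b ⊗ b') = b' x b`. -/
noncomputable abbrev rightEnvModule : Module (Env k B)ᵐᵒᵖ X :=
  letI := leftEnvModule k B X
  Module.compHom X (envSwap k B : (Env k B)ᵐᵒᵖ →+* Env k B)

theorem leftEnvModule_smul (b c : B) (x : X) :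
    letI := leftEnvModule k B X
    (b ⊗ₜ[k] MulOpposite.op c : Env k B) • x = b • MulOpposite.op c • x := rfl

theorem rightEnvModule_smul (b c : B) (x : X) :
    letI := rightEnvModule k B X
    (MulOpposite.op (b ⊗ₜ[k] MulOpposite.op c : Env k B)) • x = c • MulOpposite.op b • x := by
  let _ := leftEnvModule k B X
  change (envSwap k B (MulOpposite.op (b ⊗ₜ MulOpposite.op c))) • x = _
  rw [envSwap_op_tmul]
  rfl

variable (Y : Type u) [AddCommGroup Y] [Module k Y] [Module B Y] [Module Bᵐᵒᵖ Y]
  [SMulCommClass B Bᵐᵒᵖ Y] [IsScalarTower k B Y] [IsScalarTower k Bᵐᵒᵖ Y]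

/-- The relations defining `X ⊗_{B^e} Y`. -/
noncomputable def envRel : Submodule k (X ⊗[k] Y) :=
  letI := rightEnvModule k B X
  letI := leftEnvModule k B Y
  balancedRel k (Env k B) X Y

/-- `X ⊗_{B^e} Y` for `B`-bimodules `X` and `Y`. -/
def EnvTensor : Type u := (X ⊗[k] Y) ⧸ envRel k B X Y

namespace EnvTensor

noncomputable instance : AddCommGroup (EnvTensor k B X Y) := inferInstanceAs (AddCommGroup (_ ⧸ envRel k B X Y))
noncomputable instance : Module k (EnvTensor k B X Y) := inferInstanceAs (Module k (_ ⧸ envRel k B X Y))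

/-- The canonical map `X ⊗ Y → X ⊗_{B^e} Y`. -/
noncomputable def mk : X ⊗[k] Y →ₗ[k] EnvTensor k B X Y := (envRel k B X Y).mkQ

theorem mk_surjective : Function.Surjective (mk k B X Y) := Submodule.mkQ_surjective _

variable {X Y}

theorem mk_op_smul (b : B) (x : X) (y : Y) :
    mk k B X Y ((MulOpposite.op b • x) ⊗ₜ y) = mk k B X Y (x ⊗ₜ (b • y)) := by
  refine (Submodule.Quotient.eq _).2 (Submodule.subset_span ⟨x, b ⊗ₜ MulOpposite.op 1, y, ?_⟩)
  congr 2
  · exact ((rightEnvModule_smul k B X b 1 x).trans (by simp)).symm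
  · exact ((leftEnvModule_smul k B Y b 1 y).trans (by simp)).symm

theorem mk_smul (b : B) (x : X) (y : Y) :
    mk k B X Y ((b • x) ⊗ₜ y) = mk k B X Y (x ⊗ₜ (MulOpposite.op b • y)) := by
  refine (Submodule.Quotient.eq _).2 (Submodule.subset_span ⟨x, 1 ⊗ₜ MulOpposite.op b, y, ?_⟩)
  congr 2
  · exact ((rightEnvModule_smul k B X 1 b x).trans (by simp)).symm
  · exact ((leftEnvModule_smul k B Y 1 b y).trans (by simp)).symm

theorem ker_mk_le {Z : Type*} [AddCommGroup Z] [Module k Z] (L : X ⊗[k] Y →ₗ[k] Z)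
    (h₁ : ∀ (b : B) x y, L ((MulOpposite.op b • x) ⊗ₜ y) = L (x ⊗ₜ (b • y)))
    (h₂ : ∀ (b : B) x y, L ((b • x) ⊗ₜ y) = L (x ⊗ₜ (MulOpposite.op b • y))) :
    LinearMap.ker (mk k B X Y) ≤ LinearMap.ker L := by
  let _ := rightEnvModule k B X
  let _ := leftEnvModule k B Y
  suffices h : envRel k B X Y ≤ LinearMap.ker L from
    fun t ht => h ((Submodule.Quotient.mk_eq_zero _).1 ht)
  refine Submodule.span_le.2 ?_
  rintro _ ⟨x, r, y, rfl⟩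
  rw [SetLike.mem_coe, LinearMap.mem_ker, map_sub, sub_eq_zero]
  have e₀ : (MulOpposite.op (0 : Env k B) : (Env k B)ᵐᵒᵖ) • x = 0 := zero_smul (Env k B)ᵐᵒᵖ x
  have e₁ : (0 : Env k B) • y = 0 := zero_smul (Env k B) y
  induction r using TensorProduct.induction_on with
  | zero =>
    exact (congrArg L ((congrArg (· ⊗ₜ[k] y) e₀).trans (TensorProduct.zero_tmul _ _))).trans
      (congrArg L ((congrArg (x ⊗ₜ[k] ·) e₁).trans (TensorProduct.tmul_zero _ _))).symm
  | add r s hr hs =>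
    rw [MulOpposite.op_add, add_smul, add_smul, TensorProduct.add_tmul, TensorProduct.tmul_add,
      map_add, map_add, hr, hs]
  | tmul b c =>
    induction c using MulOpposite.rec' with
    | _ c =>
      rw [rightEnvModule_smul, leftEnvModule_smul, h₂, h₁]

end EnvTensor

/-- `Tor^{B^e}_n(X, Y)` for `B`-bimodules `X` and `Y`. -/
noncomputable def EnvTor (n : ℕ) : ModuleCat.{u} k :=
  letI := rightEnvModule k B X
  letI := leftEnvModule k B Y
  TorOver k (Env k B) X Y n

end Enveloping

section TensorPower

variable (k B N : Type u) [Field k] [Ring B] [Algebra k B]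
  [AddCommGroup N] [Module k N] [Module B N] [Module Bᵐᵒᵖ N]
  [SMulCommClass B Bᵐᵒᵖ N] [IsScalarTower k B N] [IsScalarTower k Bᵐᵒᵖ N]

/-- The relations `⋯ ⊗ mⱼ b ⊗ mⱼ₊₁ ⊗ ⋯ = ⋯ ⊗ mⱼ ⊗ b mⱼ₊₁ ⊗ ⋯` on `N ⊗ ⋯ ⊗ N` (tensor products
over `k`, with `n + 1` factors). -/
def tensorPowRel (n : ℕ) : Submodule k (⨂[k] _ : Fin (n + 1), N) :=
  Submodule.span k {t | ∃ (j : Fin n) (m : Fin (n + 1) → N) (b : B),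
    t = PiTensorProduct.tprod k
          (Function.update m j.castSucc (MulOpposite.op b • m j.castSucc)) -
        PiTensorProduct.tprod k (Function.update m j.succ (b • m j.succ))}

/-- The tensor power `N ⊗_B ⋯ ⊗_B N` with `n + 1` factors of a `B`-bimodule `N`. -/
def TensorPow (n : ℕ) : Type u := (⨂[k] _ : Fin (n + 1), N) ⧸ tensorPowRel k B N n

namespace TensorPow

instance (n : ℕ) : AddCommGroup (TensorPow k B N n) :=
  inferInstanceAs (AddCommGroup (_ ⧸ tensorPowRel k B N n))
instance (n : ℕ) : Module k (TensorPow k B N n) :=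
  inferInstanceAs (Module k (_ ⧸ tensorPowRel k B N n))

/-- The canonical map from the tensor power over `k` to the one over `B`. -/
def proj (n : ℕ) : (⨂[k] _ : Fin (n + 1), N) →ₗ[k] TensorPow k B N n :=
  (tensorPowRel k B N n).mkQ

theorem proj_surjective (n : ℕ) : Function.Surjective (proj k B N n) := Submodule.mkQ_surjective _

variable {k B N}

/-- The class of the pure tensor `m₀ ⊗ ⋯ ⊗ mₙ`. -/
def mk {n : ℕ} (m : Fin (n + 1) → N) : TensorPow k B N n :=
  proj k B N n (PiTensorProduct.tprod k m)

theorem ext {n : ℕ} {Z : Type*} [AddCommGroup Z] [Module k Z]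
    {f g : TensorPow k B N n →ₗ[k] Z} (h : ∀ m, f (mk m) = g (mk m)) : f = g := by
  refine Submodule.linearMap_qext _ (PiTensorProduct.ext (MultilinearMap.ext fun m => ?_))
  exact h m

theorem mk_rel {n : ℕ} (j : Fin n) (m : Fin (n + 1) → N) (b : B) :
    (mk (Function.update m j.castSucc (MulOpposite.op b • m j.castSucc)) : TensorPow k B N n) =
      mk (Function.update m j.succ (b • m j.succ)) :=
  (Submodule.Quotient.eq _).2 (Submodule.subset_span ⟨j, m, b, rfl⟩)

/-- Linear maps out of `N ⊗_B ⋯ ⊗_B N`. -/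
def lift {n : ℕ} {Z : Type*} [AddCommGroup Z] [Module k Z] (f : (⨂[k] _ : Fin (n + 1), N) →ₗ[k] Z)
    (h : ∀ (j : Fin n) (m : Fin (n + 1) → N) (b : B),
      f (PiTensorProduct.tprod k
          (Function.update m j.castSucc (MulOpposite.op b • m j.castSucc))) =
        f (PiTensorProduct.tprod k (Function.update m j.succ (b • m j.succ)))) :
    TensorPow k B N n →ₗ[k] Z :=
  (tensorPowRel k B N n).liftQ f <| by
    refine Submodule.span_le.2 ?_
    rintro _ ⟨j, m, b, rfl⟩
    rw [SetLike.mem_coe, LinearMap.mem_ker, map_sub, sub_eq_zero, h]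

theorem map_update_tprod {n : ℕ} (i : Fin (n + 1)) (φ : Module.End k N) (m : Fin (n + 1) → N) :
    PiTensorProduct.map (Function.update (fun _ => (LinearMap.id : Module.End k N)) i φ)
      (PiTensorProduct.tprod k m) = PiTensorProduct.tprod k (Function.update m i (φ (m i))) := by
  rw [PiTensorProduct.map_tprod]
  congr 1
  funext j
  by_cases h : j = i
  · subst h; simp
  · simp [h]

/-- Left multiplication by `b` on the first factor. -/
noncomputable def lmul (n : ℕ) (b : B) : Module.End k (TensorPow k B N n) :=
  Submodule.mapQ _ _ (PiTensorProduct.map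
    (Function.update (fun _ => LinearMap.id) 0 (Module.toModuleEnd k (S := B) N b))) <| by
    refine Submodule.span_le.2 ?_
    rintro _ ⟨j, m, c, rfl⟩
    refine Submodule.subset_span ⟨j, Function.update m 0 (b • m 0), c, ?_⟩
    rw [map_sub, map_update_tprod, map_update_tprod]
    congr 2 <;> funext l
    · by_cases h0 : j.castSucc = 0
      · rw [h0]
        by_cases hl : l = 0
        · subst hl; simp [smul_comm]
        · simp [hl]
      · rw [Function.update_of_ne h0, Function.update_of_ne (Ne.symm h0),
          Function.update_comm h0]
        simp
    · have h0 : j.succ ≠ 0 := Fin.succ_ne_zero j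
      rw [Function.update_of_ne h0, Function.update_of_ne (Ne.symm h0),
          Function.update_comm h0]
      simp

/-- Right multiplication by `b` on the last factor. -/
noncomputable def rmul (n : ℕ) (b : Bᵐᵒᵖ) : Module.End k (TensorPow k B N n) :=
  Submodule.mapQ _ _ (PiTensorProduct.map
    (Function.update (fun _ => LinearMap.id) (Fin.last n)
      (Module.toModuleEnd k (S := Bᵐᵒᵖ) N b))) <| by
    refine Submodule.span_le.2 ?_
    rintro _ ⟨j, m, c, rfl⟩
    refine Submodule.subset_span ⟨j, Function.update m (Fin.last n) (b • m (Fin.last n)), c, ?_⟩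
    rw [map_sub, map_update_tprod, map_update_tprod]
    congr 2 <;> funext l
    · have h0 : j.castSucc ≠ Fin.last n := (Fin.castSucc_lt_last j).ne
      rw [Function.update_of_ne h0, Function.update_of_ne (Ne.symm h0),
          Function.update_comm h0]
      simp
    · by_cases h0 : j.succ = Fin.last n
      · rw [h0]
        by_cases hl : l = Fin.last n
        · subst hl; simp [smul_comm]
        · simp [hl]
      · rw [Function.update_of_ne h0, Function.update_of_ne (Ne.symm h0),
          Function.update_comm h0]
        simp

@[simp]
theorem lmul_mk {n : ℕ} (b : B) (m : Fin (n + 1) → N) :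
    (lmul n b : Module.End k (TensorPow k B N n)) (mk m) = mk (Function.update m 0 (b • m 0)) :=
  congrArg (proj k B N n) (map_update_tprod _ _ _)

@[simp]
theorem rmul_mk {n : ℕ} (b : Bᵐᵒᵖ) (m : Fin (n + 1) → N) :
    (rmul n b : Module.End k (TensorPow k B N n)) (mk m) = mk (Function.update m (Fin.last n) (b • m (Fin.last n))) :=
  congrArg (proj k B N n) (map_update_tprod _ _ _)

theorem mk_update_add {n : ℕ} (m : Fin (n + 1) → N) (i : Fin (n + 1)) (x y : N) :
    (mk (Function.update m i (x + y)) : TensorPow k B N n) =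
      mk (Function.update m i x) + mk (Function.update m i y) := by
  simp [mk]

theorem mk_update_smul {n : ℕ} (m : Fin (n + 1) → N) (i : Fin (n + 1)) (c : k) (x : N) :
    (mk (Function.update m i (c • x)) : TensorPow k B N n) = c • mk (Function.update m i x) := by
  simp [mk]

theorem mk_update_zero {n : ℕ} (m : Fin (n + 1) → N) (i : Fin (n + 1)) :
    (mk (Function.update m i 0) : TensorPow k B N n) = 0 := by
  simp [mk]

variable (k B N) in
/-- The left action of `B` as a ring homomorphism. -/
noncomputable def lmulHom (n : ℕ) : B →+* Module.End k (TensorPow k B N n) where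
  toFun := lmul n
  map_one' := ext fun m => by simp
  map_mul' b c := ext fun m => by simp [mul_smul]
  map_zero' := ext fun m => by simp [mk_update_zero]
  map_add' b c := ext fun m => by simp [add_smul, mk_update_add]

variable (k B N) in
/-- The right action of `B` as a ring homomorphism. -/
noncomputable def rmulHom (n : ℕ) : Bᵐᵒᵖ →+* Module.End k (TensorPow k B N n) where
  toFun := rmul n
  map_one' := ext fun m => by simp
  map_mul' b c := ext fun m => by simp [mul_smul]
  map_zero' := ext fun m => by simp [mk_update_zero]
  map_add' b c := ext fun m => by simp [add_smul, mk_update_add]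

noncomputable instance (n : ℕ) : Module B (TensorPow k B N n) := Module.compHom _ (lmulHom k B N n)

noncomputable instance (n : ℕ) : Module Bᵐᵒᵖ (TensorPow k B N n) :=
  Module.compHom _ (rmulHom k B N n)

theorem smul_eq {n : ℕ} (b : B) (q : TensorPow k B N n) :
    b • q = (lmul n b : Module.End k (TensorPow k B N n)) q := rfl

theorem op_smul_eq {n : ℕ} (b : Bᵐᵒᵖ) (q : TensorPow k B N n) :
    b • q = (rmul n b : Module.End k (TensorPow k B N n)) q := rfl

instance (n : ℕ) : SMulCommClass B Bᵐᵒᵖ (TensorPow k B N n) where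
  smul_comm b c q := by
    simp only [smul_eq, op_smul_eq]
    refine LinearMap.congr_fun (f := lmul n b ∘ₗ rmul n c) (g := rmul n c ∘ₗ lmul n b)
      (ext fun m => ?_) q
    simp only [LinearMap.comp_apply, lmul_mk, rmul_mk]
    congr 1
    by_cases h : (0 : Fin (n + 1)) = Fin.last n
    · rw [← h]; simp [smul_comm]
    · rw [Function.update_of_ne h, Function.update_of_ne (Ne.symm h), Function.update_comm h]

instance (n : ℕ) : IsScalarTower k B (TensorPow k B N n) where
  smul_assoc c b q := by
    simp only [smul_eq]
    refine LinearMap.congr_fun (f := lmul n (c • b)) (g := c • lmul n b) (ext fun m => ?_) q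
    simp [mk_update_smul]

instance (n : ℕ) : IsScalarTower k Bᵐᵒᵖ (TensorPow k B N n) where
  smul_assoc c b q := by
    simp only [op_smul_eq]
    refine LinearMap.congr_fun (f := rmul n (c • b)) (g := c • rmul n b) (ext fun m => ?_) q
    simp [mk_update_smul]

end TensorPow
end TensorPower

/-- A split extension of `k`-algebras: an algebra map `incl : B → A` (the inclusion of the
subalgebra `B`) together with an algebra retraction `retr : A → B`. -/
structure SplitExtension (k A B : Type u) [Field k] [Ring A] [Algebra k A] [Ring B]
    [Algebra k B] where
  incl : B →ₐ[k] A
  retr : A →ₐ[k] B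
  retr_incl : ∀ b, retr (incl b) = b

namespace SplitExtension

variable {k A B : Type u} [Field k] [Ring A] [Algebra k A] [Ring B] [Algebra k B]
  (S : SplitExtension k A B)

/-- The two-sided ideal `M = ker retr`, so that `A = B ⊕ M`. -/
def ideal : Submodule k A := LinearMap.ker S.retr.toLinearMap

theorem mem_ideal {a : A} : a ∈ S.ideal ↔ S.retr a = 0 := Iff.rfl

instance : SMul B S.ideal := ⟨fun b m => ⟨S.incl b * m, by
  rw [mem_ideal, map_mul, S.mem_ideal.1 m.2, mul_zero]⟩⟩

instance : SMul Bᵐᵒᵖ S.ideal := ⟨fun b m => ⟨m * S.incl b.unop, by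
  rw [mem_ideal, map_mul, S.mem_ideal.1 m.2, zero_mul]⟩⟩

@[simp]
theorem coe_smul (b : B) (m : S.ideal) : ((b • m : S.ideal) : A) = S.incl b * m := rfl

@[simp]
theorem coe_op_smul (b : Bᵐᵒᵖ) (m : S.ideal) : ((b • m : S.ideal) : A) = m * S.incl b.unop := rfl

/-- `M` as a left `B`-module. -/
instance : Module B S.ideal where
  one_smul m := Subtype.ext (by simp)
  mul_smul b c m := Subtype.ext (by simp [mul_assoc])
  smul_zero b := Subtype.ext (by simp)
  smul_add b m n := Subtype.ext (by simp [mul_add])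
  add_smul b c m := Subtype.ext (by simp [add_mul])
  zero_smul m := Subtype.ext (by simp)

/-- `M` as a right `B`-module. -/
instance : Module Bᵐᵒᵖ S.ideal where
  one_smul m := Subtype.ext (by simp)
  mul_smul b c m := Subtype.ext (by simp [mul_assoc])
  smul_zero b := Subtype.ext (by simp)
  smul_add b m n := Subtype.ext (by simp [add_mul])
  add_smul b c m := Subtype.ext (by simp [mul_add])
  zero_smul m := Subtype.ext (by simp)

instance : SMulCommClass B Bᵐᵒᵖ S.ideal := ⟨fun b c m => Subtype.ext (by simp [mul_assoc])⟩

instance : IsScalarTower k B S.ideal := ⟨fun c b m => Subtype.ext (by simp)⟩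

instance : IsScalarTower k Bᵐᵒᵖ S.ideal := ⟨fun c b m => Subtype.ext (by simp)⟩

/-- The component `a ↦ a_M` of the decomposition `A = B ⊕ M`. -/
noncomputable def projM : A →ₗ[k] S.ideal :=
  LinearMap.codRestrict S.ideal (LinearMap.id - S.incl.toLinearMap ∘ₗ S.retr.toLinearMap)
    (fun a => by simp [mem_ideal, S.retr_incl])

@[simp]
theorem coe_projM (a : A) : (S.projM a : A) = a - S.incl (S.retr a) := rfl

theorem projM_incl (b : B) : S.projM (S.incl b) = 0 := Subtype.ext (by simp [S.retr_incl])

theorem eq_incl_of_projM {a : A} (h : S.projM a = 0) : a = S.incl (S.retr a) := by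
  have := congrArg Subtype.val h
  simpa [sub_eq_zero] using this

@[simp]
theorem projM_coe (m : S.ideal) : S.projM (m : A) = m :=
  Subtype.ext (by simp [S.mem_ideal.1 m.2])

theorem projM_mul_right {a b : A} (h : S.projM b = 0) :
    S.projM (a * b) = MulOpposite.op (S.retr b) • S.projM a := by
  refine Subtype.ext ?_
  rw [S.eq_incl_of_projM h]
  simp [S.retr_incl, sub_mul]

theorem projM_mul_left {a b : A} (h : S.projM a = 0) :
    S.projM (a * b) = S.retr a • S.projM b := by
  refine Subtype.ext ?_
  rw [S.eq_incl_of_projM h]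
  simp [S.retr_incl, mul_sub]

section Res

/-- An `A`-bimodule `X`, regarded as a `B`-bimodule by restriction of scalars. -/
def Res (_ : SplitExtension k A B) (X : Type u) : Type u := X

variable (X : Type u) [AddCommGroup X] [Module k X] [Module A X] [Module Aᵐᵒᵖ X]
  [SMulCommClass A Aᵐᵒᵖ X] [IsScalarTower k A X] [IsScalarTower k Aᵐᵒᵖ X]

instance : AddCommGroup (S.Res X) := inferInstanceAs (AddCommGroup X)
instance : Module k (S.Res X) := inferInstanceAs (Module k X)
noncomputable instance : Module B (S.Res X) :=
  Module.compHom X (S.incl : B →+* A)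
noncomputable instance : Module Bᵐᵒᵖ (S.Res X) :=
  Module.compHom X (RingHom.op (S.incl : B →+* A))

/-- The identity map `X → X`. -/
def toRes : X ≃ₗ[k] S.Res X := LinearEquiv.refl k X

variable {X}

theorem smul_toRes (b : B) (x : X) : b • S.toRes X x = S.toRes X (S.incl b • x) := rfl

theorem op_smul_toRes (b : B) (x : X) :
    MulOpposite.op b • S.toRes X x = S.toRes X (MulOpposite.op (S.incl b) • x) := rfl

variable (X)

instance : SMulCommClass B Bᵐᵒᵖ (S.Res X) :=
  ⟨fun b c x => smul_comm (S.incl b) (MulOpposite.op (S.incl c.unop)) (show X from x)⟩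

instance : IsScalarTower k B (S.Res X) :=
  ⟨fun c b x => by
    change S.incl (c • b) • (show X from x) = c • (S.incl b • (show X from x))
    rw [map_smul, smul_assoc]⟩

instance : IsScalarTower k Bᵐᵒᵖ (S.Res X) :=
  ⟨fun c b x => by
    change MulOpposite.op (S.incl (c • b.unop)) • (show X from x) =
      c • (MulOpposite.op (S.incl b.unop) • (show X from x))
    rw [map_smul, MulOpposite.op_smul, smul_assoc]⟩

end Res

section Sequence

open HochschildComplex

variable (X : Type u) [AddCommGroup X] [Module k X] [Module A X] [Module Aᵐᵒᵖ X]
  [SMulCommClass A Aᵐᵒᵖ X] [IsScalarTower k A X] [IsScalarTower k Aᵐᵒᵖ X]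

/-- The complex `C_*(A, X)`. -/
noncomputable abbrev complexA (_ : SplitExtension k A B) : ChainComplex (ModuleCat.{u} k) ℕ :=
  HochschildComplex.complex k A X

/-- The complex `C_*(B, X)`. -/
noncomputable abbrev complexB : ChainComplex (ModuleCat.{u} k) ℕ :=
  HochschildComplex.complex k B (S.Res X)

/-- The map `x ⊗ b₁ ⊗ ⋯ ⊗ bₙ ↦ x ⊗ b₁ ⊗ ⋯ ⊗ bₙ`. -/
noncomputable def iotaLin (n : ℕ) : Chain k B (S.Res X) n →ₗ[k] Chain k A X n :=
  TensorProduct.map (S.toRes X).symm.toLinearMap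
    (PiTensorProduct.map fun _ => S.incl.toLinearMap)

/-- The tensor power `M ⊗_B ⋯ ⊗_B M` with `n + 1` factors. -/
abbrev MPow (n : ℕ) : Type u := TensorPow k B S.ideal n

/-- `X ⊗_{B^e} M^{⊗_B (n + 1)}`. -/
abbrev RelChain (n : ℕ) : Type u := EnvTensor k B (S.Res X) (S.MPow n)

/-- The map `x ⊗ a₀ ⊗ ⋯ ⊗ aₙ ↦ x ⊗ [(a₀)_M ⊗_B ⋯ ⊗_B (aₙ)_M]`. -/
noncomputable def kappaLin (n : ℕ) : Chain k A X (n + 1) →ₗ[k] S.RelChain X n :=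
  EnvTensor.mk k B (S.Res X) (S.MPow n) ∘ₗ
    TensorProduct.map (S.toRes X).toLinearMap
      (TensorPow.proj k B S.ideal n ∘ₗ PiTensorProduct.map fun _ => S.projM)

variable {X}

/-- The class of `x ⊗ q` in `X ⊗_{B^e} M^{⊗_B (n + 1)}`. -/
noncomputable def relMk {n : ℕ} (x : X) (q : S.MPow n) : S.RelChain X n :=
  EnvTensor.mk k B (S.Res X) (S.MPow n) (S.toRes X x ⊗ₜ q)

theorem kappaLin_pureTensor {n : ℕ} (x : X) (a : Fin (n + 1) → A) :
    S.kappaLin X n (pureTensor k A X x a) = S.relMk x (TensorPow.mk fun i => S.projM (a i)) := by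
  simp [kappaLin, relMk, TensorPow.mk]

theorem relMk_op_smul {n : ℕ} (b : B) (x : X) (q : S.MPow n) :
    S.relMk (MulOpposite.op (S.incl b) • x) q = S.relMk x (b • q) :=
  EnvTensor.mk_op_smul k B b (S.toRes X x) q

theorem relMk_smul {n : ℕ} (b : B) (x : X) (q : S.MPow n) :
    S.relMk (S.incl b • x) q = S.relMk x (MulOpposite.op b • q) :=
  EnvTensor.mk_smul k B b (S.toRes X x) q

theorem kappaLin_eq_zero {n : ℕ} (x : X) (a : Fin (n + 1) → A) (j : Fin (n + 1))
    (h : S.projM (a j) = 0) : S.kappaLin X n (pureTensor k A X x a) = 0 := by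
  have : (TensorPow.mk fun i => S.projM (a i) : S.MPow n) = 0 := by
    have e : (fun i => S.projM (a i)) = Function.update (fun i => S.projM (a i)) j 0 := by
      rw [← h, Function.update_eq_self]
    rw [e, TensorPow.mk_update_zero]
  rw [kappaLin_pureTensor, this]
  simp [relMk]

theorem kappaLin_face {n : ℕ} (x : X) (a : Fin (n + 2) → A) (j : Fin (n + 2))
    (h : S.projM (a j) = 0) :
    S.kappaLin X n (face k j.castSucc (pureTensor k A X x a)) =
      S.kappaLin X n (face k j.succ (pureTensor k A X x a)) := by
  have ha := S.eq_incl_of_projM h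
  set b := S.retr (a j) with hb
  simp only [face_pureTensor, kappaLin_pureTensor]
  have hj := j.2
  by_cases h0 : (j : ℕ) = 0
  · obtain rfl : j = 0 := Fin.ext h0
    have e1 : (coeffFace (Fin.castSucc (0 : Fin (n + 2))) x a : X) =
        MulOpposite.op (S.incl b) • x := by simp [coeffFace, ha]
    have e2 : (coeffFace (Fin.succ (0 : Fin (n + 2))) x a : X) = x := by simp [coeffFace]
    rw [e1, e2, relMk_op_smul, TensorPow.smul_eq, TensorPow.lmul_mk]
    congr 2
    funext l
    by_cases hl : l = 0
    · subst hl
      simp [algFace, S.projM_mul_left h, hb]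
    · have : (l : ℕ) ≠ 0 := fun h' => hl (Fin.ext h')
      simp [algFace, hl]
  by_cases h1 : (j : ℕ) = n + 1
  · obtain rfl : j = Fin.last (n + 1) := Fin.ext h1
    have e1 : (coeffFace (Fin.castSucc (Fin.last (n + 1))) x a : X) = x := by simp [coeffFace]
    have e2 : (coeffFace (Fin.succ (Fin.last (n + 1))) x a : X) = S.incl b • x := by
      simp [coeffFace, ← ha]
    rw [e1, e2, relMk_smul, TensorPow.op_smul_eq, TensorPow.rmul_mk]
    congr 2
    funext l
    have hl2 := l.2
    by_cases hl : l = Fin.last n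
    · subst hl
      simp [algFace, S.projM_mul_right h, hb]
    · have : (l : ℕ) < n := by
        have : (l : ℕ) ≠ n := fun h' => hl (Fin.ext h')
        omega
      simp [algFace, hl, this, this.le]
  have e1 : (coeffFace j.castSucc x a : X) = x := by
    simp only [coeffFace, Fin.val_castSucc, h0, if_false]
    rw [if_neg (by omega)]
  have e2 : (coeffFace j.succ x a : X) = x := by
    simp only [coeffFace, Fin.val_succ]
    rw [if_neg (by omega), if_neg (by omega)]
  rw [e1, e2]
  congr 1
  let i : Fin n := ⟨j - 1, by omega⟩
  let m : Fin (n + 1) → S.ideal := fun l =>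
    if (l : ℕ) < j then S.projM (a l.castSucc) else S.projM (a l.succ)
  have key := TensorPow.mk_rel (k := k) i m b
  have hi1 : i.castSucc.succ = j := by simp [i, Fin.ext_iff]; omega
  have hi2 : i.succ.castSucc = j := by simp [i, Fin.ext_iff]; omega
  convert key using 2
  · funext l
    by_cases hl : l = i.castSucc
    · subst hl
      have hv : (i.castSucc : ℕ) = j - 1 := rfl
      have hlt : (i.castSucc : ℕ) < j := by omega
      simp only [algFace, Function.update_self, m, hlt, if_true, Fin.val_castSucc (n := n + 2)]
      rw [if_neg (by omega), if_pos (by omega), hi1, S.projM_mul_right h]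
    · rw [Function.update_of_ne hl]
      have hv : (l : ℕ) ≠ j - 1 := fun h' => hl (Fin.ext h')
      simp only [algFace, m, Fin.val_castSucc (n := n + 2)]
      split_ifs <;> first | omega | rfl
  · funext l
    by_cases hl : l = i.succ
    · subst hl
      have hv : (i.succ : ℕ) = j := by simp [i]; omega
      have hlt : ¬(i.succ : ℕ) < j := by omega
      simp only [algFace, Function.update_self, m, hlt, if_false, Fin.val_succ j]
      rw [if_neg (by omega), if_pos (by omega), hi2, S.projM_mul_left h]
    · rw [Function.update_of_ne hl]
      have hv : (l : ℕ) ≠ j := fun h' => hl (Fin.ext (by simp [i]; omega))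
      simp only [algFace, m, Fin.val_succ j]
      split_ifs <;> first | omega | rfl

theorem exists_projM_algFace {n : ℕ} (a : Fin (n + 1) → A) (j : Fin (n + 1))
    (h : S.projM (a j) = 0) (i : Fin (n + 2)) (h1 : i ≠ j.castSucc) (h2 : i ≠ j.succ) :
    ∃ l, S.projM (algFace (· * ·) i a l) = 0 := by
  have h1' : (i : ℕ) ≠ j := fun h' => h1 (Fin.ext h')
  have h2' : (i : ℕ) ≠ j + 1 := fun h' => h2 (Fin.ext h')
  have hi := i.2
  have hj := j.2
  by_cases hij : (i : ℕ) < j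
  · refine ⟨⟨j - 1, by omega⟩, ?_⟩
    have e : (⟨j - 1, by omega⟩ : Fin n).succ = j := by simp [Fin.ext_iff]; omega
    simp only [algFace]
    rw [if_neg (by omega), if_neg (by omega), e, h]
  · refine ⟨⟨j, by omega⟩, ?_⟩
    have e : (⟨j, by omega⟩ : Fin n).castSucc = j := by simp
    simp only [algFace]
    rw [if_pos (by omega), e, h]

theorem boundary_apply (n : ℕ) (t : Chain k A X (n + 1)) :
    boundary k A X n t = ∑ i : Fin (n + 2), (-1 : k) ^ (i : ℕ) • face k i t := by
  simp [boundary]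

/-- Splitting two neighbouring terms off an alternating sum. -/
theorem alternating_sum_split {V : Type*} [AddCommGroup V] [Module k V] {n : ℕ}
    (f : Fin (n + 2) → V) (j : Fin (n + 1))
    (h : ∀ i, i ≠ j.castSucc → i ≠ j.succ → f i = 0) :
    ∑ i : Fin (n + 2), (-1 : k) ^ (i : ℕ) • f i = (-1 : k) ^ (j : ℕ) • (f j.castSucc - f j.succ) := by
  have hne : j.castSucc ≠ j.succ := (Fin.castSucc_lt_succ).ne
  rw [← Finset.sum_subset (Finset.subset_univ {j.castSucc, j.succ}), Finset.sum_pair hne]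
  · simp [pow_succ, sub_eq_add_neg]
  · intro i _ hi
    simp only [Finset.mem_insert, Finset.mem_singleton, not_or] at hi
    rw [h i hi.1 hi.2, smul_zero]

theorem kappaLin_boundary_eq_zero {n : ℕ} (x : X) (a : Fin (n + 2) → A) (j : Fin (n + 2))
    (h : S.projM (a j) = 0) :
    S.kappaLin X n (boundary k A X (n + 1) (pureTensor k A X x a)) = 0 := by
  rw [boundary_apply, map_sum]
  simp only [map_smul]
  rw [alternating_sum_split (fun i => S.kappaLin X n (face k i (pureTensor k A X x a))) j,
    S.kappaLin_face x a j h, sub_self, smul_zero]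
  intro i h1 h2
  obtain ⟨l, hl⟩ := S.exists_projM_algFace a j h i h1 h2
  rw [face_pureTensor]
  exact S.kappaLin_eq_zero _ _ l hl

theorem kappaLin_boundary_face {n : ℕ} (x : X) (a : Fin (n + 3) → A) (j : Fin (n + 3))
    (h : S.projM (a j) = 0) :
    S.kappaLin X n (boundary k A X (n + 1) (face k j.castSucc (pureTensor k A X x a))) =
      S.kappaLin X n (boundary k A X (n + 1) (face k j.succ (pureTensor k A X x a))) := by
  have key : S.kappaLin X n (boundary k A X (n + 1)
      (boundary k A X (n + 2) (pureTensor k A X x a))) = 0 := by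
    have := LinearMap.congr_fun (boundary_boundary k (R := A) (X := X) (n + 1))
      (pureTensor k A X x a)
    rw [LinearMap.comp_apply] at this
    rw [this, LinearMap.zero_apply, map_zero]
  rw [boundary_apply (n + 2), map_sum, map_sum] at key
  simp only [map_smul] at key
  rw [alternating_sum_split (fun i => S.kappaLin X n (boundary k A X (n + 1)
    (face k i (pureTensor k A X x a)))) j] at key
  · rcases smul_eq_zero.1 key with h' | h'
    · exact absurd h' (pow_ne_zero _ (by simp))
    · exact sub_eq_zero.1 h'
  intro i h1 h2
  obtain ⟨l, hl⟩ := S.exists_projM_algFace a j h i h1 h2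
  rw [face_pureTensor]
  exact S.kappaLin_boundary_eq_zero _ _ l hl

theorem kappaLin_surjective (n : ℕ) : Function.Surjective (S.kappaLin X n) := by
  refine (EnvTensor.mk_surjective k B (S.Res X) (S.MPow n)).comp
    (TensorProduct.map_surjective (S.toRes X).surjective
      ((TensorPow.proj_surjective k B S.ideal n).comp ?_))
  intro t
  refine ⟨PiTensorProduct.map (fun _ => S.ideal.subtype) t, ?_⟩
  rw [← LinearMap.comp_apply, ← PiTensorProduct.map_comp]
  have : (fun _ : Fin (n + 1) => S.projM ∘ₗ S.ideal.subtype) = fun _ => LinearMap.id := by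
    funext _; ext m; simp
  rw [this, PiTensorProduct.map_id]
  rfl

theorem map_pureTensor_projM {Z : Type*} [AddCommGroup Z] [Module k Z] {n : ℕ}
    (L : Chain k A X n →ₗ[k] Z)
    (hL : ∀ (x : X) (a : Fin n → A) (j : Fin n), S.projM (a j) = 0 → L (pureTensor k A X x a) = 0)
    (x : X) (a : Fin n → A) :
    L (pureTensor k A X x a) = L (pureTensor k A X x fun i => (S.projM (a i) : A)) := by
  have key : ∀ s : Finset (Fin n),
      L (pureTensor k A X x (s.piecewise (fun i => (S.projM (a i) : A)) a)) =
        L (pureTensor k A X x a) := by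
    intro s
    induction s using Finset.induction_on with
    | empty => simp
    | insert i s hi ih =>
      rw [← ih, Finset.piecewise_insert, ← sub_eq_zero, ← map_sub]
      set p := s.piecewise (fun i => (S.projM (a i) : A)) a with hp
      have hpi : p i = a i := by simp [hp, hi]
      have : pureTensor k A X x (Function.update p i (S.projM (a i) : A)) - pureTensor k A X x p =
          pureTensor k A X x (Function.update p i ((S.projM (a i) : A) - a i)) := by
        conv_lhs => rw [← Function.update_eq_self i p, hpi]
        simp only [pureTensor, MultilinearMap.map_update_sub, TensorProduct.tmul_sub,
          Function.update_idem]
      rw [this]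
      refine hL _ _ i ?_
      simp [-coe_projM]
  simpa using (key Finset.univ).symm

/-- Insertion of `c` at position `j`. -/
def insertAt {n : ℕ} (j : Fin (n + 1)) (c : A) (a : Fin n → A) (l : Fin (n + 1)) : A :=
  if h : (l : ℕ) < j then a ⟨l, by omega⟩
  else if h' : (l : ℕ) = j then c else a ⟨l - 1, by omega⟩

theorem insertAt_self {n : ℕ} (j : Fin (n + 1)) (c : A) (a : Fin n → A) :
    insertAt j c a j = c := by simp [insertAt]

theorem algFace_insertAt_castSucc {n : ℕ} (i : Fin n) (c : A) (a : Fin n → A) :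
    algFace (· * ·) i.succ.castSucc (insertAt i.succ c a) = Function.update a i (a i * c) := by
  funext l
  have hl := l.2
  by_cases h : l = i
  · subst h
    simp [algFace, insertAt]
  · rw [Function.update_of_ne h]
    have h' : (l : ℕ) ≠ i := fun e => h (Fin.ext e)
    simp only [algFace, insertAt, Fin.val_succ, Fin.val_castSucc]
    split_ifs <;> first | omega | rfl

theorem algFace_insertAt_succ {n : ℕ} (i : Fin n) (c : A) (a : Fin n → A) :
    algFace (· * ·) i.castSucc.succ (insertAt i.castSucc c a) = Function.update a i (c * a i) := by
  funext l
  have hl := l.2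
  by_cases h : l = i
  · subst h
    simp [algFace, insertAt]
  · rw [Function.update_of_ne h]
    have h' : (l : ℕ) ≠ i := fun e => h (Fin.ext e)
    simp only [algFace, insertAt, Fin.val_succ, Fin.val_castSucc]
    split_ifs <;> first | omega | rfl

theorem algFace_insertAt_zero {n : ℕ} (c : A) (a : Fin n → A) :
    algFace (· * ·) 0 (insertAt 0 c a) = a := by
  funext l
  simp [algFace, insertAt]

theorem algFace_insertAt_last {n : ℕ} (c : A) (a : Fin n → A) :
    algFace (· * ·) (Fin.last (n + 1)) (insertAt (Fin.last n) c a) = a := by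
  funext l
  have := l.2
  simp [algFace, insertAt]

theorem ker_kappaLin_le (n : ℕ) :
    LinearMap.ker (S.kappaLin X (n + 1)) ≤
      LinearMap.ker (S.kappaLin X n ∘ₗ boundary k A X (n + 1)) := by
  set L := S.kappaLin X n ∘ₗ boundary k A X (n + 1) with hLdef
  have hL : ∀ (x : X) (a : Fin (n + 2) → A) (j : Fin (n + 2)), S.projM (a j) = 0 →
      L (pureTensor k A X x a) = 0 := fun x a j h => S.kappaLin_boundary_eq_zero x a j h
  have hLM := S.map_pureTensor_projM L hL
  have hLf : ∀ (x : X) (a : Fin (n + 3) → A) (j : Fin (n + 3)), S.projM (a j) = 0 →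
      L (face k j.castSucc (pureTensor k A X x a)) =
        L (face k j.succ (pureTensor k A X x a)) :=
    fun x a j h => S.kappaLin_boundary_face x a j h
  clear_value L
  have hup : ∀ (m : Fin (n + 2) → S.ideal) (i : Fin (n + 2)) (m' : S.ideal) ,
      (fun l => (Function.update m i m' l : A)) = Function.update (fun l => (m l : A)) i m' := by
    intro m i m'
    funext l
    by_cases h : l = i
    · subst h; simp
    · simp [h]
  have r0 : ∀ (x : X) (m : Fin (n + 2) → S.ideal) (b : B),
      L (pureTensor k A X (MulOpposite.op (S.incl b) • x) fun l => (m l : A)) =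
        L (pureTensor k A X x fun l => (Function.update m 0 (b • m 0) l : A)) := by
    intro x m b
    have := hLf x (insertAt 0 (S.incl b) fun l => (m l : A)) 0 (by
      rw [insertAt_self, S.projM_incl])
    rw [face_pureTensor, face_pureTensor, Fin.castSucc_zero, algFace_insertAt_zero] at this
    have e := algFace_insertAt_succ (0 : Fin (n + 2)) (S.incl b) fun l => (m l : A)
    rw [Fin.castSucc_zero] at e
    rw [e] at this
    rw [hup]
    simpa [coeffFace, insertAt_self] using this
  have r1 : ∀ (x : X) (m : Fin (n + 2) → S.ideal) (b : B),
      L (pureTensor k A X (S.incl b • x) fun l => (m l : A)) =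
        L (pureTensor k A X x fun l => (Function.update m (Fin.last (n + 1))
          (MulOpposite.op b • m (Fin.last (n + 1))) l : A)) := by
    intro x m b
    have := hLf x (insertAt (Fin.last (n + 2)) (S.incl b) fun l => (m l : A)) (Fin.last (n + 2)) (by
      rw [insertAt_self, S.projM_incl])
    rw [face_pureTensor, face_pureTensor, Fin.succ_last, algFace_insertAt_last] at this
    have e := algFace_insertAt_castSucc (Fin.last (n + 1)) (S.incl b) fun l => (m l : A)
    rw [Fin.succ_last] at e
    rw [e] at this
    rw [hup]
    simpa [coeffFace, insertAt_self] using this.symm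
  have r2 : ∀ (x : X) (m : Fin (n + 2) → S.ideal) (b : B) (j : Fin (n + 1)),
      L (pureTensor k A X x fun l => (Function.update m j.castSucc
          (MulOpposite.op b • m j.castSucc) l : A)) =
        L (pureTensor k A X x fun l => (Function.update m j.succ (b • m j.succ) l : A)) := by
    intro x m b j
    have := hLf x (insertAt j.succ.castSucc (S.incl b) fun l => (m l : A)) j.succ.castSucc (by
      rw [insertAt_self, S.projM_incl])
    rw [face_pureTensor, face_pureTensor, algFace_insertAt_succ] at this
    have e := algFace_insertAt_castSucc j.castSucc (S.incl b) fun l => (m l : A)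
    rw [Fin.succ_castSucc] at e
    rw [e] at this
    rw [hup, hup]
    have hj := j.2
    have h1 : ¬ ((j : ℕ) = n + 2) := by omega
    simpa [coeffFace, h1, hj.ne] using this
  let L1 : S.Res X ⊗[k] (⨂[k] _ : Fin (n + 2), S.ideal) →ₗ[k] S.RelChain X n :=
    L ∘ₗ TensorProduct.map (S.toRes X).symm.toLinearMap
      (PiTensorProduct.map fun _ => S.ideal.subtype)
  have hL1 : ∀ (x : X) (m : Fin (n + 2) → S.ideal),
      L1 (S.toRes X x ⊗ₜ PiTensorProduct.tprod k m) =
        L (pureTensor k A X x fun l => (m l : A)) := by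
    intro x m
    simp [L1]
  let L2 : S.Res X ⊗[k] S.MPow (n + 1) →ₗ[k] S.RelChain X n :=
    TensorProduct.lift (TensorPow.lift (TensorProduct.curry L1).flip (by
      intro j m b
      ext x
      exact (hL1 x _).trans ((r2 x m b j).trans (hL1 x _).symm))).flip
  have hL2 : ∀ (x : X) (m : Fin (n + 2) → S.ideal),
      L2 (S.toRes X x ⊗ₜ TensorPow.mk m) = L (pureTensor k A X x fun l => (m l : A)) :=
    fun x m => hL1 x m
  have key := EnvTensor.ker_mk_le k B L2 (by
    intro b x y
    refine LinearMap.congr_fun (f := TensorProduct.curry L2 (MulOpposite.op b • x))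
      (g := TensorProduct.curry L2 x ∘ₗ TensorPow.lmul (n + 1) b) (TensorPow.ext fun m => ?_) y
    simp only [LinearMap.comp_apply, TensorPow.lmul_mk, TensorProduct.curry_apply]
    exact (hL2 _ _).trans ((r0 x m b).trans (hL2 _ _).symm)) (by
    intro b x y
    refine LinearMap.congr_fun (f := TensorProduct.curry L2 (b • x))
      (g := TensorProduct.curry L2 x ∘ₗ TensorPow.rmul (n + 1) (MulOpposite.op b))
      (TensorPow.ext fun m => ?_) y
    simp only [LinearMap.comp_apply, TensorPow.rmul_mk, TensorProduct.curry_apply]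
    exact (hL2 _ _).trans ((r1 x m b).trans (hL2 _ _).symm))
  have hfac : L = L2 ∘ₗ TensorProduct.map (S.toRes X).toLinearMap
      (TensorPow.proj k B S.ideal (n + 1) ∘ₗ PiTensorProduct.map fun _ => S.projM) := by
    refine chain_ext k fun x a => ?_
    rw [hLM, ← hL2]
    simp [TensorPow.mk]
  intro y hy
  rw [hfac]
  exact key hy

/-- The boundary of `C_*^M(A|B, X)`, from degree `n + 2` to degree `n + 1`: the map induced by `b`
along the surjections `kappaLin`. -/
noncomputable def relBoundary (n : ℕ) : S.RelChain X (n + 1) →ₗ[k] S.RelChain X n :=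
  (LinearMap.ker (S.kappaLin X (n + 1))).liftQ (S.kappaLin X n ∘ₗ boundary k A X (n + 1))
    (S.ker_kappaLin_le n) ∘ₗ
  ((S.kappaLin X (n + 1)).quotKerEquivOfSurjective (S.kappaLin_surjective (n + 1))).symm.toLinearMap

theorem relBoundary_comp_kappaLin (n : ℕ) :
    S.relBoundary n ∘ₗ S.kappaLin X (n + 1) = S.kappaLin X n ∘ₗ boundary k A X (n + 1) := by
  refine LinearMap.ext fun y => ?_
  have h : (S.kappaLin X (n + 1)).quotKerEquivOfSurjective (S.kappaLin_surjective (n + 1))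
      (Submodule.Quotient.mk y) = S.kappaLin X (n + 1) y := rfl
  simp only [LinearMap.comp_apply, relBoundary, LinearEquiv.coe_coe]
  rw [← h, LinearEquiv.symm_apply_apply]
  rfl

theorem relBoundary_relBoundary (n : ℕ) :
    (S.relBoundary n ∘ₗ S.relBoundary (n + 1) : S.RelChain X (n + 2) →ₗ[k] _) = 0 := by
  rw [← LinearMap.cancel_right (S.kappaLin_surjective (n + 2)), LinearMap.comp_assoc,
    relBoundary_comp_kappaLin, ← LinearMap.comp_assoc, relBoundary_comp_kappaLin,
    LinearMap.comp_assoc, boundary_boundary]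
  simp

theorem iotaLin_pureTensor {n : ℕ} (x : X) (b : Fin n → B) :
    S.iotaLin X n (pureTensor k B (S.Res X) (S.toRes X x) b) =
      pureTensor k A X x fun i => S.incl (b i) := by
  simp [iotaLin]

theorem iotaLin_face {n : ℕ} (i : Fin (n + 2)) :
    S.iotaLin X n ∘ₗ face k i = face k i ∘ₗ S.iotaLin X (n + 1) := by
  refine chain_ext k fun x b => ?_
  obtain ⟨x, rfl⟩ := (S.toRes X).surjective x
  rw [LinearMap.comp_apply, LinearMap.comp_apply, iotaLin_pureTensor, face_pureTensor,
    face_pureTensor]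
  have e1 : (coeffFace i (S.toRes X x) b : S.Res X) =
      S.toRes X (coeffFace i x fun l => S.incl (b l)) := by
    simp only [coeffFace]
    split_ifs <;> rfl
  have e2 : (fun l => S.incl (algFace (· * ·) i b l)) =
      algFace (· * ·) i fun l => S.incl (b l) := by
    funext l
    simp only [algFace]
    split_ifs <;> simp
  rw [e1, iotaLin_pureTensor, e2]

theorem iotaLin_boundary (n : ℕ) :
    S.iotaLin X n ∘ₗ boundary k B (S.Res X) n = boundary k A X n ∘ₗ S.iotaLin X (n + 1) := by
  refine LinearMap.ext fun t => ?_
  simp only [LinearMap.comp_apply, boundary_apply, map_sum, map_smul]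
  refine Finset.sum_congr rfl fun i _ => ?_
  rw [← LinearMap.comp_apply, ← LinearMap.comp_apply,
    iotaLin_face]

theorem kappaLin_iotaLin (n : ℕ) : S.kappaLin X n ∘ₗ S.iotaLin X (n + 1) = 0 := by
  refine chain_ext k fun x b => ?_
  obtain ⟨x, rfl⟩ := (S.toRes X).surjective x
  rw [LinearMap.comp_apply, iotaLin_pureTensor, LinearMap.zero_apply]
  exact S.kappaLin_eq_zero _ _ 0 (S.projM_incl _)

end Sequence
end SplitExtension

namespace SplitExtension
variable {k A B : Type u} [Field k] [Ring A] [Algebra k A] [Ring B] [Algebra k B]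
  (S : SplitExtension k A B)
open HochschildComplex
variable (X : Type u) [AddCommGroup X] [Module k X] [Module A X] [Module Aᵐᵒᵖ X]
  [SMulCommClass A Aᵐᵒᵖ X] [IsScalarTower k A X] [IsScalarTower k Aᵐᵒᵖ X]

section SequenceDouble

open scoped ZeroObject

/-- The terms of the reduced relative complex in positive degrees, `X ⊗_{B^e} M^{⊗_B n}` for
`n ≥ 1`, and `0` in degree `0`. -/
noncomputable def relObj : ℕ → ModuleCat.{u} k
  | 0 => ModuleCat.of k PUnit
  | n + 1 => ModuleCat.of k (S.RelChain X n)

/-- The boundary of the reduced relative complex. -/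
noncomputable def relD : ∀ n, S.relObj X (n + 1) ⟶ S.relObj X n
  | 0 => 0
  | n + 1 => ModuleCat.ofHom (S.relBoundary n)

/-- The positive-degree part of the reduced relative complex `C_*^M(A|B, X)`. -/
noncomputable def relComplex : ChainComplex (ModuleCat.{u} k) ℕ :=
  ChainComplex.of (S.relObj X) (S.relD X) (by
    rintro (_ | n)
    · exact Limits.comp_zero
    · exact (ModuleCat.ofHom_comp _ _).symm.trans
        (congrArg ModuleCat.ofHom (S.relBoundary_relBoundary n)))

/-- The components of `κ`. -/
noncomputable def kappaHom : ∀ n, ModuleCat.of k (Chain k A X n) ⟶ S.relObj X n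
  | 0 => 0
  | n + 1 => ModuleCat.ofHom (S.kappaLin X n)

theorem relComplex_d (n : ℕ) : (S.relComplex X).d (n + 1) n = S.relD X n :=
  ChainComplex.of_d _ _ _

/-- The chain map `κ : C_*(A, X) → C_*^M(A|B, X)` (in positive degrees). -/
noncomputable def kappa : S.complexA X ⟶ S.relComplex X :=
  ChainComplex.ofHom (S.kappaHom X) (by
    rintro (_ | n)
    · exact (congrArg (S.kappaHom X 1 ≫ ·) (S.relComplex_d X 0)).trans
        (Limits.comp_zero.trans Limits.comp_zero.symm)
    · exact (congrArg (S.kappaHom X (n + 2) ≫ ·) (S.relComplex_d X (n + 1))).trans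
        ((congrArg ModuleCat.ofHom (S.relBoundary_comp_kappaLin n)).trans
          (congrArg (· ≫ S.kappaHom X (n + 1)) (complex_d k A X (n + 1))).symm))

/-- The chain map `ι : C_*(B, X) → C_*(A, X)`. -/
noncomputable def iota : S.complexB X ⟶ S.complexA X :=
  ChainComplex.ofHom (fun n => ModuleCat.ofHom (S.iotaLin X n)) (by
    intro n
    exact (congrArg (ModuleCat.ofHom (S.iotaLin X (n + 1)) ≫ ·) (complex_d k A X n)).trans
        ((congrArg ModuleCat.ofHom (S.iotaLin_boundary n).symm).trans
          (congrArg (· ≫ ModuleCat.ofHom (S.iotaLin X n)) (complex_d k B (S.Res X) n)).symm))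

theorem iota_kappa : S.iota X ≫ S.kappa X = 0 := by
  ext n : 1
  rcases n with _ | n
  · exact Limits.comp_zero
  · exact congrArg ModuleCat.ofHom (S.kappaLin_iotaLin n)

/-- The sequence `0 → C_*(B, X) → C_*(A, X) → C_*^M(A|B, X) → 0` as a double complex:
`C_*^M(A|B, X)`, `C_*(A, X)` and `C_*(B, X)` are its columns `0`, `1` and `2`. -/
noncomputable def sequenceDoubleComplex :
    HomologicalComplex₂ (ModuleCat.{u} k) (ComplexShape.down ℕ) (ComplexShape.down ℕ) :=
  ChainComplex.mk (S.relComplex X) (S.complexA X) (S.complexB X) (S.kappa X) (S.iota X)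
    (S.iota_kappa X) (fun _ => ⟨0, 0, Limits.zero_comp⟩)

end SequenceDouble

section Grading

/-- The projections of `A = B ⊕ M` onto its summands: onto `M` for `true`, onto `B` for `false`. -/
noncomputable def comp : Bool → A →ₗ[k] A
  | true => S.ideal.subtype ∘ₗ S.projM
  | false => S.incl.toLinearMap ∘ₗ S.retr.toLinearMap

/-- The projection of `X ⊗ A^{⊗ n}` onto its summand whose `i`-th tensorand lies in `M` if `t i` is
`true` and in `B` otherwise. -/
noncomputable def typeProj {n : ℕ} (t : Fin n → Bool) : Chain k A X n →ₗ[k] Chain k A X n :=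
  LinearMap.lTensor X (PiTensorProduct.map fun i => S.comp (t i))

/-- The number of `true` entries. -/
def weight {n : ℕ} (t : Fin n → Bool) : ℕ := ∑ i, (t i).toNat

/-- The projection of `X ⊗ A^{⊗ n}` onto `X ⊗ [M_p B_{n-p}]`. -/
noncomputable def gradeProj (p n : ℕ) : Chain k A X n →ₗ[k] Chain k A X n :=
  ∑ t : Fin n → Bool with weight t = p, S.typeProj X t

/-- `X ⊗ [M_p B_{n-p}]`: the sum of the summands of `X ⊗ A^{⊗ n}` with exactly `p` tensorands in `M`
and the other `n - p` tensorands in `B`. -/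
noncomputable def piece (p n : ℕ) : Submodule k (Chain k A X n) := LinearMap.range (S.gradeProj X p n)

theorem comp_comp (s t : Bool) (a : A) : S.comp s (S.comp t a) = if s = t then S.comp t a else 0 := by
  cases s <;> cases t <;> simp [comp, S.retr_incl]

theorem comp_sum (a : A) : ∑ s, S.comp s a = a := by
  simp [comp]

theorem typeProj_pureTensor {n : ℕ} (t : Fin n → Bool) (x : X) (a : Fin n → A) :
    S.typeProj X t (pureTensor k A X x a) = pureTensor k A X x fun i => S.comp (t i) (a i) := by
  simp [typeProj]

theorem sum_typeProj (n : ℕ) : ∑ t : Fin n → Bool, S.typeProj X t = LinearMap.id := by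
  refine chain_ext k fun x a => ?_
  rw [LinearMap.sum_apply]
  simp only [typeProj_pureTensor, pureTensor]
  rw [← TensorProduct.tmul_sum,
    ← MultilinearMap.map_sum (PiTensorProduct.tprod k) (fun i s => S.comp s (a i))]
  simp only [S.comp_sum, LinearMap.id_apply]

theorem weight_le {n : ℕ} (t : Fin n → Bool) : weight t ≤ n := by
  calc weight t ≤ ∑ _i : Fin n, 1 := Finset.sum_le_sum fun i _ => Bool.toNat_le _
    _ = n := by simp

theorem sum_gradeProj (n : ℕ) : ∑ p ∈ Finset.range (n + 1), S.gradeProj X p n = LinearMap.id := by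
  rw [← S.sum_typeProj X n]
  exact Finset.sum_fiberwise_of_maps_to (fun t _ => Finset.mem_range.2
    (Nat.lt_succ_of_le (weight_le t))) _

theorem comp_mul (s t : Bool) (a b : A) :
    S.comp (s || t) (S.comp s a * S.comp t b) = S.comp s a * S.comp t b := by
  cases s <;> cases t <;>
    simp [comp, S.retr_incl, sub_mul, mul_sub]

theorem comp_of_ne {s t : Bool} (h : s ≠ t) {a : A} (ha : S.comp t a = a) : S.comp s a = 0 := by
  rw [← ha, comp_comp, if_neg h]

theorem typeProj_eq_zero {n : ℕ} (t t' : Fin n → Bool) (h : t' ≠ t) (x : X) (a : Fin n → A)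
    (ha : ∀ i, S.comp (t i) (a i) = a i) : S.typeProj X t' (pureTensor k A X x a) = 0 := by
  obtain ⟨i, hi⟩ := Function.ne_iff.1 h
  rw [typeProj_pureTensor, pureTensor,
    MultilinearMap.map_coord_zero (PiTensorProduct.tprod k) i (S.comp_of_ne hi (ha i)),
    TensorProduct.tmul_zero]

theorem typeProj_face_typeProj {n : ℕ} (t : Fin (n + 1) → Bool) (t' : Fin n → Bool) (i : Fin (n + 2))
    (h : t' ≠ algFace (· || ·) i t) :
    S.typeProj X t' ∘ₗ face k i ∘ₗ S.typeProj X t = 0 := by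
  refine chain_ext k fun x a => ?_
  rw [LinearMap.comp_apply, LinearMap.comp_apply, typeProj_pureTensor, face_pureTensor,
    LinearMap.zero_apply]
  refine S.typeProj_eq_zero X _ t' h _ _ fun l => ?_
  simp only [algFace]
  split_ifs
  · rw [comp_comp, if_pos rfl]
  · rw [comp_mul]
  · rw [comp_comp, if_pos rfl]

theorem weight_algFace {n : ℕ} (t : Fin (n + 1) → Bool) (i : Fin (n + 2)) :
    weight t = weight (algFace (· || ·) i t) ∨ weight t = weight (algFace (· || ·) i t) + 1 := by
  have hi := i.2
  by_cases h0 : (i : ℕ) = 0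
  · have e : algFace (· || ·) i t = fun l => t l.succ := by
      funext l; simp [algFace, h0]
    rw [e]
    simp only [weight, Fin.sum_univ_succ (fun l => (t l).toNat)]
    cases t 0 <;> simp [add_comm]
  by_cases h1 : (i : ℕ) = n + 1
  · have e : algFace (· || ·) i t = fun l => t l.castSucc := by
      funext l
      have := l.2
      simp [algFace, h1]
    rw [e]
    simp only [weight, Fin.sum_univ_castSucc (fun l => (t l).toNat)]
    cases t (Fin.last n) <;> simp
  let p : Fin n := ⟨i - 1, by omega⟩
  have e : ∀ l, algFace (· || ·) i t l =
      Function.update (fun l => t (p.succ.succAbove l)) p (t p.castSucc || t p.succ) l := by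
    intro l
    have hl := l.2
    by_cases h : l = p
    · subst h
      have : (p : ℕ) + 1 = i := by simp [p]; omega
      simp [algFace, this]
    · have h' : (l : ℕ) ≠ i - 1 := fun h' => h (Fin.ext h')
      rw [Function.update_of_ne h]
      simp only [algFace, Fin.succAbove, Fin.lt_def, Fin.val_castSucc, Fin.val_succ, p]
      split_ifs <;> first | omega | rfl
  simp only [weight]
  rw [Fin.sum_univ_succAbove _ p.succ, Finset.sum_congr rfl fun l _ => congrArg Bool.toNat (e l),
    ← Finset.add_sum_erase Finset.univ (fun l => (t (p.succ.succAbove l)).toNat)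
      (Finset.mem_univ p),
    ← Finset.add_sum_erase Finset.univ (fun l => (Function.update
      (fun l => t (p.succ.succAbove l)) p (t p.castSucc || t p.succ) l).toNat)
      (Finset.mem_univ p), Function.update_self]
  have e2 : p.succ.succAbove p = p.castSucc := by simp
  rw [e2]
  have e3 : ∑ l ∈ Finset.univ.erase p, (Function.update (fun l => t (p.succ.succAbove l)) p
      (t p.castSucc || t p.succ) l).toNat =
      ∑ l ∈ Finset.univ.erase p, (t (p.succ.succAbove l)).toNat :=
    Finset.sum_congr rfl fun l hl => by rw [Function.update_of_ne (Finset.ne_of_mem_erase hl)]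
  rw [e3]
  cases t p.castSucc <;> cases t p.succ <;> simp <;> omega

/-- The boundary of `C_*(A, X)` from degree `i` to degree `j` (zero unless `i = j + 1`). -/
noncomputable def bd (_ : SplitExtension k A B) (i j : ℕ) : Chain k A X i →ₗ[k] Chain k A X j :=
  ((HochschildComplex.complex k A X).d i j).hom

theorem bd_succ (n : ℕ) : S.bd X (n + 1) n = boundary k A X n := by
  exact congrArg ModuleCat.Hom.hom (complex_d k A X n)

theorem bd_bd (i j l : ℕ) (z : Chain k A X i) : S.bd X j l (S.bd X i j z) = 0 := by
  have := (HochschildComplex.complex k A X).d_comp_d i j l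
  exact LinearMap.congr_fun (congrArg ModuleCat.Hom.hom this) z

theorem gradeProj_bd_gradeProj (i j r s : ℕ) (h1 : r ≠ s) (h2 : r + 1 ≠ s) (z : Chain k A X i) :
    S.gradeProj X r j (S.bd X i j (S.gradeProj X s i z)) = 0 := by
  by_cases hij : i = j + 1
  · subst hij
    rw [bd_succ, boundary_apply, map_sum]
    refine Finset.sum_eq_zero fun l _ => ?_
    rw [map_smul, gradeProj, gradeProj, LinearMap.sum_apply, LinearMap.sum_apply, map_sum]
    simp only [map_sum]
    rw [Finset.sum_eq_zero, smul_zero]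
    intro t' ht'
    refine Finset.sum_eq_zero fun t ht => ?_
    refine LinearMap.congr_fun (S.typeProj_face_typeProj X t t' l ?_) z
    rintro rfl
    have := weight_algFace t l
    simp only [Finset.mem_filter, Finset.mem_univ, true_and] at ht ht'
    omega
  · have : S.bd X i j = 0 := by
      simp only [bd, (HochschildComplex.complex k A X).shape i j (fun h => hij h.symm)]
      rfl
    rw [this]; simp

theorem gradeProj_eq_zero {p n : ℕ} (h : n < p) : S.gradeProj X p n = 0 := by
  rw [gradeProj, Finset.sum_eq_zero]
  intro t ht
  have := weight_le t
  simp only [Finset.mem_filter, Finset.mem_univ, true_and] at ht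
  omega

theorem eq_sum_gradeProj {n N : ℕ} (h : n ≤ N) (y : Chain k A X n) :
    y = ∑ p ∈ Finset.range (N + 1), S.gradeProj X p n y := by
  conv_lhs => rw [← LinearMap.id_apply (R := k) y, ← S.sum_gradeProj X n, LinearMap.sum_apply]
  refine Finset.sum_subset (fun p hp => ?_) fun p _ hp => ?_
  · simp only [Finset.mem_range] at *; omega
  · simp only [Finset.mem_range] at hp
    rw [S.gradeProj_eq_zero X (by omega), LinearMap.zero_apply]

/-- The boundary of an element of `X ⊗ [M_{s+1} B_*]` has only two components. -/
theorem bd_eq {i j s : ℕ} {z : Chain k A X i} (hz : z ∈ S.piece X (s + 1) i) :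
    S.bd X i j z = S.gradeProj X (s + 1) j (S.bd X i j z) + S.gradeProj X s j (S.bd X i j z) := by
  obtain ⟨z, rfl⟩ := hz
  conv_lhs => rw [S.eq_sum_gradeProj X (Nat.le_add_right j (s + 1)) (S.bd X i j _)]
  rw [Finset.sum_eq_add (s + 1) s (by omega)]
  · intro r _ hr
    exact S.gradeProj_bd_gradeProj X i j r (s + 1) hr.1 (by omega) z
  · intro h; exact absurd (Finset.mem_range.2 (by omega)) h
  · intro h; exact absurd (Finset.mem_range.2 (by omega)) h

theorem gradeProj_bd_of_mem {i j r s : ℕ} (h1 : r ≠ s) (h2 : r + 1 ≠ s) {z : Chain k A X i}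
    (hz : z ∈ S.piece X s i) : S.gradeProj X r j (S.bd X i j z) = 0 := by
  obtain ⟨z, rfl⟩ := hz
  exact S.gradeProj_bd_gradeProj X i j r s h1 h2 z

theorem gradeProj_mem (p n : ℕ) (z : Chain k A X n) : S.gradeProj X p n z ∈ S.piece X p n := ⟨z, rfl⟩

theorem vert_vert {i j l s : ℕ} {z : Chain k A X i} (hz : z ∈ S.piece X (s + 1) i) :
    S.gradeProj X (s + 1) l (S.bd X j l (S.gradeProj X (s + 1) j (S.bd X i j z))) = 0 := by
  have h := congrArg (fun y => S.gradeProj X (s + 1) l (S.bd X j l y)) (S.bd_eq X (j := j) hz)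
  simp only [bd_bd, map_zero, map_add] at h
  rw [S.gradeProj_bd_of_mem X (by omega) (by omega) (S.gradeProj_mem X s j _), add_zero] at h
  exact h.symm

theorem horiz_horiz {i j l s : ℕ} {z : Chain k A X i} (hz : z ∈ S.piece X (s + 2) i) :
    S.gradeProj X s l (S.bd X j l (S.gradeProj X (s + 1) j (S.bd X i j z))) = 0 := by
  have h := congrArg (fun y => S.gradeProj X s l (S.bd X j l y)) (S.bd_eq X (j := j) hz)
  simp only [bd_bd, map_zero, map_add] at h
  rw [S.gradeProj_bd_of_mem X (by omega) (by omega) (S.gradeProj_mem X (s + 2) j _),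
    zero_add] at h
  exact h.symm

theorem horiz_vert {i j j' l s : ℕ} {z : Chain k A X i} (hz : z ∈ S.piece X (s + 1) i) (hj : j' = j) :
    S.gradeProj X s l (S.bd X j l (S.gradeProj X (s + 1) j (S.bd X i j z))) =
      -S.gradeProj X s l (S.bd X j' l (S.gradeProj X s j' (S.bd X i j' z))) := by
  subst hj
  have h := congrArg (fun y => S.gradeProj X s l (S.bd X j' l y)) (S.bd_eq X (j := j') hz)
  simp only [bd_bd, map_zero, map_add] at h
  exact eq_neg_of_add_eq_zero_left h.symm

theorem kappaLin_gradeProj_of_ne {n r : ℕ} (h : r ≠ n + 1) :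
    S.kappaLin X n ∘ₗ S.gradeProj X r (n + 1) = 0 := by
  refine chain_ext k fun x a => ?_
  rw [LinearMap.comp_apply, gradeProj, LinearMap.sum_apply, map_sum, LinearMap.zero_apply]
  refine Finset.sum_eq_zero fun t ht => ?_
  simp only [Finset.mem_filter, Finset.mem_univ, true_and] at ht
  obtain ⟨i, hi⟩ : ∃ i, t i = false := by
    by_contra! hc
    apply h
    rw [← ht, weight]
    simp [hc]
  rw [typeProj_pureTensor]
  refine S.kappaLin_eq_zero _ _ i ?_
  rw [hi]
  exact S.projM_incl _

theorem kappaLin_gradeProj (n : ℕ) (y : Chain k A X (n + 1)) :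
    S.kappaLin X n (S.gradeProj X (n + 1) (n + 1) y) = S.kappaLin X n y := by
  conv_rhs => rw [S.eq_sum_gradeProj X le_rfl y, map_sum]
  rw [Finset.sum_eq_single (n + 1)]
  · intro r _ hr
    exact LinearMap.congr_fun (S.kappaLin_gradeProj_of_ne X hr) y
  · intro h; exact absurd (Finset.mem_range.2 (by omega)) h

end Grading
end SplitExtension

namespace SplitExtension
variable {k A B : Type u} [Field k] [Ring A] [Algebra k A] [Ring B] [Algebra k B]
  (S : SplitExtension k A B)
open HochschildComplex
variable (X : Type u) [AddCommGroup X] [Module k X] [Module A X] [Module Aᵐᵒᵖ X]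
  [SMulCommClass A Aᵐᵒᵖ X] [IsScalarTower k A X] [IsScalarTower k Aᵐᵒᵖ X]

section Gap

/-- The terms `C_{p,q}` of the double complex: `X ⊗ [M_p B_q]` for `p, q > 0`, the kernel `K_{p,0}`
of `X ⊗ M^{⊗ p} → X ⊗_{B^e} M^{⊗_B p}` for `p > 0` and `q = 0`, and `0` for `p = 0`. -/
noncomputable def gapTerm : ∀ p q : ℕ, Submodule k (Chain k A X (p + q))
  | 0, _ => ⊥
  | p + 1, 0 => S.piece X (p + 1) (p + 1) ⊓ LinearMap.ker (S.kappaLin X p)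
  | p + 1, q + 1 => S.piece X (p + 1) (p + 1 + (q + 1))

theorem gapTerm_le (p q : ℕ) : S.gapTerm X p q ≤ S.piece X p (p + q) := by
  rcases p with _ | p
  · exact bot_le
  rcases q with _ | q
  · exact inf_le_left
  · exact le_rfl

theorem kappaLin_bd {n : ℕ} {z : Chain k A X (n + 2)} (hz : S.kappaLin X (n + 1) z = 0) :
    S.kappaLin X n (S.bd X (n + 2) (n + 1) z) = 0 := by
  rw [bd_succ]
  exact (S.ker_kappaLin_le n hz : _)

theorem kappaLin_gradeProj_bd {n : ℕ} {z : Chain k A X (n + 2)}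
    (hz : S.kappaLin X (n + 1) z = 0) :
    S.kappaLin X n (S.gradeProj X (n + 1) (n + 1) (S.bd X (n + 2) (n + 1) z)) = 0 := by
  rw [kappaLin_gradeProj, kappaLin_bd S X hz]

theorem vert_mem (p q : ℕ) {z : Chain k A X (p + (q + 1))} (hz : z ∈ S.gapTerm X p (q + 1)) :
    S.gradeProj X p (p + q) (S.bd X (p + (q + 1)) (p + q) z) ∈ S.gapTerm X p q := by
  rcases p with _ | p
  · obtain rfl : z = 0 := hz
    simp
  rcases q with _ | q
  · refine ⟨S.gradeProj_mem X _ _ _, ?_⟩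
    refine S.kappaLin_gradeProj_bd X ?_
    obtain ⟨y, rfl⟩ := hz
    exact LinearMap.congr_fun (S.kappaLin_gradeProj_of_ne X (n := p + 1) (r := p + 1) (by omega)) y
  · exact S.gradeProj_mem X _ _ _

theorem horiz_mem (p q : ℕ) {z : Chain k A X (p + 1 + q)} (hz : z ∈ S.gapTerm X (p + 1) q) :
    (if p = 0 then 0 else S.gradeProj X p (p + q) (S.bd X (p + 1 + q) (p + q) z)) ∈
      S.gapTerm X p q := by
  rcases p with _ | p
  · simp
  rw [if_neg (by omega)]
  rcases q with _ | q
  · refine ⟨S.gradeProj_mem X _ _ _, ?_⟩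
    exact S.kappaLin_gradeProj_bd X hz.2
  · exact S.gradeProj_mem X _ _ _

/-- The vertical maps `C_{p,q+1} → C_{p,q}`: the component of `b` that preserves the number of
tensorands in `M`. -/
noncomputable def gapVert (p q : ℕ) : S.gapTerm X p (q + 1) →ₗ[k] S.gapTerm X p q :=
  (S.gradeProj X p (p + q) ∘ₗ S.bd X (p + (q + 1)) (p + q)).restrict
    fun _ hz => S.vert_mem X p q hz

/-- The horizontal maps `C_{p+1,q} → C_{p,q}`: the component of `b` that lowers the number of
tensorands in `M` by one. -/
noncomputable def gapHoriz (p q : ℕ) : S.gapTerm X (p + 1) q →ₗ[k] S.gapTerm X p q :=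
  (if p = 0 then 0 else S.gradeProj X p (p + q) ∘ₗ S.bd X (p + 1 + q) (p + q)).restrict
    fun _ hz => by
      have := S.horiz_mem X p q hz
      split_ifs at this ⊢
      · exact zero_mem _
      · exact this

theorem gapVert_gapVert (p q : ℕ) : S.gapVert X p q ∘ₗ S.gapVert X p (q + 1) = 0 := by
  refine LinearMap.ext fun z => Subtype.ext ?_
  rcases p with _ | p
  · exact (S.gapVert X 0 q (S.gapVert X 0 (q + 1) z)).2
  · exact S.vert_vert X (S.gapTerm_le X _ _ z.2)

theorem gapHoriz_gapHoriz (p q : ℕ) : S.gapHoriz X p q ∘ₗ S.gapHoriz X (p + 1) q = 0 := by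
  refine LinearMap.ext fun z => Subtype.ext ?_
  rcases p with _ | p
  · exact (S.gapHoriz X 0 q (S.gapHoriz X 1 q z)).2
  · exact S.horiz_horiz X (S.gapTerm_le X _ _ z.2)

theorem gapHoriz_gapVert (p q : ℕ) :
    S.gapHoriz X p q ∘ₗ S.gapVert X (p + 1) q = -(S.gapVert X p q ∘ₗ S.gapHoriz X p (q + 1)) := by
  refine LinearMap.ext fun z => Subtype.ext ?_
  rcases p with _ | p
  · exact (S.gapHoriz X 0 q (S.gapVert X 1 q z)).2.trans
      (neg_eq_zero.2 (S.gapVert X 0 q (S.gapHoriz X 0 (q + 1) z)).2).symm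
  · exact S.horiz_vert X (S.gapTerm_le X _ _ z.2) (by omega)

/-- The `p`-th column of the double complex. The sign makes the squares commute; it is removed again
by the sign in the total complex, whose differential is the one of `C_*(A, X)`. -/
noncomputable def gapColumn (p : ℕ) : ChainComplex (ModuleCat.{u} k) ℕ :=
  ChainComplex.of (fun q => ModuleCat.of k (S.gapTerm X p q))
    (fun q => ModuleCat.ofHom ((-1 : k) ^ p • S.gapVert X p q)) (by
      intro q
      rw [← ModuleCat.ofHom_comp, LinearMap.smul_comp, LinearMap.comp_smul, gapVert_gapVert,
        smul_zero, smul_zero]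
      rfl)

theorem gapColumn_d (p q : ℕ) : (S.gapColumn X p).d (q + 1) q =
    ModuleCat.ofHom ((-1 : k) ^ p • S.gapVert X p q) :=
  ChainComplex.of_d (fun q => ModuleCat.of k (S.gapTerm X p q))
    (fun q => ModuleCat.ofHom ((-1 : k) ^ p • S.gapVert X p q)) q

theorem neg_smul_neg_eq {V : Type*} [AddCommGroup V] [Module k V] (c : k) (v : V) :
    c • v = (-c) • (-v) := by
  rw [neg_smul, smul_neg, neg_neg]

/-- The horizontal differential as a map of columns. -/
noncomputable def gapMap (p : ℕ) : S.gapColumn X (p + 1) ⟶ S.gapColumn X p :=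
  ChainComplex.ofHom (fun q => ModuleCat.ofHom (S.gapHoriz X p q)) (by
    intro q
    refine (congrArg (ModuleCat.ofHom (S.gapHoriz X p (q + 1)) ≫ ·) (S.gapColumn_d X p q)).trans
      (Eq.trans ?_ (congrArg (· ≫ ModuleCat.ofHom (S.gapHoriz X p q))
        (S.gapColumn_d X (p + 1) q)).symm)
    refine congrArg ModuleCat.ofHom (?_ : ((-1 : k) ^ p • S.gapVert X p q) ∘ₗ
      S.gapHoriz X p (q + 1) = S.gapHoriz X p q ∘ₗ ((-1 : k) ^ (p + 1) • S.gapVert X (p + 1) q))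
    rw [LinearMap.smul_comp, LinearMap.comp_smul, gapHoriz_gapVert, pow_succ, mul_neg_one]
    refine LinearMap.ext fun z => ?_
    exact neg_smul_neg_eq ((-1 : k) ^ p) (S.gapVert X p q (S.gapHoriz X p (q + 1) z)))

/-- The double complex `C_{*,*}` (the first index is the column). -/
noncomputable def gapDoubleComplex :
    HomologicalComplex₂ (ModuleCat.{u} k) (ComplexShape.down ℕ) (ComplexShape.down ℕ) :=
  ChainComplex.of (S.gapColumn X) (S.gapMap X) (by
    intro p
    ext q : 1
    exact (ModuleCat.ofHom_comp _ _).symm.trans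
      (congrArg ModuleCat.ofHom (S.gapHoriz_gapHoriz X p q)))

end Gap

end SplitExtension

namespace FilteredComplex

variable {k : Type u} [Field k] (K : ChainComplex (ModuleCat.{u} k) ℕ)
  (F : ℤ → ∀ n : ℕ, Submodule k (K.X n))

/-- `Z^r_p = {z ∈ F_p | d z ∈ F_{p-r}}` in degree `n`. -/
def cycles (r p : ℤ) (n : ℕ) : Submodule k (K.X n) :=
  F p n ⊓ ⨅ j : ℕ, (F (p - r) j).comap (K.d n j).hom

/-- `Z^{r-1}_{p-1} + d Z^{r-1}_{p+r-1}` in degree `n`. -/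
def boundaries (r p : ℤ) (n : ℕ) : Submodule k (K.X n) :=
  cycles K F (r - 1) (p - 1) n ⊔ ⨆ i : ℕ, (cycles K F (r - 1) (p + r - 1) i).map (K.d i n).hom

/-- The term of filtration degree `p` and total degree `n` (that is, the term at the spot
`(p, n - p)`) of the `r`-th page of the spectral sequence of the complex `K` with the increasing
filtration `F`: the quotient of `Z^r_p` by `Z^{r-1}_{p-1} + d Z^{r-1}_{p+r-1}`. -/
abbrev page (r p : ℤ) (n : ℕ) : Type u :=
  cycles K F r p n ⧸ (boundaries K F r p n).comap (cycles K F r p n).subtype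

end FilteredComplex

namespace DoubleComplex

variable {k : Type u} [Field k]
  (D : HomologicalComplex₂ (ModuleCat.{u} k) (ComplexShape.down ℕ) (ComplexShape.down ℕ))

/-- The total complex. -/
noncomputable abbrev tot : ChainComplex (ModuleCat.{u} k) ℕ := D.total (ComplexShape.down ℕ)

/-- The filtration of the total complex by columns: the sum of the `D_{i,j}` with `i ≤ p`. -/
noncomputable def colFiltration (p : ℤ) (n : ℕ) : Submodule k ((tot D).X n) :=
  ⨆ (i : ℕ) (j : ℕ) (h : i + j = n) (_ : (i : ℤ) ≤ p),
    LinearMap.range (D.ιTotal (ComplexShape.down ℕ) i j n h).hom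

/-- The filtration of the total complex by rows: the sum of the `D_{i,j}` with `j ≤ p`. -/
noncomputable def rowFiltration (p : ℤ) (n : ℕ) : Submodule k ((tot D).X n) :=
  ⨆ (i : ℕ) (j : ℕ) (h : i + j = n) (_ : (j : ℤ) ≤ p),
    LinearMap.range (D.ιTotal (ComplexShape.down ℕ) i j n h).hom

/-- The `r`-th page of the spectral sequence of the filtration by columns, in column `p` and total
degree `n`. -/
abbrev colPage (r p : ℤ) (n : ℕ) : Type u := FilteredComplex.page (tot D) (colFiltration D) r p n

/-- The `r`-th page of the spectral sequence of the filtration by rows, in row `q` and total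
degree `n`. -/
abbrev rowPage (r q : ℤ) (n : ℕ) : Type u := FilteredComplex.page (tot D) (rowFiltration D) r q n

end DoubleComplex

/-! Both halves rest on the weight grading of C_n(A, X) = X ⊗ A^{⊗ n}, the weight of a word being
its number of letters in M. The boundary b preserves the weight or lowers it by one, the part of
weight 0 is Im ι, and κ sees only the top weight n.

Part 1 compares both sides with the complex Ker κ / Im ι. Its homology is column 1 of the second
page of the row filtration, because Ker κ / Im ι is the row homology at C_*(A, X)
(`nonempty_rowPageEquiv_middle`). On the other side, Ker κ is the direct sum of Im ι and of the
terms C_{p,q} with p > 0. Hence Tot C is a complement of Im ι in Ker κ, its differential is b with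
the component of weight 0 removed (`gapIncl_d`), and it has the homology of Ker κ / Im ι
(`nonempty_homologyEquiv_middle`).

In part 2 the first page is the homology of the columns (`nonempty_colPageEquiv`). It vanishes at q
= 0, because the relations that define X ⊗_{B^e} M^{⊗_B p} are the vertical boundaries of words with
exactly one letter in B (`exists_vert_eq`). In positive degrees the column is X ⊗_{B^e} P, where P =
(B ⊗ B) ⊗ [M_p B_*] consists of projective B^e-modules and is augmented onto M^{⊗_B p}. So
everything comes down to the exactness of P in positive degrees.

This is an induction on p. The map (b ⊗ c) ⊗ w ↦ (1 ⊗ c) ⊗ b ⊗ w contracts P when p = 0; this is the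
bar resolution of B. In general it is a homotopy between the identity and a map that factors through
(M ⊗ B) ⊗ [M_{p-1} B_*], since only the M-component of the first letter obstructs the contraction
(`boundary_consBase`). Exactness of (M ⊗ B) ⊗ [M_{p-1} B_*] therefore gives exactness of P
(`vertExact_base_succ`). That complex is M ⊗_B - applied to (B ⊗ B) ⊗ [M_{p-1} B_*], which by
induction is a projective resolution of M^{⊗_B (p-1)} over B. Its homology in positive degrees is
thus Tor^B(M, M^{⊗_B (p-1)}), which vanishes by hypothesis, or trivially when p = 1
(`vertExact_ideal`, `vertExact_base`). The first page is then read off from the resolution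
(`nonempty_envTorEquiv`). -/

section Subquotients

/-! ### Isomorphisms of subquotients. -/

variable {k V W : Type*} [Ring k] [AddCommGroup V] [AddCommGroup W] [Module k V] [Module k W]

/-- A linear map induces an isomorphism of subquotients when it respects the cycles, is surjective
on cycles modulo boundaries, and reflects boundaries. -/
theorem nonempty_subquotientEquiv (f : V →ₗ[k] W) {Z₁ B₁ : Submodule k V} {Z₂ B₂ : Submodule k W}
    (h₁ : ∀ z ∈ Z₁, f z ∈ Z₂) (h₂ : ∀ y ∈ Z₂, ∃ z ∈ Z₁, y - f z ∈ B₂)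
    (h₃ : ∀ z ∈ Z₁, f z ∈ B₂ ↔ z ∈ B₁) :
    Nonempty ((Z₁ ⧸ B₁.comap Z₁.subtype) ≃ₗ[k] (Z₂ ⧸ B₂.comap Z₂.subtype)) := by
  have hle : B₁.comap Z₁.subtype ≤ (B₂.comap Z₂.subtype).comap (f.restrict h₁) :=
    fun z hz => (h₃ z z.2).2 hz
  refine ⟨LinearEquiv.ofBijective (Submodule.mapQ _ _ (f.restrict h₁) hle) ⟨?_, ?_⟩⟩
  · rw [← LinearMap.ker_eq_bot, LinearMap.ker_eq_bot']
    intro y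
    obtain ⟨z, rfl⟩ := Submodule.Quotient.mk_surjective _ y
    intro h
    rw [Submodule.mapQ_apply, Submodule.Quotient.mk_eq_zero] at h
    exact (Submodule.Quotient.mk_eq_zero _).2 ((h₃ z z.2).1 h)
  · intro y
    obtain ⟨y, rfl⟩ := Submodule.Quotient.mk_surjective _ y
    obtain ⟨z, hz, h⟩ := h₂ y y.2
    refine ⟨Submodule.Quotient.mk ⟨z, hz⟩, ?_⟩
    rw [Submodule.mapQ_apply]
    exact ((Submodule.Quotient.eq (B₂.comap Z₂.subtype)).2 h).symm

theorem subsingleton_subquotient {Z B : Submodule k V} (h : Z ≤ B) :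
    Subsingleton (Z ⧸ B.comap Z.subtype) :=
  Submodule.Quotient.subsingleton_iff.2 (eq_top_iff.2 fun z _ => h z.2)

theorem le_of_subsingleton_subquotient {Z B : Submodule k V}
    (h : Subsingleton (Z ⧸ B.comap Z.subtype)) : Z ≤ B := by
  intro z hz
  have := Submodule.Quotient.subsingleton_iff.1 h
  exact (this ▸ Submodule.mem_top : (⟨z, hz⟩ : Z) ∈ B.comap Z.subtype)

end Subquotients

/-! ### Homology of a chain complex as a subquotient. -/

namespace HomologicalComplex

variable {k : Type u} [Ring k] (K : HomologicalComplex (ModuleCat.{u} k) (ComplexShape.down ℕ))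

/-- The cycles in degree `n`, as a submodule. -/
def cycleSubmodule (n : ℕ) : Submodule k (K.X n) := ⨅ j, LinearMap.ker (K.d n j).hom

/-- The boundaries in degree `n`, as a submodule. -/
def boundarySubmodule (n : ℕ) : Submodule k (K.X n) := ⨆ i, LinearMap.range (K.d i n).hom

theorem mem_cycleSubmodule {n : ℕ} {z : K.X n} :
    z ∈ K.cycleSubmodule n ↔ ∀ j, K.d n j z = 0 := by
  simp [cycleSubmodule]

theorem boundarySubmodule_eq (n : ℕ) :
    K.boundarySubmodule n = LinearMap.range (K.d (n + 1) n).hom := by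
  refine le_antisymm (iSup_le fun i => ?_) (le_iSup (fun i => LinearMap.range (K.d i n).hom) _)
  by_cases h : i = n + 1
  · rw [h]
  · rw [K.shape i n fun h' => h h'.symm]
    rintro _ ⟨y, rfl⟩
    exact zero_mem _

theorem mem_boundarySubmodule {n : ℕ} {z : K.X n} :
    z ∈ K.boundarySubmodule n ↔ ∃ y, K.d (n + 1) n y = z := by
  rw [boundarySubmodule_eq]; rfl

theorem mem_cycleSubmodule_succ {n : ℕ} {z : K.X (n + 1)} :
    z ∈ K.cycleSubmodule (n + 1) ↔ K.d (n + 1) n z = 0 := by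
  rw [mem_cycleSubmodule]
  refine ⟨fun h => h n, fun h j => ?_⟩
  by_cases hj : j = n
  · rw [hj, h]
  · rw [K.shape _ _ fun h' => hj (Nat.succ_injective h')]
    rfl

/-- Homology takes here the form of cycles modulo boundaries inside `K.X n`, so that it can be
compared with pages and with `Tor` through `nonempty_subquotientEquiv`. -/
theorem nonempty_homologyEquiv (n : ℕ) :
    Nonempty ((K.homology n : ModuleCat.{u} k) ≃ₗ[k]
      (K.cycleSubmodule n ⧸ (K.boundarySubmodule n).comap (K.cycleSubmodule n).subtype)) := by
  have e := (K.sc n).moduleCatHomologyIso.toLinearEquiv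
  have hr : LinearMap.range (K.sc n).moduleCatToCycles =
      (LinearMap.range (K.sc n).f.hom).comap (LinearMap.ker (K.sc n).g.hom).subtype := by
    ext z
    constructor
    · rintro ⟨y, rfl⟩; exact ⟨y, rfl⟩
    · rintro ⟨y, hy⟩; exact ⟨y, Subtype.ext hy⟩
  have e' := Submodule.quotEquivOfEq _ _ hr
  obtain ⟨e''⟩ := nonempty_subquotientEquiv (k := k) (V := K.X n) (W := K.X n) LinearMap.id
    (Z₁ := LinearMap.ker (K.sc n).g.hom) (B₁ := LinearMap.range (K.sc n).f.hom)
    (Z₂ := K.cycleSubmodule n) (B₂ := K.boundarySubmodule n) (fun z hz => by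
      rw [mem_cycleSubmodule]
      intro j
      by_cases hj : (ComplexShape.down ℕ).Rel n j
      · have := (ComplexShape.down ℕ).next_eq' hj
        subst this
        exact hz
      · rw [K.shape _ _ hj]; rfl) (fun z hz => by
      refine ⟨z, (mem_cycleSubmodule K).1 hz _, ?_⟩
      simp) (fun z _ => by
      have h : (ComplexShape.down ℕ).prev n = n + 1 := ChainComplex.prev ℕ n
      have : K.boundarySubmodule n =
          LinearMap.range (K.d ((ComplexShape.down ℕ).prev n) n).hom := by
        rw [h, boundarySubmodule_eq]
      rw [this]; rfl)
  exact ⟨(e.trans e').trans e''⟩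

end HomologicalComplex

/-! ### The total complex and its filtrations in coordinates. -/

namespace DoubleComplex

variable {k : Type u} [Field k]
  (D : HomologicalComplex₂ (ModuleCat.{u} k) (ComplexShape.down ℕ) (ComplexShape.down ℕ))

/-- The inclusion of a summand of the total complex. -/
noncomputable def incl (i j n : ℕ) (h : i + j = n) : (D.X i).X j →ₗ[k] (tot D).X n :=
  (D.ιTotal (ComplexShape.down ℕ) i j n h).hom

/-- The projection of the total complex onto a summand. -/
noncomputable def proj (i j n : ℕ) : (tot D).X n →ₗ[k] (D.X i).X j :=
  (D.totalDesc (fun i' j' _ => if h : i' = i ∧ j' = j then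
    (D.XXIsoOfEq _ _ _ h.1 h.2).hom else 0)).hom

theorem tot_ext {n : ℕ} {W : Type u} [AddCommGroup W] [Module k W] {f g : (tot D).X n →ₗ[k] W}
    (h : ∀ i j (h : i + j = n) z, f (incl D i j n h z) = g (incl D i j n h z)) : f = g := by
  have : ModuleCat.ofHom f = ModuleCat.ofHom g :=
    HomologicalComplex₂.total.hom_ext _ fun i j hij => by
      ext z
      exact h i j hij z
  exact congrArg ModuleCat.Hom.hom this

theorem proj_incl {i j n : ℕ} (h : i + j = n) (i' j' : ℕ) (z : (D.X i).X j) :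
    proj D i' j' n (incl D i j n h z) =
      (if h : i = i' ∧ j = j' then (D.XXIsoOfEq _ _ _ h.1 h.2).hom else 0) z := by
  have := HomologicalComplex₂.ι_totalDesc (K := D) (c₁₂ := ComplexShape.down ℕ) (i₁₂ := n)
    (fun i j _ => if h : i = i' ∧ j = j' then
    (D.XXIsoOfEq _ _ _ h.1 h.2).hom else 0) i j h
  exact LinearMap.congr_fun (congrArg ModuleCat.Hom.hom this) z

@[simp]
theorem proj_incl_self {i j n : ℕ} (h : i + j = n) (z : (D.X i).X j) :
    proj D i j n (incl D i j n h z) = z := by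
  rw [proj_incl, dif_pos ⟨rfl, rfl⟩]
  simp

theorem proj_incl_of_ne {i j n : ℕ} (h : i + j = n) {i' j' : ℕ} (hi : i ≠ i') (z : (D.X i).X j) :
    proj D i' j' n (incl D i j n h z) = 0 := by
  rw [proj_incl, dif_neg fun h => hi h.1]
  rfl

theorem sum_incl_proj {n : ℕ} (z : (tot D).X n) :
    ∑ i : Fin (n + 1), incl D i (n - i) n (by omega) (proj D i (n - i) n z) = z := by
  suffices h : ∑ i : Fin (n + 1), incl D i (n - i) n (by omega) ∘ₗ proj D i (n - i) n =
      LinearMap.id by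
    have := LinearMap.congr_fun h z
    simpa [LinearMap.sum_apply] using this
  clear z
  refine tot_ext D fun i j h z => ?_
  subst h
  rw [LinearMap.sum_apply, Finset.sum_eq_single ⟨i, by omega⟩]
  · have e : i + j - i = j := by omega
    -- `i + j - i` is not definitionally `j`; generalising it to `l` lets the equality be
    -- substituted.
    have : ∀ l (_ : l = j) (h' : i + l = i + j), incl D i l (i + j) h' (proj D i l (i + j)
        (incl D i j (i + j) rfl z)) = incl D i j (i + j) rfl z := by
      rintro l rfl h'
      rw [proj_incl_self]
    exact this _ e _
  · intro l _ hl
    rw [LinearMap.comp_apply, proj_incl_of_ne, map_zero]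
    exact fun h => hl (Fin.ext h.symm)
  · intro h; exact absurd (Finset.mem_univ _) h

theorem ext_proj {n : ℕ} {z w : (tot D).X n}
    (h : ∀ i j, i + j = n → proj D i j n z = proj D i j n w) : z = w := by
  rw [← sum_incl_proj D z, ← sum_incl_proj D w]
  exact Finset.sum_congr rfl fun i _ => by rw [h i (n - i) (by omega)]

theorem tot_d_incl {i j n : ℕ} (h : i + j = n) (m : ℕ) (z : (D.X i).X j) :
    (tot D).d n m (incl D i j n h z) = (D.d₁ (ComplexShape.down ℕ) i j m).hom z +
      (D.d₂ (ComplexShape.down ℕ) i j m).hom z := by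
  have h₁ := HomologicalComplex₂.ι_D₁ D (ComplexShape.down ℕ) n m i j h
  have h₂ := HomologicalComplex₂.ι_D₂ D (ComplexShape.down ℕ) n m i j h
  exact congrArg₂ (· + ·) (LinearMap.congr_fun (congrArg ModuleCat.Hom.hom h₁) z)
    (LinearMap.congr_fun (congrArg ModuleCat.Hom.hom h₂) z)

/-- The horizontal differential enters the total complex with sign 1. Unless the source summand lies
in column `i + 1`, both sides vanish. -/
theorem proj_d₁ {i j i' j' n : ℕ} (h : i + j = n) (h' : i' + j' = n + 1) (z : (D.X i').X j') :
    proj D i j n ((D.d₁ (ComplexShape.down ℕ) i' j' n).hom z) =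
      (D.d (i + 1) i).f j (proj D (i + 1) j (n + 1) (incl D i' j' (n + 1) h' z)) := by
  by_cases hi : i' = i + 1
  · subst hi
    obtain rfl : j' = j := by omega
    rw [proj_incl_self, HomologicalComplex₂.d₁_eq D (ComplexShape.down ℕ) (i₁' := i) rfl j' n h]
    exact (congrArg (proj D i j' n) (one_smul ℤˣ _)).trans (proj_incl_self D h _)
  · rw [proj_incl_of_ne D h' hi, map_zero]
    rcases i' with _ | i'
    · rw [HomologicalComplex₂.d₁_eq_zero]
      · exact map_zero _
      · simp
    · rw [HomologicalComplex₂.d₁_eq D (ComplexShape.down ℕ) (i₁' := i') rfl j' n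
        (show i' + j' = n by omega)]
      exact (congrArg (proj D i j n) (one_smul ℤˣ _)).trans
        (proj_incl_of_ne D (show i' + j' = n by omega) (fun h => hi (by rw [h])) _)

theorem units_smul_eq {V : Type*} [AddCommGroup V] [Module k V] (i : ℕ) (v : V) :
    ((-1 : ℤˣ) ^ i) • v = (-1 : k) ^ i • v := by
  rcases Nat.even_or_odd i with h | h <;> simp [h.neg_one_pow]

/-- The vertical differential of column `i` enters the total complex with sign (-1)^i. Unless the
source lies in column `i`, both sides vanish. -/
theorem proj_d₂ {i j i' j' n : ℕ} (h : i + j = n) (h' : i' + j' = n + 1) (z : (D.X i').X j') :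
    proj D i j n ((D.d₂ (ComplexShape.down ℕ) i' j' n).hom z) =
      (-1 : k) ^ i • (D.X i).d (j + 1) j (proj D i (j + 1) (n + 1) (incl D i' j' (n + 1) h' z)) := by
  by_cases hi : i' = i
  · subst hi
    obtain rfl : j' = j + 1 := by omega
    rw [proj_incl_self, HomologicalComplex₂.d₂_eq D (ComplexShape.down ℕ) i' (i₂' := j) rfl n h]
    refine (congrArg (proj D i' j n) (units_smul_eq (k := k) i' _)).trans ?_
    rw [map_smul]
    exact congrArg _ (proj_incl_self D h _)
  · rw [proj_incl_of_ne D h' hi, map_zero, smul_zero]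
    rcases j' with _ | j'
    · rw [HomologicalComplex₂.d₂_eq_zero]
      · exact map_zero _
      · simp
    · rw [HomologicalComplex₂.d₂_eq D (ComplexShape.down ℕ) i' (i₂' := j') rfl n
        (show i' + j' = n by omega)]
      refine (congrArg (proj D i j n) (units_smul_eq (k := k) i' _)).trans ?_
      rw [map_smul]
      exact (congrArg _ (proj_incl_of_ne D (show i' + j' = n by omega) hi _)).trans (smul_zero _)

/-- The differential of the total complex in coordinates. -/
theorem proj_tot_d {i j n : ℕ} (h : i + j = n) (z : (tot D).X (n + 1)) :
    proj D i j n ((tot D).d (n + 1) n z) = (D.d (i + 1) i).f j (proj D (i + 1) j (n + 1) z) +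
      (-1 : k) ^ i • (D.X i).d (j + 1) j (proj D i (j + 1) (n + 1) z) := by
  refine LinearMap.congr_fun (f := proj D i j n ∘ₗ ((tot D).d (n + 1) n).hom)
    (g := ((D.d (i + 1) i).f j).hom ∘ₗ proj D (i + 1) j (n + 1) +
      (-1 : k) ^ i • ((D.X i).d (j + 1) j).hom ∘ₗ proj D i (j + 1) (n + 1))
    (tot_ext D fun i' j' h' w => ?_) z
  refine (congrArg (proj D i j n) (tot_d_incl D h' n w)).trans ?_
  rw [map_add, proj_d₁ D h h', proj_d₂ D h h']
  rfl

/-- The total complex is the direct sum of its summands, so lying in the span of some of them means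
that the other coordinates vanish. All computations with pages below use this form. -/
theorem mem_colFiltration {p : ℤ} {n : ℕ} {z : (tot D).X n} :
    z ∈ colFiltration D p n ↔ ∀ i j, i + j = n → p < i → proj D i j n z = 0 := by
  constructor
  · intro hz i j h hp
    have : colFiltration D p n ≤ LinearMap.ker (proj D i j n) := by
      refine iSup_le fun i' => iSup_le fun j' => iSup_le fun h' => iSup_le fun hp' => ?_
      rintro _ ⟨w, rfl⟩
      exact proj_incl_of_ne D h' (by omega) w
    exact this hz
  · intro hz
    rw [← sum_incl_proj D z]
    refine Submodule.sum_mem _ fun i _ => ?_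
    by_cases hp : p < (i : ℕ)
    · rw [hz i (n - i) (by omega) hp, map_zero]
      exact zero_mem _
    · have := le_iSup_of_le (f := fun i : ℕ => ⨆ (j : ℕ) (h : i + j = n) (_ : (i : ℤ) ≤ p),
        LinearMap.range (D.ιTotal (ComplexShape.down ℕ) i j n h).hom) i (le_iSup_of_le (n - i)
          (le_iSup_of_le (by omega) (le_iSup_of_le (by omega) le_rfl)))
      exact this ⟨_, rfl⟩

theorem mem_rowFiltration {p : ℤ} {n : ℕ} {z : (tot D).X n} :
    z ∈ rowFiltration D p n ↔ ∀ i j, i + j = n → p < j → proj D i j n z = 0 := by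
  constructor
  · intro hz i j h hp
    have : rowFiltration D p n ≤ LinearMap.ker (proj D i j n) := by
      refine iSup_le fun i' => iSup_le fun j' => iSup_le fun h' => iSup_le fun hp' => ?_
      rintro _ ⟨w, rfl⟩
      exact proj_incl_of_ne D h' (by omega) w
    exact this hz
  · intro hz
    rw [← sum_incl_proj D z]
    refine Submodule.sum_mem _ fun i _ => ?_
    by_cases hp : p < (n - i : ℕ)
    · rw [hz i (n - i) (by omega) hp, map_zero]
      exact zero_mem _
    · have := le_iSup_of_le (f := fun i : ℕ => ⨆ (j : ℕ) (h : i + j = n) (_ : (j : ℤ) ≤ p),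
        LinearMap.range (D.ιTotal (ComplexShape.down ℕ) i j n h).hom) i (le_iSup_of_le (n - i)
          (le_iSup_of_le (by omega) (le_iSup_of_le (by omega) le_rfl)))
      exact this ⟨_, rfl⟩

end DoubleComplex

/-! ### Pages of a filtered complex by elements. -/

namespace FilteredComplex

variable {k : Type u} [Field k] (K : ChainComplex (ModuleCat.{u} k) ℕ)
  (F : ℤ → ∀ n : ℕ, Submodule k (K.X n))

theorem mem_cycles {r p : ℤ} {n : ℕ} {z : K.X n} :
    z ∈ cycles K F r p n ↔ z ∈ F p n ∧ ∀ j, K.d n j z ∈ F (p - r) j := by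
  simp [cycles]

theorem mem_cycles_succ {r p : ℤ} {n : ℕ} {z : K.X (n + 1)} :
    z ∈ cycles K F r p (n + 1) ↔ z ∈ F p (n + 1) ∧ K.d (n + 1) n z ∈ F (p - r) n := by
  rw [mem_cycles]
  refine and_congr_right fun _ => ⟨fun h => h n, fun h j => ?_⟩
  by_cases hj : j = n
  · rwa [hj]
  · rw [K.shape _ _ fun h' => hj (Nat.succ_injective h')]
    exact zero_mem _

/-- The supremum over all source degrees collapses, since only the differential from degree `n + 1`
can be nonzero. -/
theorem mem_boundaries {r p : ℤ} {n : ℕ} {z : K.X n} :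
    z ∈ boundaries K F r p n ↔ ∃ y ∈ cycles K F (r - 1) (p + r - 1) (n + 1),
      z - K.d (n + 1) n y ∈ cycles K F (r - 1) (p - 1) n := by
  have : (⨆ i : ℕ, (cycles K F (r - 1) (p + r - 1) i).map (K.d i n).hom) =
      (cycles K F (r - 1) (p + r - 1) (n + 1)).map (K.d (n + 1) n).hom := by
    refine le_antisymm (iSup_le fun i => ?_) (le_iSup (fun i : ℕ =>
      (cycles K F (r - 1) (p + r - 1) i).map (K.d i n).hom) (n + 1))
    by_cases h : i = n + 1
    · rw [h]
    · rw [K.shape i n fun h' => h h'.symm]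
      rintro _ ⟨y, _, rfl⟩
      exact zero_mem _
  rw [boundaries, this, Submodule.mem_sup]
  constructor
  · rintro ⟨w, hw, _, ⟨y, hy, rfl⟩, rfl⟩
    exact ⟨y, hy, by simpa using hw⟩
  · rintro ⟨y, hy, h⟩
    exact ⟨_, h, _, ⟨y, hy, rfl⟩, by simp⟩

end FilteredComplex

namespace DoubleComplex

variable {k : Type u} [Field k]
  (D : HomologicalComplex₂ (ModuleCat.{u} k) (ComplexShape.down ℕ) (ComplexShape.down ℕ))

/-- The first page of the column filtration is the vertical homology. -/
theorem nonempty_colPageEquiv {p q n : ℕ} (hn : p + q = n) :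
    Nonempty (colPage D 1 p n ≃ₗ[k] ((D.X p).cycleSubmodule q ⧸
      ((D.X p).boundarySubmodule q).comap ((D.X p).cycleSubmodule q).subtype)) := by
  -- The isomorphism reads off the coordinate in column `p`: the columns to its right vanish on F_p,
  -- and those to its left lie in F_{p-1}.
  refine nonempty_subquotientEquiv (proj D p q n) ?_ ?_ ?_
  · intro z hz
    rcases q with _ | q
    · rw [HomologicalComplex.mem_cycleSubmodule]
      intro j
      rw [(D.X p).shape _ _ (by simp)]
      rfl
    · subst hn
      rw [HomologicalComplex.mem_cycleSubmodule_succ]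
      have h := FilteredComplex.mem_cycles_succ (n := p + q) .. |>.1 hz
      have h₂ := (mem_colFiltration D).1 h.2 p q rfl (by omega)
      rw [proj_tot_d D rfl, (mem_colFiltration D).1 h.1 (p + 1) q (by omega) (by omega), map_zero,
        zero_add] at h₂
      exact (smul_eq_zero.1 h₂).resolve_left (pow_ne_zero _ (by simp))
  · intro y hy
    refine ⟨incl D p q n hn y, ?_, by simp⟩
    refine FilteredComplex.mem_cycles .. |>.2 ⟨(mem_colFiltration D).2 fun i j _ hi =>
      proj_incl_of_ne D hn (by omega) y, fun m => ?_⟩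
    by_cases hm : m + 1 = n
    · subst hm
      refine (mem_colFiltration D).2 fun i j hij hi => ?_
      rw [proj_tot_d D hij, proj_incl_of_ne D hn (by omega), map_zero, zero_add]
      by_cases hip : p = i
      · subst hip
        obtain rfl : q = j + 1 := by omega
        rw [proj_incl_self, (HomologicalComplex.mem_cycleSubmodule_succ _).1 hy, smul_zero]
      · rw [proj_incl_of_ne D hn hip, map_zero, smul_zero]
    · rw [(tot D).shape _ _ hm]
      exact zero_mem _
  · intro z hz
    have hz' := FilteredComplex.mem_cycles .. |>.1 hz
    have hsq : ((-1 : k) ^ p) * (-1 : k) ^ p = 1 := by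
      rw [← pow_add, Even.neg_one_pow ⟨p, rfl⟩]
    rw [HomologicalComplex.mem_boundarySubmodule]
    refine Iff.trans ?_ (FilteredComplex.mem_boundaries ..).symm
    constructor
    · rintro ⟨w, hw⟩
      have hF : ∀ i j, i + j = n + 1 → (p : ℤ) < i →
          proj D i j (n + 1) ((-1 : k) ^ p • incl D p (q + 1) (n + 1) (by omega) w) = 0 :=
        fun i j _ hi => by rw [map_smul, proj_incl_of_ne D _ (by omega), smul_zero]
      have hd : ∀ i j, i + j = n → (p : ℤ) < i → proj D i j n ((tot D).d (n + 1) n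
          ((-1 : k) ^ p • incl D p (q + 1) (n + 1) (by omega) w)) = 0 := fun i j hij hi => by
        rw [proj_tot_d D hij, hF _ _ (by omega) (by omega), hF _ _ (by omega) (by omega), map_zero,
          map_zero, smul_zero, add_zero]
      -- The sign cancels the one that the total differential puts on column `p`.
      refine ⟨(-1 : k) ^ p • incl D p (q + 1) (n + 1) (by omega) w, ?_, ?_⟩
      · refine FilteredComplex.mem_cycles_succ .. |>.2 ⟨(mem_colFiltration D).2 fun i j hij hi =>
          hF i j hij (by omega), (mem_colFiltration D).2 fun i j hij hi => hd i j hij (by omega)⟩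
      · refine FilteredComplex.mem_cycles .. |>.2
          ⟨(mem_colFiltration D).2 fun i j hij hi => ?_, fun m => ?_⟩
        · rw [map_sub]
          by_cases hip : p = i
          · subst hip
            obtain rfl : q = j := by omega
            rw [proj_tot_d D hij, hF _ _ (by omega) (by omega), map_zero, zero_add, map_smul,
              map_smul, proj_incl_self, smul_smul, hsq, one_smul, hw, sub_self]
          · rw [hd i j hij (by omega), (mem_colFiltration D).1 hz'.1 i j hij (by omega), sub_zero]
        · rw [map_sub]
          have : (tot D).d n m ((tot D).d (n + 1) n
              ((-1 : k) ^ p • incl D p (q + 1) (n + 1) (by omega) w)) = 0 :=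
            LinearMap.congr_fun (congrArg ModuleCat.Hom.hom ((tot D).d_comp_d (n + 1) n m)) _
          rw [this, sub_zero]
          -- The two filtration degrees `p - 1 - (1 - 1)` and `p - 1` agree.
          convert hz'.2 m using 2
          omega
    · rintro ⟨y, hy, h⟩
      have h₁ := (mem_colFiltration D).1 (FilteredComplex.mem_cycles .. |>.1 h).1 p q hn (by omega)
      have h₂ := (mem_colFiltration D).1 (FilteredComplex.mem_cycles .. |>.1 hy).1 (p + 1) q
        (by omega) (by omega)
      rw [map_sub, sub_eq_zero, proj_tot_d D hn, h₂, map_zero, zero_add] at h₁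
      exact ⟨(-1 : k) ^ p • proj D p (q + 1) (n + 1) y, by rw [map_smul, h₁]⟩

end DoubleComplex

/-! ### Weight projections and the image of ι. -/

namespace SplitExtension
variable {k A B : Type u} [Field k] [Ring A] [Algebra k A] [Ring B] [Algebra k B]
  (S : SplitExtension k A B)
open HochschildComplex
variable (X : Type u) [AddCommGroup X] [Module k X] [Module A X] [Module Aᵐᵒᵖ X]
  [SMulCommClass A Aᵐᵒᵖ X] [IsScalarTower k A X] [IsScalarTower k Aᵐᵒᵖ X]

theorem typeProj_typeProj {n : ℕ} (t t' : Fin n → Bool) :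
    S.typeProj X t ∘ₗ S.typeProj X t' = if t = t' then S.typeProj X t' else 0 := by
  refine chain_ext k fun x a => ?_
  rw [LinearMap.comp_apply, typeProj_pureTensor]
  split_ifs with h
  · subst h
    rw [typeProj_pureTensor, typeProj_pureTensor]
    simp only [comp_comp, if_true]
  · exact S.typeProj_eq_zero X t' t h x _ fun i => by rw [comp_comp, if_pos rfl]

/-- The type projections are orthogonal idempotents, and each type has exactly one weight. -/
theorem gradeProj_gradeProj (r s n : ℕ) (z : Chain k A X n) :
    S.gradeProj X r n (S.gradeProj X s n z) = if r = s then S.gradeProj X s n z else 0 := by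
  simp only [gradeProj, LinearMap.sum_apply, map_sum]
  have : ∀ t t' : Fin n → Bool, S.typeProj X t (S.typeProj X t' z) =
      if t = t' then S.typeProj X t' z else 0 := fun t t' => by
    have := LinearMap.congr_fun (S.typeProj_typeProj X t t') z
    rw [LinearMap.comp_apply] at this
    rw [this]; split_ifs <;> rfl
  simp only [this]
  split_ifs with h
  · subst h
    refine Finset.sum_congr rfl fun t ht => ?_
    rw [Finset.sum_ite_eq', if_pos ht]
  · refine Finset.sum_eq_zero fun t ht => ?_
    rw [Finset.sum_ite_eq', if_neg]
    simp only [Finset.mem_filter, Finset.mem_univ, true_and] at ht ⊢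
    omega

theorem gradeProj_of_mem {r n : ℕ} {z : Chain k A X n} (hz : z ∈ S.piece X r n) :
    S.gradeProj X r n z = z := by
  obtain ⟨z, rfl⟩ := hz
  rw [gradeProj_gradeProj, if_pos rfl]

theorem gradeProj_of_mem_of_ne {r s n : ℕ} (h : r ≠ s) {z : Chain k A X n}
    (hz : z ∈ S.piece X s n) : S.gradeProj X r n z = 0 := by
  obtain ⟨z, rfl⟩ := hz
  rw [gradeProj_gradeProj, if_neg h]

theorem weight_eq_zero_iff {n : ℕ} {t : Fin n → Bool} : weight t = 0 ↔ t = fun _ => false := by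
  rw [weight, Finset.sum_eq_zero_iff]
  constructor
  · intro h
    funext i
    simpa using h i (Finset.mem_univ i)
  · rintro rfl
    simp

theorem gradeProj_zero_eq (n : ℕ) : S.gradeProj X 0 n = S.typeProj X (fun _ => false) := by
  rw [gradeProj, Finset.sum_eq_single (fun _ => false)]
  · intro t ht h
    simp only [Finset.mem_filter, Finset.mem_univ, true_and] at ht
    exact absurd (weight_eq_zero_iff.1 ht) h
  · intro h
    simp [weight] at h

theorem gradeProj_iotaLin {n : ℕ} (z : Chain k B (S.Res X) n) :
    S.gradeProj X 0 n (S.iotaLin X n z) = S.iotaLin X n z := by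
  refine LinearMap.congr_fun (f := S.gradeProj X 0 n ∘ₗ S.iotaLin X n) (chain_ext k fun x b => ?_) z
  obtain ⟨x, rfl⟩ := (S.toRes X).surjective x
  rw [LinearMap.comp_apply, iotaLin_pureTensor, gradeProj_zero_eq, typeProj_pureTensor]
  simp [comp, S.retr_incl]

/-- The preimage is obtained by applying the retraction to every letter. Together with
`gradeProj_iotaLin`, the image of the projection onto weight 0 is exactly Im ι. -/
theorem gradeProj_zero_mem (n : ℕ) (z : Chain k A X n) :
    S.gradeProj X 0 n z ∈ LinearMap.range (S.iotaLin X n) := by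
  let r : Chain k A X n →ₗ[k] Chain k B (S.Res X) n :=
    TensorProduct.map (S.toRes X).toLinearMap (PiTensorProduct.map fun _ => S.retr.toLinearMap)
  refine ⟨r z, LinearMap.congr_fun (f := S.iotaLin X n ∘ₗ r) (chain_ext k fun x a => ?_) z⟩
  have : r (pureTensor k A X x a) = pureTensor k B (S.Res X) (S.toRes X x) fun i => S.retr (a i) := by
    simp [r]
  rw [LinearMap.comp_apply, this, iotaLin_pureTensor, gradeProj_zero_eq, typeProj_pureTensor]
  rfl

/-! ### The total complex of C_{*,*} as a complement of Im ι in Ker κ. -/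

section Sequence

/-- The reindexing of chains along an equality of degrees. -/
def chainCast {m n : ℕ} (h : m = n) : Chain k A X m →ₗ[k] Chain k A X n := h ▸ LinearMap.id

/-- The inclusion of the total complex of `C_{*,*}` into `C_*(A, X)`. -/
noncomputable def gapIncl (n : ℕ) : (DoubleComplex.tot (S.gapDoubleComplex X)).X n →ₗ[k]
    Chain k A X n :=
  ((S.gapDoubleComplex X).totalDesc (A := ModuleCat.of k (Chain k A X n)) fun p q h =>
    ModuleCat.ofHom (chainCast X h ∘ₗ (S.gapTerm X p q).subtype)).hom

theorem gapIncl_incl (p q : ℕ) (z : S.gapTerm X p q) :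
    S.gapIncl X (p + q) (DoubleComplex.incl (S.gapDoubleComplex X) p q (p + q) rfl z) = z := by
  have := HomologicalComplex₂.ι_totalDesc (K := S.gapDoubleComplex X) (A := ModuleCat.of k (Chain k A X (p + q)))
    (c₁₂ := ComplexShape.down ℕ) (i₁₂ := p + q)
    (fun p q h => ModuleCat.ofHom (chainCast X h ∘ₗ (S.gapTerm X p q).subtype)) p q rfl
  exact LinearMap.congr_fun (congrArg ModuleCat.Hom.hom this) z

theorem gapDoubleComplex_d (p q : ℕ) (z : S.gapTerm X (p + 1) q) :
    (((S.gapDoubleComplex X).d (p + 1) p).f q).hom z = S.gapHoriz X p q z := by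
  have : (S.gapDoubleComplex X).d (p + 1) p = S.gapMap X p := ChainComplex.of_d _ _ _
  rw [this]
  rfl

theorem gapDoubleComplex_X_d (p q : ℕ) (z : S.gapTerm X p (q + 1)) :
    (((S.gapDoubleComplex X).X p).d (q + 1) q).hom z = (-1 : k) ^ p • S.gapVert X p q z :=
  LinearMap.congr_fun (congrArg ModuleCat.Hom.hom (S.gapColumn_d X p q)) z

/-- A term with `q > 0` has a letter in B in each of its words, which κ kills; the terms with `q =
0` lie in Ker κ by definition. -/
theorem kappaHom_gapIncl (n : ℕ) (z) : (S.kappaHom X n).hom (S.gapIncl X n z) = 0 := by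
  rcases n with _ | n
  · rfl
  refine LinearMap.congr_fun (f := (S.kappaHom X (n + 1)).hom ∘ₗ S.gapIncl X (n + 1)) (g := 0)
    (DoubleComplex.tot_ext _ fun p q h w => ?_) z
  rcases p with _ | p
  · obtain rfl : w = 0 := Subtype.ext w.2
    simp
  rcases q with _ | q
  · obtain rfl : n = p := by omega
    exact (congrArg (S.kappaLin X n) (S.gapIncl_incl X (n + 1) 0 w)).trans w.2.2
  · obtain rfl : n = p + 1 + q := by omega
    refine (congrArg (S.kappaLin X _) (S.gapIncl_incl X (p + 1) (q + 1) w)).trans ?_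
    obtain ⟨w, y, rfl⟩ := w
    exact LinearMap.congr_fun
      (S.kappaLin_gradeProj_of_ne X (n := p + 1 + q) (r := p + 1) (by omega)) y

/-- The summand in column `p` lands in weight `p`, so the coordinates of `z` are recovered as weight
components. This gives injectivity of `gapIncl`. -/
theorem gradeProj_gapIncl {p q n : ℕ} (h : p + q = n) (z) : S.gradeProj X p n (S.gapIncl X n z) =
    chainCast X h (DoubleComplex.proj (S.gapDoubleComplex X) p q n z : S.gapTerm X p q).1 := by
  subst h
  refine LinearMap.congr_fun (f := S.gradeProj X p (p + q) ∘ₗ S.gapIncl X (p + q))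
    (g := (S.gapTerm X p q).subtype ∘ₗ DoubleComplex.proj (S.gapDoubleComplex X) p q (p + q))
    (DoubleComplex.tot_ext _ fun p' q' h w => ?_) z
  by_cases hp : p' = p
  · subst hp
    obtain rfl : q' = q := by omega
    refine (congrArg (S.gradeProj X p' _) (S.gapIncl_incl X p' q' w)).trans ?_
    refine (S.gradeProj_of_mem X (S.gapTerm_le X _ _ w.2)).trans ?_
    exact congrArg Subtype.val (DoubleComplex.proj_incl_self (S.gapDoubleComplex X) h w).symm
  · refine Eq.trans ?_ (congrArg (S.gapTerm X p q).subtype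
      (DoubleComplex.proj_incl_of_ne (S.gapDoubleComplex X) h hp w)).symm
    refine Eq.trans ?_ (map_zero (S.gapTerm X p q).subtype).symm
    clear z
    generalize p + q = n at *
    subst h
    exact (congrArg (S.gradeProj X p _) (S.gapIncl_incl X p' q' w)).trans
      (S.gradeProj_of_mem_of_ne X (Ne.symm hp) (S.gapTerm_le X _ _ w.2))

theorem gradeProj_zero_gapIncl (n : ℕ) (z) : S.gradeProj X 0 n (S.gapIncl X n z) = 0 := by
  rw [S.gradeProj_gapIncl X (zero_add n)]
  have : (DoubleComplex.proj (S.gapDoubleComplex X) 0 n n z : S.gapTerm X 0 n) = 0 :=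
    Subtype.ext (DoubleComplex.proj (S.gapDoubleComplex X) 0 n n z : S.gapTerm X 0 n).2
  rw [this]
  exact map_zero _

theorem gapIncl_injective (n : ℕ) : Function.Injective (S.gapIncl X n) := by
  intro z w h
  refine DoubleComplex.ext_proj _ fun p q hpq => Subtype.ext ?_
  have := congrArg (S.gradeProj X p n) h
  rw [S.gradeProj_gapIncl X hpq, S.gradeProj_gapIncl X hpq] at this
  subst hpq
  exact this

/-- Each weight component of `y` lies in a term of C_{*,*}. Only the component of top weight has to
satisfy a condition, and it has the same image under κ as `y`. -/
theorem exists_gapIncl_eq {n : ℕ} {y : Chain k A X n} (h : (S.kappaHom X n).hom y = 0)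
    (h₀ : S.gradeProj X 0 n y = 0) : ∃ w, S.gapIncl X n w = y := by
  change y ∈ LinearMap.range (S.gapIncl X n)
  rw [S.eq_sum_gradeProj X le_rfl y]
  refine Submodule.sum_mem _ fun p hp => ?_
  rcases p with _ | p
  · rw [h₀]
    exact zero_mem _
  obtain ⟨q, rfl⟩ : ∃ q, n = p + 1 + q := ⟨n - (p + 1), by simp at hp; omega⟩
  have hm : S.gradeProj X (p + 1) (p + 1 + q) y ∈ S.gapTerm X (p + 1) q := by
    rcases q with _ | q
    · exact ⟨S.gradeProj_mem X _ _ _, (S.kappaLin_gradeProj X p y).trans h⟩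
    · exact S.gradeProj_mem X _ _ _
  exact ⟨_, S.gapIncl_incl X (p + 1) q ⟨_, hm⟩⟩

theorem gapIncl_incl' {p q n : ℕ} (h : p + q = n) (z : S.gapTerm X p q) :
    S.gapIncl X n (DoubleComplex.incl (S.gapDoubleComplex X) p q n h z) = chainCast X h z.1 := by
  subst h
  exact S.gapIncl_incl X p q z

theorem chainCast_gradeProj {m n : ℕ} (h : m = n) (p i : ℕ) (z : Chain k A X i) :
    chainCast X h (S.gradeProj X p m (S.bd X i m z)) = S.gradeProj X p n (S.bd X i n z) := by
  subst h
  rfl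

theorem bd_of_ne {m n : ℕ} (h : n + 1 ≠ m) : S.bd X m n = 0 :=
  congrArg ModuleCat.Hom.hom ((HochschildComplex.complex k A X).shape m n h)

theorem gapIncl_d₁ {p q m : ℕ} (h : m + 1 = p + 1 + q) (z : S.gapTerm X (p + 1) q) :
    S.gapIncl X m (((S.gapDoubleComplex X).d₁ (ComplexShape.down ℕ) (p + 1) q m).hom z) =
      if p = 0 then 0 else S.gradeProj X p m (S.bd X (p + 1 + q) m z) := by
  have h' : p + q = m := by omega
  rw [HomologicalComplex₂.d₁_eq _ (ComplexShape.down ℕ) (i₁' := p) rfl q m h']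
  refine (congrArg (S.gapIncl X m) (one_smul ℤˣ _)).trans ?_
  refine (S.gapIncl_incl' X h' _).trans ?_
  refine (congrArg (fun w : S.gapTerm X p q => chainCast X h' w.1)
    (S.gapDoubleComplex_d X p q z)).trans ?_
  have : (S.gapHoriz X p q z).1 =
      if p = 0 then 0 else S.gradeProj X p (p + q) (S.bd X (p + 1 + q) (p + q) z) := by
    change (if p = 0 then 0 else S.gradeProj X p (p + q) ∘ₗ S.bd X (p + 1 + q) (p + q)) z.1 = _
    split_ifs <;> rfl
  change chainCast X h' (S.gapHoriz X p q z).1 = _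
  rw [this]
  split_ifs
  · exact map_zero _
  · exact S.chainCast_gradeProj X h' _ _ _

/-- The sign built into the columns meets the equal sign of the total complex and cancels. For `q =
0` the right side is 0, as the weight exceeds the number of letters. -/
theorem gapIncl_d₂ {p q m : ℕ} (h : m + 1 = p + 1 + q) (z : S.gapTerm X (p + 1) q) :
    S.gapIncl X m (((S.gapDoubleComplex X).d₂ (ComplexShape.down ℕ) (p + 1) q m).hom z) =
      S.gradeProj X (p + 1) m (S.bd X (p + 1 + q) m z) := by
  rcases q with _ | q
  · rw [HomologicalComplex₂.d₂_eq_zero _ _ _ _ _ (by simp), S.gradeProj_eq_zero X (by omega)]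
    exact map_zero _
  have h' : p + 1 + q = m := by omega
  rw [HomologicalComplex₂.d₂_eq _ (ComplexShape.down ℕ) (p + 1) (i₂' := q) rfl m h']
  refine (congrArg (S.gapIncl X m) (DoubleComplex.units_smul_eq (k := k) (p + 1) _)).trans ?_
  rw [map_smul]
  refine (congrArg ((-1 : k) ^ (p + 1) • ·) ((S.gapIncl_incl' X h' _).trans
    (congrArg (fun w : S.gapTerm X (p + 1) q => chainCast X h' w.1)
      (S.gapDoubleComplex_X_d X (p + 1) q z)))).trans ?_
  change (-1 : k) ^ (p + 1) • chainCast X h'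
    ((-1 : k) ^ (p + 1) • (S.gapVert X (p + 1) q z).1) = _
  rw [map_smul, smul_smul, ← pow_add, Even.neg_one_pow ⟨p + 1, rfl⟩, one_smul]
  exact S.chainCast_gradeProj X h' _ _ _

/-- `gapIncl` is not a chain map into C_*(A, X): the component of b from weight 1 to weight 0 is
missing in C_{*,*}, whose column 0 is zero. The defect lies in Im ι, so `gapIncl` becomes a chain
map modulo Im ι. -/
theorem gapIncl_d (n m : ℕ) (z) :
    S.gapIncl X m ((DoubleComplex.tot (S.gapDoubleComplex X)).d n m z) =
      S.bd X n m (S.gapIncl X n z) - S.gradeProj X 0 m (S.bd X n m (S.gapIncl X n z)) := by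
  by_cases hm : m + 1 = n
  swap
  · rw [S.bd_of_ne X hm, (DoubleComplex.tot (S.gapDoubleComplex X)).shape n m hm]
    simp
  refine LinearMap.congr_fun (f := S.gapIncl X m ∘ₗ
      ((DoubleComplex.tot (S.gapDoubleComplex X)).d n m).hom)
    (g := S.bd X n m ∘ₗ S.gapIncl X n - S.gradeProj X 0 m ∘ₗ S.bd X n m ∘ₗ S.gapIncl X n)
    (DoubleComplex.tot_ext _ fun p q h w => ?_) z
  rcases p with _ | p
  · obtain rfl : w = 0 := Subtype.ext w.2
    simp
  clear z
  subst h
  refine (congrArg (S.gapIncl X m) (DoubleComplex.tot_d_incl _ rfl m w)).trans ?_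
  rw [map_add, S.gapIncl_d₁ X hm w, S.gapIncl_d₂ X hm w]
  simp only [LinearMap.sub_apply, LinearMap.comp_apply]
  rw [S.gapIncl_incl X (p + 1) q w]
  conv_rhs => rw [S.bd_eq X (S.gapTerm_le X _ _ w.2), map_add]
  rw [gradeProj_gradeProj, gradeProj_gradeProj, if_neg (Nat.succ_ne_zero p).symm, zero_add]
  rcases p with _ | p
  · simp
  · rw [if_neg (Nat.succ_ne_zero p), if_neg (Nat.succ_ne_zero p).symm, sub_zero, add_comm]

theorem kappaHom_gradeProj_zero (n : ℕ) (y : Chain k A X n) :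
    (S.kappaHom X n).hom (S.gradeProj X 0 n y) = 0 := by
  rcases n with _ | n
  · rfl
  · exact LinearMap.congr_fun (S.kappaLin_gradeProj_of_ne X (by omega)) y

theorem bd_iotaLin (n m : ℕ) (b : Chain k B (S.Res X) n) :
    S.bd X n m (S.iotaLin X n b) ∈ LinearMap.range (S.iotaLin X m) := by
  by_cases h : m + 1 = n
  · subst h
    rw [bd_succ]
    exact ⟨_, LinearMap.congr_fun (S.iotaLin_boundary m) b⟩
  · rw [S.bd_of_ne X h]
    exact zero_mem _

/-- The cycles of the complex `Ker κ / Im ι`. -/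
noncomputable def middleCycles (n : ℕ) : Submodule k (Chain k A X n) :=
  LinearMap.ker (S.kappaHom X n).hom ⊓
    ⨅ m, (LinearMap.range (S.iotaLin X m)).comap (S.bd X n m)

/-- The boundaries of the complex `Ker κ / Im ι`. -/
noncomputable def middleBoundaries (n : ℕ) : Submodule k (Chain k A X n) :=
  (LinearMap.ker (S.kappaHom X (n + 1)).hom).map (S.bd X (n + 1) n) ⊔
    LinearMap.range (S.iotaLin X n)

theorem mem_middleCycles {n : ℕ} {y : Chain k A X n} : y ∈ S.middleCycles X n ↔
    (S.kappaHom X n).hom y = 0 ∧ ∀ m, S.bd X n m y ∈ LinearMap.range (S.iotaLin X m) := by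
  simp only [middleCycles, Submodule.mem_inf, Submodule.mem_iInf, Submodule.mem_comap]
  rfl

theorem mem_middleBoundaries {n : ℕ} {y : Chain k A X n} : y ∈ S.middleBoundaries X n ↔
    ∃ z, (S.kappaHom X (n + 1)).hom z = 0 ∧
      y - S.bd X (n + 1) n z ∈ LinearMap.range (S.iotaLin X n) := by
  rw [middleBoundaries, Submodule.mem_sup]
  constructor
  · rintro ⟨_, ⟨z, hz, rfl⟩, w, hw, rfl⟩
    exact ⟨z, hz, by simpa using hw⟩
  · rintro ⟨z, hz, h⟩
    exact ⟨_, ⟨z, hz, rfl⟩, _, h, by simp⟩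

theorem sub_gradeProj_zero_of_mem {n : ℕ} {y : Chain k A X n}
    (h : y ∈ LinearMap.range (S.iotaLin X n)) : y - S.gradeProj X 0 n y = 0 := by
  obtain ⟨b, rfl⟩ := h
  rw [gradeProj_iotaLin, sub_self]

/-- Modulo Im ι, `gapIncl` is an isomorphism of complexes from Tot C onto Ker κ / Im ι. -/
theorem nonempty_homologyEquiv_middle (n : ℕ) :
    Nonempty (((DoubleComplex.tot (S.gapDoubleComplex X)).homology n : ModuleCat.{u} k) ≃ₗ[k]
      (S.middleCycles X n ⧸ (S.middleBoundaries X n).comap (S.middleCycles X n).subtype)) := by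
  obtain ⟨e⟩ := (DoubleComplex.tot (S.gapDoubleComplex X)).nonempty_homologyEquiv n
  suffices h : Nonempty (_ ≃ₗ[k] _) from ⟨e.trans h.some⟩
  refine nonempty_subquotientEquiv (S.gapIncl X n) ?_ ?_ ?_
  · intro z hz
    refine (S.mem_middleCycles X).2 ⟨S.kappaHom_gapIncl X n z, fun m => ?_⟩
    have h := S.gapIncl_d X n m z
    have hz' : (DoubleComplex.tot (S.gapDoubleComplex X)).d n m z = 0 :=
      (HomologicalComplex.mem_cycleSubmodule _).1 hz m
    rw [hz', map_zero] at h
    rw [sub_eq_zero.1 h.symm]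
    exact S.gradeProj_zero_mem X m _
  · intro y hy
    obtain ⟨hκ, hb⟩ := (S.mem_middleCycles X).1 hy
    -- Removing the part of weight 0 leaves the class modulo Im ι unchanged and brings `y` into the
    -- image of `gapIncl`.
    obtain ⟨w, hw⟩ := S.exists_gapIncl_eq X (y := y - S.gradeProj X 0 n y)
      (by rw [map_sub, kappaHom_gradeProj_zero, hκ, sub_zero])
      (by rw [map_sub, gradeProj_gradeProj, if_pos rfl, sub_self])
    refine ⟨w, (HomologicalComplex.mem_cycleSubmodule _).2 fun m => ?_,
      (S.mem_middleBoundaries X).2 ⟨0, map_zero _, ?_⟩⟩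
    · refine S.gapIncl_injective X m ?_
      rw [gapIncl_d, hw, map_zero]
      refine S.sub_gradeProj_zero_of_mem X ?_
      rw [map_sub]
      refine sub_mem (hb m) ?_
      obtain ⟨b, hb'⟩ := S.gradeProj_zero_mem X n y
      rw [← hb']
      exact S.bd_iotaLin X n m b
    · rw [hw, map_zero, sub_zero, sub_sub_cancel]
      exact S.gradeProj_zero_mem X n y
  · intro z hz
    rw [HomologicalComplex.mem_boundarySubmodule, S.mem_middleBoundaries X]
    constructor
    · rintro ⟨y, hy, h⟩
      obtain ⟨w, hw⟩ := S.exists_gapIncl_eq X (y := y - S.gradeProj X 0 (n + 1) y)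
        (by rw [map_sub, kappaHom_gradeProj_zero, hy, sub_zero])
        (by rw [map_sub, gradeProj_gradeProj, if_pos rfl, sub_self])
      refine ⟨w, S.gapIncl_injective X n ?_⟩
      have h₁ : S.gapIncl X n z - S.bd X (n + 1) n (S.gapIncl X (n + 1) w) ∈
          LinearMap.range (S.iotaLin X n) := by
        rw [hw, map_sub, sub_sub_eq_add_sub, add_sub_right_comm]
        refine add_mem h ?_
        obtain ⟨b, hb'⟩ := S.gradeProj_zero_mem X (n + 1) y
        rw [← hb']
        exact S.bd_iotaLin X (n + 1) n b
      -- An element of Im ι equals its own weight 0 part. This turns the congruence modulo Im ι into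
      -- the exact formula of `gapIncl_d`.
      have h₂ := S.sub_gradeProj_zero_of_mem X h₁
      rw [map_sub, gradeProj_zero_gapIncl, zero_sub, sub_neg_eq_add] at h₂
      rw [gapIncl_d]
      exact (sub_eq_zero.1 (by rw [← h₂]; abel)).symm
    · rintro ⟨w, rfl⟩
      refine ⟨S.gapIncl X (n + 1) w, S.kappaHom_gapIncl X _ w, ?_⟩
      rw [gapIncl_d, sub_sub_cancel_left]
      exact neg_mem (S.gradeProj_zero_mem X n _)

/-! ### The second page of the sequence double complex. -/

open DoubleComplex in
theorem proj_zero_sequence_d {m : ℕ} {z : (tot (S.sequenceDoubleComplex X)).X (m + 1)}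
    (hz : proj (S.sequenceDoubleComplex X) 0 (m + 1) (m + 1) z = 0) :
    proj (S.sequenceDoubleComplex X) 0 m m
        ((tot (S.sequenceDoubleComplex X)).d (m + 1) m z) =
      (S.kappaHom X m).hom (proj (S.sequenceDoubleComplex X) 1 m (m + 1) z) := by
  have d₁ : (S.sequenceDoubleComplex X).d 1 0 = S.kappa X := ChainComplex.mk_d_1_0 _ _ _ _ _ _ _
  rw [proj_tot_d _ (zero_add m), hz, map_zero, smul_zero, add_zero, d₁]
  rfl

open DoubleComplex in
theorem proj_one_sequence_d {m : ℕ} (z : (tot (S.sequenceDoubleComplex X)).X (m + 2)) :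
    proj (S.sequenceDoubleComplex X) 1 m (m + 1)
        ((tot (S.sequenceDoubleComplex X)).d (m + 2) (m + 1) z) =
      S.iotaLin X m (proj (S.sequenceDoubleComplex X) 2 m (m + 2) z) -
        S.bd X (m + 1) m (proj (S.sequenceDoubleComplex X) 1 (m + 1) (m + 2) z) := by
  have d₂ : (S.sequenceDoubleComplex X).d 2 1 = S.iota X := ChainComplex.mk_d_2_1 _ _ _ _ _ _ _
  rw [proj_tot_d _ (add_comm 1 m), pow_one, neg_one_smul, d₂, sub_eq_add_neg]
  rfl

open DoubleComplex in
-- Row `n` in total degree `n + 1` is the spot in column 1, and the isomorphism is the coordinate in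
-- that column. For `z` in F_n, the condition that dz lies in F_{n-2} says that κ kills this
-- coordinate and that its boundary is ι of the coordinate in column 2.
theorem nonempty_rowPageEquiv_middle (n : ℕ) :
    Nonempty (rowPage (S.sequenceDoubleComplex X) 2 n (n + 1) ≃ₗ[k]
      (S.middleCycles X n ⧸ (S.middleBoundaries X n).comap (S.middleCycles X n).subtype)) := by
  have hκ {m : ℕ} {z} := S.proj_zero_sequence_d X (m := m) (z := z)
  have hι {m : ℕ} (z) := S.proj_one_sequence_d X (m := m) z
  let p₁ (m n : ℕ) : (tot (S.sequenceDoubleComplex X)).X n →ₗ[k] Chain k A X m :=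
    proj (S.sequenceDoubleComplex X) 1 m n
  let p₂ (m n : ℕ) : (tot (S.sequenceDoubleComplex X)).X n →ₗ[k] Chain k B (S.Res X) m :=
    proj (S.sequenceDoubleComplex X) 2 m n
  let i₁ (m n : ℕ) (h : 1 + m = n) : Chain k A X m →ₗ[k] (tot (S.sequenceDoubleComplex X)).X n :=
    DoubleComplex.incl (S.sequenceDoubleComplex X) 1 m n h
  let i₂ (m n : ℕ) (h : 2 + m = n) : Chain k B (S.Res X) m →ₗ[k]
      (tot (S.sequenceDoubleComplex X)).X n :=
    DoubleComplex.incl (S.sequenceDoubleComplex X) 2 m n h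
  have pi₁₁ : ∀ m n h y, p₁ m n (i₁ m n h y) = y := fun m n h y => proj_incl_self (S.sequenceDoubleComplex X) h _
  have pi₂₂ : ∀ m n h y, p₂ m n (i₂ m n h y) = y := fun m n h y => proj_incl_self (S.sequenceDoubleComplex X) h _
  have pi₁₂ : ∀ m m' n h y, p₁ m n (i₂ m' n h y) = 0 :=
    fun m m' n h y => proj_incl_of_ne _ h (by omega) _
  have pi₂₁ : ∀ m m' n h y, p₂ m n (i₁ m' n h y) = 0 :=
    fun m m' n h y => proj_incl_of_ne _ h (by omega) _
  have pi₀₁ : ∀ m m' n h y, proj (S.sequenceDoubleComplex X) 0 m n (i₁ m' n h y) = 0 :=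
    fun m m' n h y => proj_incl_of_ne _ h (by omega) _
  have pi₀₂ : ∀ m m' n h y, proj (S.sequenceDoubleComplex X) 0 m n (i₂ m' n h y) = 0 :=
    fun m m' n h y => proj_incl_of_ne _ h (by omega) _
  clear_value i₁ i₂
  refine nonempty_subquotientEquiv (p₁ n (n + 1)) ?_ ?_ ?_
  · intro z hz
    have h := FilteredComplex.mem_cycles_succ .. |>.1 hz
    have h₀ := (mem_rowFiltration _).1 h.1 0 (n + 1) (by omega) (by omega)
    have h₁ := (mem_rowFiltration _).1 h.2 0 n (by omega) (by omega)
    rw [hκ h₀] at h₁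
    refine (S.mem_middleCycles X).2 ⟨h₁, fun m => ?_⟩
    by_cases hm : m + 1 = n
    · subst hm
      have h₂ := (mem_rowFiltration _).1 h.2 1 m (by omega) (by push_cast; omega)
      rw [hι] at h₂
      exact ⟨_, sub_eq_zero.1 h₂⟩
    · rw [S.bd_of_ne X hm]
      exact zero_mem _
  · intro y hy
    obtain ⟨hy₁, hy₂⟩ := (S.mem_middleCycles X).1 hy
    -- The lift of `y` needs a coordinate in column 2 whose image under ι is the boundary of `y`.
    -- For `n = 0` there is no such coordinate and no condition.
    obtain ⟨z, hz₀, hz₁, hz₂⟩ : ∃ z, proj (S.sequenceDoubleComplex X) 0 (n + 1) (n + 1) z = 0 ∧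
        p₁ n (n + 1) z = y ∧ ∀ m, m + 1 = n → S.iotaLin X m (p₂ m (n + 1) z) = S.bd X n m y := by
      rcases n with _ | m
      · exact ⟨i₁ 0 1 rfl y, pi₀₁ _ _ _ _ _, pi₁₁ _ _ _ _, fun m hm => by omega⟩
      · obtain ⟨b, hb⟩ := hy₂ m
        refine ⟨i₁ (m + 1) (m + 1 + 1) (by omega) y + i₂ m (m + 1 + 1) (by omega) b, ?_, ?_,
          fun m' hm' => ?_⟩
        · rw [map_add, pi₀₁, pi₀₂, add_zero]
        · rw [map_add, pi₁₁, pi₁₂, add_zero]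
        · obtain rfl : m = m' := by omega
          rw [map_add, pi₂₁, pi₂₂, zero_add, hb]
    refine ⟨z, FilteredComplex.mem_cycles_succ .. |>.2 ⟨(mem_rowFiltration _).2 ?_,
      (mem_rowFiltration _).2 ?_⟩, by rw [hz₁, sub_self]; exact zero_mem _⟩
    · intro i j hij hj
      obtain rfl : i = 0 := by omega
      obtain rfl : j = n + 1 := by omega
      exact hz₀
    · intro i j hij hj
      rcases i with _ | _ | i
      · obtain rfl : j = n := by omega
        rw [hκ hz₀]
        exact (congrArg _ hz₁).trans hy₁
      · obtain rfl : n = j + 1 := by omega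
        refine (hι z).trans ?_
        exact sub_eq_zero.2 ((hz₂ j rfl).trans (congrArg _ hz₁.symm))
      · omega
  · intro z hz
    have h := FilteredComplex.mem_cycles_succ .. |>.1 hz
    have h₀ := (mem_rowFiltration _).1 h.1 0 (n + 1) (by omega) (by omega)
    rw [S.mem_middleBoundaries X]
    refine Iff.trans ?_ (FilteredComplex.mem_boundaries ..).symm
    constructor
    · rintro ⟨y, hy, b, hb⟩
      -- In column 1 the total differential is ι minus the boundary of C_*(A, X), so `-y`
      -- contributes the boundary of `y`.
      let w := i₂ n (n + 1 + 1) (by omega) b - i₁ (n + 1) (n + 1 + 1) (by omega) y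
      have hw₀ : proj (S.sequenceDoubleComplex X) 0 (n + 1 + 1) (n + 1 + 1) w = 0 := by
        simp only [w]
        rw [map_sub, pi₀₁, pi₀₂, sub_zero]
      have hw₁ : p₁ (n + 1) (n + 1 + 1) w = -y := by
        simp only [w]
        rw [map_sub, pi₁₁, pi₁₂, zero_sub]
      have hw₂ : p₂ n (n + 1 + 1) w = b := by
        simp only [w]
        rw [map_sub, pi₂₁, pi₂₂, sub_zero]
      clear_value w
      have hdw₀ : proj (S.sequenceDoubleComplex X) 0 (n + 1) (n + 1)
          ((tot (S.sequenceDoubleComplex X)).d (n + 1 + 1) (n + 1) w) = 0 := by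
        refine (hκ hw₀).trans ((congrArg _ hw₁).trans ?_)
        rw [map_neg, hy, neg_zero]
        rfl
      have hdw₁ : p₁ n (n + 1) ((tot (S.sequenceDoubleComplex X)).d (n + 1 + 1) (n + 1) w) =
          p₁ n (n + 1) z := by
        refine (hι w).trans ((congrArg₂ (fun b y => S.iotaLin X n b - S.bd X (n + 1) n y)
          hw₂ hw₁).trans ?_)
        simp only [map_neg, sub_neg_eq_add, hb, sub_add_cancel]
      refine ⟨w, FilteredComplex.mem_cycles_succ .. |>.2 ⟨(mem_rowFiltration _).2 ?_,
        (mem_rowFiltration _).2 ?_⟩, FilteredComplex.mem_cycles_succ .. |>.2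
        ⟨(mem_rowFiltration _).2 ?_, ?_⟩⟩
      · intro i j hij hj
        obtain rfl : i = 0 := by omega
        obtain rfl : j = n + 1 + 1 := by omega
        exact hw₀
      · intro i j hij hj
        obtain rfl : i = 0 := by omega
        obtain rfl : j = n + 1 := by omega
        exact hdw₀
      · intro i j hij hj
        rw [map_sub, sub_eq_zero]
        rcases i with _ | _ | i
        · obtain rfl : j = n + 1 := by omega
          exact h₀.trans hdw₀.symm
        · obtain rfl : n = j := by omega
          exact hdw₁.symm
        · omega
      · have : (tot (S.sequenceDoubleComplex X)).d (n + 1) n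
            ((tot (S.sequenceDoubleComplex X)).d (n + 1 + 1) (n + 1) w) = 0 :=
          LinearMap.congr_fun (congrArg ModuleCat.Hom.hom
            ((tot (S.sequenceDoubleComplex X)).d_comp_d (n + 1 + 1) (n + 1) n)) w
        rw [map_sub, this, sub_zero]
        convert h.2 using 2
        omega
    · rintro ⟨w, hw, hzw⟩
      have h₁ := FilteredComplex.mem_cycles_succ .. |>.1 hw
      have hw₀ := (mem_rowFiltration _).1 h₁.1 0 (n + 1 + 1) (by omega) (by omega)
      have hw₁ := (mem_rowFiltration _).1 h₁.2 0 (n + 1) (by omega) (by omega)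
      have hw₂ := (mem_rowFiltration _).1 (FilteredComplex.mem_cycles .. |>.1 hzw).1 1 n
        (by omega) (by omega)
      rw [hκ hw₀] at hw₁
      rw [map_sub, hι] at hw₂
      refine ⟨-p₁ (n + 1) (n + 1 + 1) w, ?_, ⟨p₂ n (n + 1 + 1) w, ?_⟩⟩
      · rw [map_neg, neg_eq_zero]
        exact hw₁
      · rw [map_neg, sub_neg_eq_add]
        exact (sub_eq_iff_eq_add.1 (sub_eq_zero.1 hw₂).symm)

theorem nonempty_rowPageEquiv_homology (n : ℕ) :
    Nonempty (DoubleComplex.rowPage (S.sequenceDoubleComplex X) 2 n (n + 1) ≃ₗ[k]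
      ((DoubleComplex.tot (S.gapDoubleComplex X)).homology n : ModuleCat.{u} k)) := by
  obtain ⟨e₁⟩ := S.nonempty_rowPageEquiv_middle X n
  obtain ⟨e₂⟩ := S.nonempty_homologyEquiv_middle X n
  exact ⟨e₁.trans e₂.symm⟩

end Sequence
end SplitExtension

/-! ### Computing Tor from an explicit resolution. -/

section Resolution

variable {R : Type u} [Ring R] {P : ℕ → Type u} [∀ q, AddCommGroup (P q)] [∀ q, Module R (P q)]
  {Y : Type u} [AddCommGroup Y] [Module R Y] (D : ∀ q, P (q + 1) →ₗ[R] P q) (ε : P 0 →ₗ[R] Y)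

/-- The chain complex of a sequence of modules. -/
noncomputable def moduleComplex (hD : ∀ q, D q ∘ₗ D (q + 1) = 0) : ChainComplex (ModuleCat.{u} R) ℕ :=
  ChainComplex.of (fun q => ModuleCat.of R (P q)) (fun q => ModuleCat.ofHom (D q)) fun q => by
    rw [← ModuleCat.ofHom_comp, hD]; rfl

theorem moduleComplex_d (hD : ∀ q, D q ∘ₗ D (q + 1) = 0) (q : ℕ) :
    (moduleComplex D hD).d (q + 1) q = ModuleCat.ofHom (D q) :=
  ChainComplex.of_d (fun q => ModuleCat.of R (P q)) (fun q => ModuleCat.ofHom (D q)) q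

/-- An exact sequence of projective modules as a projective resolution. -/
noncomputable def moduleResolution (hP : ∀ q, Module.Projective R (P q))
    (hε : Function.Surjective ε) (h₀ : Function.Exact (D 0) ε)
    (hD : ∀ q, Function.Exact (D (q + 1)) (D q)) : ProjectiveResolution (ModuleCat.of R Y) where
  complex := moduleComplex D fun q => (hD q).linearMap_comp_eq_zero
  projective q := (IsProjective.iff_projective (P q)).1 (hP q)
  π := (ChainComplex.toSingle₀Equiv _ _).symm ⟨ModuleCat.ofHom ε, by
    rw [moduleComplex_d]
    exact congrArg ModuleCat.ofHom h₀.linearMap_comp_eq_zero⟩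
  quasiIso := ⟨fun n => by
    rcases n with _ | n
    -- In degree 0 the condition is exactness of P₁ → P₀ → Y together with surjectivity of ε.
    · rw [ChainComplex.quasiIsoAt₀_iff, ShortComplex.quasiIso_iff_of_zeros' _ (HomologicalComplex.shape
        (moduleComplex D fun q => (hD q).linearMap_comp_eq_zero) 0 0
        (by simp : ¬(ComplexShape.down ℕ).Rel 0 0)) rfl rfl]
      constructor
      · rw [ShortComplex.moduleCat_exact_iff]
        intro y hy
        have hy' : ε y = 0 := by
          refine Eq.trans ?_ hy
          refine (LinearMap.congr_fun (congrArg ModuleCat.Hom.hom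
            (ChainComplex.toSingle₀Equiv_symm_apply_f_zero (C := moduleComplex D
            fun q => (hD q).linearMap_comp_eq_zero) (X := ModuleCat.of R Y) (ModuleCat.ofHom ε) _)) y).symm
        obtain ⟨x, hx⟩ := (h₀ y).1 hy'
        refine ⟨x, Eq.trans ?_ hx⟩
        exact LinearMap.congr_fun (congrArg ModuleCat.Hom.hom (moduleComplex_d D (fun q => (hD q).linearMap_comp_eq_zero) 0)) x
      · rw [ModuleCat.epi_iff_surjective]
        intro y
        obtain ⟨x, hx⟩ := hε y
        refine ⟨x, Eq.trans ?_ hx⟩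
        exact LinearMap.congr_fun (congrArg ModuleCat.Hom.hom
            (ChainComplex.toSingle₀Equiv_symm_apply_f_zero (C := moduleComplex D
            fun q => (hD q).linearMap_comp_eq_zero) (X := ModuleCat.of R Y) (ModuleCat.ofHom ε) _)) x
    -- In positive degrees the target is zero, so only exactness of P is needed.
    · rw [quasiIsoAt_iff_exactAt' (hL := ChainComplex.exactAt_succ_single_obj ..),
          HomologicalComplex.exactAt_iff' _ (n + 2) (n + 1) n (by simp) (by simp)]
      rw [ShortComplex.moduleCat_exact_iff]
      intro y hy
      have hy' : D n y = 0 := by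
        refine Eq.trans ?_ hy
        exact (LinearMap.congr_fun (congrArg ModuleCat.Hom.hom (moduleComplex_d D (fun q => (hD q).linearMap_comp_eq_zero) n)) y).symm
      obtain ⟨x, hx⟩ := (hD n y).1 hy'
      refine ⟨x, Eq.trans ?_ hx⟩
      exact LinearMap.congr_fun (congrArg ModuleCat.Hom.hom (moduleComplex_d D (fun q => (hD q).linearMap_comp_eq_zero) (n + 1))) x⟩

end Resolution

/-! ### Tensor products over R of generated modules, and Tor. -/

section TensorOver

attribute [local instance] ModuleCat.moduleOfAlgebraModule
  ModuleCat.isScalarTower_of_algebra_moduleCat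

variable {k R X : Type u} [Field k] [Ring R] [Algebra k R] [AddCommGroup X] [Module k X]
  [Module Rᵐᵒᵖ X]

/-- `tensorOverFunctor` uses the k-structure that comes from R, whereas the concrete modules carry
their own; the scalar tower forces the two to agree. -/
theorem module_eq_moduleOfAlgebraModule (P : Type u) [AddCommGroup P] [inst : Module k P]
    [Module R P] [IsScalarTower k R P] :
    inst = (ModuleCat.of R P).moduleOfAlgebraModule :=
  Module.ext' _ _ fun c y => (algebraMap_smul (M := P) R c y).symm

section Single

variable {P : ModuleCat.{u} R} {U T : Type u} [AddCommGroup U] [Module k U] [AddCommGroup T] [Module k T]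

/-- The map on `X ⊗_R P` induced by a balanced bilinear map. -/
noncomputable def tensorOverLift (β : X →ₗ[k] P →ₗ[k] T)
    (hβ : ∀ x (r : R) y, β (MulOpposite.op r • x) y = β x (r • y)) :
    TensorOver k R X P →ₗ[k] T :=
  (balancedRel k R X P).liftQ (TensorProduct.lift β) (by
    refine Submodule.span_le.2 ?_
    rintro _ ⟨x, r, y, rfl⟩
    rw [SetLike.mem_coe, LinearMap.mem_ker, map_sub, sub_eq_zero]
    exact hβ x r y)

/-- X ⊗ U maps onto X ⊗_R P because U generates P. The composite of this surjection with the map to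
T is bijective, so both maps are. No basis of P is needed. -/
theorem tensorOverLift_bijective (β : X →ₗ[k] P →ₗ[k] T)
    (hβ : ∀ x (r : R) y, β (MulOpposite.op r • x) y = β x (r • y)) (u : U →ₗ[k] P)
    (hu : Submodule.span R (Set.range u) = ⊤)
    (hT : Function.Bijective (TensorProduct.lift (β.compl₂ u))) :
    Function.Bijective (tensorOverLift β hβ) := by
  let j : X ⊗[k] U →ₗ[k] TensorOver k R X P :=
    (balancedRel k R X P).mkQ ∘ₗ u.lTensor X
  have hj : tensorOverLift β hβ ∘ₗ j = TensorProduct.lift (β.compl₂ u) :=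
    TensorProduct.ext' fun x w => rfl
  have hj' : Function.Surjective j := by
    rw [← LinearMap.range_eq_top, eq_top_iff]
    rintro y -
    obtain ⟨y, rfl⟩ := Submodule.mkQ_surjective _ y
    induction y using TensorProduct.induction_on with
    | zero => rw [map_zero]; exact zero_mem _
    | add y z hy hz => rw [map_add]; exact add_mem hy hz
    | tmul x y =>
      have hy : @Membership.mem P _ _ (Submodule.span R (Set.range u)) y := hu ▸ Submodule.mem_top
      -- `x` must vary, because a scalar from R is moved across the tensor sign onto it.
      induction hy using Submodule.span_induction generalizing x with
      | mem y hy =>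
        obtain ⟨w, rfl⟩ := hy
        exact ⟨x ⊗ₜ w, rfl⟩
      | zero =>
        have := TensorProduct.tmul_zero (R := k) P x
        exact (congrArg (balancedRel k R X P).mkQ this).trans (map_zero _) ▸
          zero_mem _
      | add y z _ _ hy hz =>
        have := TensorProduct.tmul_add (R := k) (N := P) x y z
        exact ((congrArg (balancedRel k R X P).mkQ this).trans (map_add _ _ _)) ▸
          add_mem (hy x) (hz x)
      | smul r y _ hy =>
        have : (balancedRel k R X P).mkQ (x ⊗ₜ (r • y)) =
            (balancedRel k R X P).mkQ
              ((MulOpposite.op r • x) ⊗ₜ y) :=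
          ((Submodule.Quotient.eq (balancedRel k R X P)).2 (Submodule.subset_span ⟨x, r, y, rfl⟩)).symm
        exact this ▸ hy _
  refine ⟨fun y z h => ?_, fun t => ?_⟩
  · obtain ⟨y, rfl⟩ := hj' y
    obtain ⟨z, rfl⟩ := hj' z
    have e : ∀ y, tensorOverLift β hβ (j y) = TensorProduct.lift (β.compl₂ u) y :=
      LinearMap.congr_fun hj
    rw [e, e] at h
    rw [hT.1 h]
  · obtain ⟨y, rfl⟩ := hT.2 t
    exact ⟨j y, LinearMap.congr_fun hj y⟩

end Single

section Complex

variable {Y : Type u} [AddCommGroup Y] [Module R Y] (Q : ProjectiveResolution (ModuleCat.of R Y))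
  {T : ℕ → Type u} [∀ q, AddCommGroup (T q)] [∀ q, Module k (T q)]

/-- Computation of `Tor` in positive degrees from a projective resolution. -/
theorem nonempty_torOverEquiv_of_resolution
    (f : ∀ q, (tensorOverFunctor k R X).obj (Q.complex.X q) →ₗ[k] T q)
    (hf : ∀ q, Function.Bijective (f q)) (δ : ∀ q, T (q + 1) →ₗ[k] T q)
    (hδ : ∀ q, f q ∘ₗ ((tensorOverFunctor k R X).map (Q.complex.d (q + 1) q)).hom =
      δ q ∘ₗ f (q + 1)) (q : ℕ) :
    Nonempty ((LinearMap.ker (δ q) ⧸ (LinearMap.range (δ (q + 1))).comap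
      (LinearMap.ker (δ q)).subtype) ≃ₗ[k] TorOver k R X Y (q + 1)) := by
  have e₁ := (Q.isoLeftDerivedObj (tensorOverFunctor k R X) (q + 1)).toLinearEquiv
  obtain ⟨e₂⟩ := (((tensorOverFunctor k R X).mapHomologicalComplex _).obj
    Q.complex).nonempty_homologyEquiv (q + 1)
  suffices h : Nonempty (_ ≃ₗ[k] _) from ⟨h.some.symm.trans (e₁.trans e₂).symm⟩
  have hfd : ∀ q z, f q ((((tensorOverFunctor k R X).mapHomologicalComplex _).obj
      Q.complex).d (q + 1) q z) = δ q (f (q + 1) z) := fun q z => LinearMap.congr_fun (hδ q) z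
  refine nonempty_subquotientEquiv (f (q + 1)) ?_ ?_ ?_
  · intro z hz
    have := (HomologicalComplex.mem_cycleSubmodule_succ _).1 hz
    rw [LinearMap.mem_ker]
    exact (hfd q z).symm.trans ((congrArg (f q) this).trans (map_zero _))
  · intro t ht
    obtain ⟨z, rfl⟩ := (hf (q + 1)).2 t
    refine ⟨z, (HomologicalComplex.mem_cycleSubmodule_succ _).2 ((hf q).1 ?_), by simp⟩
    exact (hfd q z).trans (Eq.trans ht (map_zero _).symm)
  · intro z _
    refine Iff.trans ?_ (HomologicalComplex.mem_boundarySubmodule _).symm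
    constructor
    · rintro ⟨t, ht⟩
      obtain ⟨w, rfl⟩ := (hf (q + 2)).2 t
      exact ⟨w, (hf (q + 1)).1 ((hfd (q + 1) w).trans ht)⟩
    · rintro ⟨w, rfl⟩
      exact ⟨f (q + 2) w, (hfd (q + 1) w).symm⟩

end Complex

variable {P U T : ℕ → Type u} [∀ q, AddCommGroup (P q)] [instP : ∀ q, Module k (P q)]
  [∀ q, Module R (P q)] [∀ q, IsScalarTower k R (P q)]
  [∀ q, AddCommGroup (U q)] [∀ q, Module k (U q)] [∀ q, AddCommGroup (T q)] [∀ q, Module k (T q)]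
  {Y : Type u} [AddCommGroup Y] [Module R Y]

/-- Computation of `Tor` in positive degrees from a projective resolution `P` whose terms are
generated over `R` by `k`-spaces `U` with `X ⊗_R P ≃ X ⊗ U ≃ T`. -/
theorem nonempty_torOverEquiv (D : ∀ q, P (q + 1) →ₗ[R] P q) (ε : P 0 →ₗ[R] Y)
    (hP : ∀ q, Module.Projective R (P q))
    (hε : Function.Surjective ε) (h₀ : Function.Exact (D 0) ε)
    (hD : ∀ q, Function.Exact (D (q + 1)) (D q))
    (β : ∀ q, X →ₗ[k] P q →ₗ[k] T q)
    (hβ : ∀ q x (r : R) y, β q (MulOpposite.op r • x) y = β q x (r • y))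
    (u : ∀ q, U q →ₗ[k] P q) (hu : ∀ q, Submodule.span R (Set.range (u q)) = ⊤)
    (hT : ∀ q, Function.Bijective (TensorProduct.lift ((β q).compl₂ (u q))))
    (δ : ∀ q, T (q + 1) →ₗ[k] T q) (hδ : ∀ q x y, δ q (β (q + 1) x y) = β q x (D q y)) (q : ℕ) :
    Nonempty ((LinearMap.ker (δ q) ⧸ (LinearMap.range (δ (q + 1))).comap
      (LinearMap.ker (δ q)).subtype) ≃ₗ[k] TorOver k R X Y (q + 1)) := by
  -- Afterwards `tensorOverFunctor` applied to `P q` is literally the tensor product on which `β q`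
  -- is defined.
  obtain rfl : instP = fun q => (ModuleCat.of R (P q)).moduleOfAlgebraModule :=
    funext fun q => module_eq_moduleOfAlgebraModule (P q)
  refine nonempty_torOverEquiv_of_resolution (moduleResolution D ε hP hε h₀ hD)
    (fun q => tensorOverLift (P := ModuleCat.of R (P q)) (β q) (hβ q))
    (fun q => tensorOverLift_bijective (P := ModuleCat.of R (P q)) (β q) (hβ q) (u q) (hu q)
      (hT q)) δ (fun q => ?_) q
  have hd := moduleComplex_d D (fun q => (hD q).linearMap_comp_eq_zero) q
  refine Eq.trans (congrArg (fun g => tensorOverLift (P := ModuleCat.of R (P q)) (β q) (hβ q) ∘ₗ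
    ((tensorOverFunctor k R X).map g).hom) hd) ?_
  refine Submodule.linearMap_qext _ (TensorProduct.ext' fun x y => ?_)
  exact (hδ q x y).symm

end TensorOver

/-! ### The pieces X ⊗ [M_p B_q] as tensor products. -/

namespace SplitExtension
variable {k A B : Type u} [Field k] [Ring A] [Algebra k A] [Ring B] [Algebra k B]
  (S : SplitExtension k A B)
open HochschildComplex

section Words

/-- The projection of `A^{⊗ n}` onto `[M_p B_{n-p}]`. -/
noncomputable def wordProj (p n : ℕ) : Module.End k (⨂[k] _ : Fin n, A) :=
  ∑ t : Fin n → Bool with weight t = p, PiTensorProduct.map fun i => S.comp (t i)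

/-- `[M_p B_{n-p}]`. -/
noncomputable abbrev Words (p n : ℕ) : Type u := LinearMap.range (S.wordProj p n)

variable (X : Type u) [AddCommGroup X] [Module k X] [Module A X] [Module Aᵐᵒᵖ X]
  [SMulCommClass A Aᵐᵒᵖ X] [IsScalarTower k A X] [IsScalarTower k Aᵐᵒᵖ X]

theorem gradeProj_eq_lTensor (p n : ℕ) : S.gradeProj X p n = (S.wordProj p n).lTensor X := by
  rw [gradeProj, wordProj, ← LinearMap.coe_lTensorHom, map_sum]
  rfl

/-- The inclusion `X ⊗ [M_p B_{n-p}] → X ⊗ A^{⊗ n}`. -/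
noncomputable def wordIncl (p n : ℕ) : X ⊗[k] S.Words p n →ₗ[k] Chain k A X n :=
  (LinearMap.range (S.wordProj p n)).subtype.lTensor X

/-- The projection `X ⊗ A^{⊗ n} → X ⊗ [M_p B_{n-p}]`. -/
noncomputable def wordRestrict (p n : ℕ) : Chain k A X n →ₗ[k] X ⊗[k] S.Words p n :=
  (S.wordProj p n).rangeRestrict.lTensor X

theorem wordIncl_wordRestrict (p n : ℕ) (z : Chain k A X n) :
    S.wordIncl X p n (S.wordRestrict X p n z) = S.gradeProj X p n z := by
  rw [gradeProj_eq_lTensor, wordIncl, wordRestrict, ← LinearMap.comp_apply, ← LinearMap.lTensor_comp]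
  rfl

/-- X is flat over the field k. Hence `piece` is a genuine tensor product X ⊗ [M_p B_{n-p}], on
which maps of the coefficients and scalar actions operate. -/
theorem wordIncl_injective (p n : ℕ) : Function.Injective (S.wordIncl X p n) :=
  Module.Flat.lTensor_preserves_injective_linearMap _ Subtype.val_injective

theorem wordRestrict_surjective (p n : ℕ) : Function.Surjective (S.wordRestrict X p n) :=
  LinearMap.lTensor_surjective _ (LinearMap.surjective_rangeRestrict _)

theorem range_wordIncl (p n : ℕ) : LinearMap.range (S.wordIncl X p n) = S.piece X p n := by
  refine le_antisymm ?_ ?_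
  · rintro _ ⟨z, rfl⟩
    obtain ⟨z, rfl⟩ := S.wordRestrict_surjective X p n z
    exact ⟨z, (S.wordIncl_wordRestrict X p n z).symm⟩
  · rintro _ ⟨z, rfl⟩
    exact ⟨_, S.wordIncl_wordRestrict X p n z⟩

theorem wordIncl_mem (p n : ℕ) (z) : S.wordIncl X p n z ∈ S.piece X p n :=
  S.range_wordIncl X p n ▸ ⟨z, rfl⟩

theorem exists_wordIncl_eq {p n : ℕ} {z : Chain k A X n} (hz : z ∈ S.piece X p n) :
    ∃ w, S.wordIncl X p n w = z := by
  rwa [← S.range_wordIncl] at hz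

variable {X}

theorem typeProj_of_typed {n : ℕ} {t : Fin n → Bool} {a : Fin n → A}
    (ha : ∀ i, S.comp (t i) (a i) = a i) (x : X) :
    S.typeProj X t (pureTensor k A X x a) = pureTensor k A X x a := by
  rw [typeProj_pureTensor]
  simp only [ha]

theorem gradeProj_of_typed {n p : ℕ} {t : Fin n → Bool} {a : Fin n → A}
    (ha : ∀ i, S.comp (t i) (a i) = a i) (x : X) :
    S.gradeProj X p n (pureTensor k A X x a) =
      if weight t = p then pureTensor k A X x a else 0 := by
  rw [gradeProj, LinearMap.sum_apply]
  split_ifs with h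
  · rw [Finset.sum_eq_single t]
    · exact S.typeProj_of_typed ha x
    · intro t' _ h'
      exact S.typeProj_eq_zero X t t' h' x a ha
    · intro h'
      exact absurd (Finset.mem_filter.2 ⟨Finset.mem_univ t, h⟩) h'
  · refine Finset.sum_eq_zero fun t' ht' => S.typeProj_eq_zero X t t' ?_ x a ha
    rintro rfl
    exact h (Finset.mem_filter.1 ht').2

theorem pureTensor_mem_piece {n p : ℕ} {t : Fin n → Bool} {a : Fin n → A} (ht : weight t = p)
    (ha : ∀ i, S.comp (t i) (a i) = a i) (x : X) : pureTensor k A X x a ∈ S.piece X p n :=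
  ⟨pureTensor k A X x a, by rw [S.gradeProj_of_typed ha, if_pos ht]⟩

/-- Each type projection sends pure tensors to pure tensors with letters of that type, and pure
tensors span. -/
theorem piece_le {n p : ℕ} {N : Submodule k (Chain k A X n)}
    (h : ∀ (x : X) (t : Fin n → Bool) (a : Fin n → A), weight t = p →
      (∀ i, S.comp (t i) (a i) = a i) → pureTensor k A X x a ∈ N) : S.piece X p n ≤ N := by
  rintro _ ⟨z, rfl⟩
  rw [gradeProj, LinearMap.sum_apply]
  refine Submodule.sum_mem _ fun t ht => ?_
  have : Submodule.comap (S.typeProj X t) N = ⊤ := by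
    rw [← Submodule.ker_mkQ (Submodule.comap (S.typeProj X t) N), LinearMap.ker_eq_top]
    refine chain_ext k fun x a => ?_
    rw [LinearMap.zero_apply, Submodule.mkQ_apply, Submodule.Quotient.mk_eq_zero,
      Submodule.mem_comap, typeProj_pureTensor]
    refine h x t _ (Finset.mem_filter.1 ht).2 fun i => ?_
    rw [comp_comp, if_pos rfl]
  exact (this ▸ Submodule.mem_top : z ∈ Submodule.comap (S.typeProj X t) N)

/-- Two linear maps agree on `X ⊗ [M_p B_{n-p}]` if they do so on homogeneous tensors. -/
theorem eq_on_piece {n p : ℕ} {Z : Type*} [AddCommGroup Z] [Module k Z]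
    {f g : Chain k A X n →ₗ[k] Z}
    (h : ∀ (x : X) (t : Fin n → Bool) (a : Fin n → A), weight t = p →
      (∀ i, S.comp (t i) (a i) = a i) → f (pureTensor k A X x a) = g (pureTensor k A X x a))
    {z : Chain k A X n} (hz : z ∈ S.piece X p n) : f z = g z := by
  have := S.piece_le (N := LinearMap.ker (f - g)) (fun x t a ht ha => by
    rw [LinearMap.mem_ker, LinearMap.sub_apply, h x t a ht ha, sub_self]) hz
  rwa [LinearMap.mem_ker, LinearMap.sub_apply, sub_eq_zero] at this

/-- A map that takes the component of degree `q` to the one of degree `p`, and the others to other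
ones, commutes with the projections onto these components. -/
theorem gradeProj_map {X' : Type u} [AddCommGroup X'] [Module k X'] [Module A X'] [Module Aᵐᵒᵖ X']
  [SMulCommClass A Aᵐᵒᵖ X'] [IsScalarTower k A X'] [IsScalarTower k Aᵐᵒᵖ X'] {n m p q : ℕ}
    (F : Chain k A X n →ₗ[k] Chain k A X' m)
    (h₁ : ∀ z ∈ S.piece X q n, F z ∈ S.piece X' p m)
    (h₂ : ∀ r ≠ q, ∀ z ∈ S.piece X r n, S.gradeProj X' p m (F z) = 0) (z : Chain k A X n) :
    S.gradeProj X' p m (F z) = F (S.gradeProj X q n z) := by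
  have e : S.gradeProj X' p m (F z) = ∑ r ∈ Finset.range (n + q + 1),
      S.gradeProj X' p m (F (S.gradeProj X r n z)) := by
    rw [← map_sum, ← map_sum, ← S.eq_sum_gradeProj X (Nat.le_add_right n q) z]
  rw [e, Finset.sum_eq_single q]
  · exact S.gradeProj_of_mem X' (h₁ _ (S.gradeProj_mem X q n z))
  · intro r _ hr
    exact h₂ r hr _ (S.gradeProj_mem X r n z)
  · intro h
    exact absurd (Finset.mem_range.2 (by omega)) h

end Words

/-! ### The weight-preserving component of the boundary. -/

section Vertical

variable (X : Type u) [AddCommGroup X] [Module k X] [Module A X] [Module Aᵐᵒᵖ X]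
  [SMulCommClass A Aᵐᵒᵖ X] [IsScalarTower k A X] [IsScalarTower k Aᵐᵒᵖ X]

/-- The component of `b` that preserves the number of tensorands in `M`. -/
noncomputable def vert (p n : ℕ) : Chain k A X (n + 1) →ₗ[k] Chain k A X n :=
  S.gradeProj X p n ∘ₗ boundary k A X n

theorem vert_apply (p n : ℕ) (z : Chain k A X (n + 1)) :
    S.vert X p n z = S.gradeProj X p n (boundary k A X n z) := rfl

/-- The component of `b` that preserves the number of tensorands in `M`, as a map
`X ⊗ [M_p B_{n+1-p}] → X ⊗ [M_p B_{n-p}]`. -/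
noncomputable def wordBoundary (p n : ℕ) : X ⊗[k] S.Words p (n + 1) →ₗ[k] X ⊗[k] S.Words p n :=
  S.wordRestrict X p n ∘ₗ boundary k A X n ∘ₗ S.wordIncl X p (n + 1)

theorem wordIncl_wordBoundary (p n : ℕ) (z : X ⊗[k] S.Words p (n + 1)) :
    S.wordIncl X p n (S.wordBoundary X p n z) = S.vert X p n (S.wordIncl X p (n + 1) z) :=
  S.wordIncl_wordRestrict X p n _

theorem wordBoundary_exact_iff (p n : ℕ) :
    Function.Exact (S.wordBoundary X p (n + 1)) (S.wordBoundary X p n) ↔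
      ∀ z ∈ S.piece X p (n + 1), S.vert X p n z = 0 ↔
        ∃ w ∈ S.piece X p (n + 2), S.vert X p (n + 1) w = z := by
  constructor
  · intro h z hz
    obtain ⟨z, rfl⟩ := S.exists_wordIncl_eq X hz
    rw [← wordIncl_wordBoundary, ← map_zero (S.wordIncl X p n), (S.wordIncl_injective X p n).eq_iff,
      h z]
    constructor
    · rintro ⟨w, rfl⟩
      exact ⟨_, S.wordIncl_mem X p _ w, (S.wordIncl_wordBoundary X p _ w).symm⟩
    · rintro ⟨w, hw, e⟩
      obtain ⟨w, rfl⟩ := S.exists_wordIncl_eq X hw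
      exact ⟨w, S.wordIncl_injective X p _ ((S.wordIncl_wordBoundary X p _ w).trans e)⟩
  · intro h z
    rw [← (S.wordIncl_injective X p n).eq_iff, wordIncl_wordBoundary, map_zero,
      h _ (S.wordIncl_mem X p _ z)]
    constructor
    · rintro ⟨w, hw, e⟩
      obtain ⟨w, rfl⟩ := S.exists_wordIncl_eq X hw
      exact ⟨w, S.wordIncl_injective X p _ ((S.wordIncl_wordBoundary X p _ w).trans e)⟩
    · rintro ⟨w, rfl⟩
      exact ⟨_, S.wordIncl_mem X p _ w, (S.wordIncl_wordBoundary X p _ w).symm⟩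

variable {X} {X' : Type u} [AddCommGroup X'] [Module k X'] [Module A X'] [Module Aᵐᵒᵖ X']
  [SMulCommClass A Aᵐᵒᵖ X'] [IsScalarTower k A X'] [IsScalarTower k Aᵐᵒᵖ X']

theorem typed_algFace {n : ℕ} (i : Fin (n + 2)) {t : Fin (n + 1) → Bool} {a : Fin (n + 1) → A}
    (ha : ∀ i, S.comp (t i) (a i) = a i) (l : Fin n) :
    S.comp (algFace (· || ·) i t l) (algFace (· * ·) i a l) = algFace (· * ·) i a l := by
  simp only [algFace]
  split_ifs
  · exact ha _
  · conv_rhs => rw [← ha l.castSucc, ← ha l.succ]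
    rw [← ha l.castSucc, ← ha l.succ, comp_comp, comp_comp, if_pos rfl, if_pos rfl]
    exact S.comp_mul _ _ _ _
  · exact ha _

theorem eq_incl_of_comp_false {a : A} (h : S.comp false a = a) : a = S.incl (S.retr a) := h.symm

/-- The first face absorbs the first letter into the coefficient, so a letter in M is lost. The
weight-preserving part thus never uses the action of M on X. -/
theorem weight_algFace_zero {n : ℕ} {t : Fin (n + 1) → Bool} (h : t 0 = true) :
    weight t = weight (algFace (· || ·) 0 t) + 1 := by
  have e : algFace (· || ·) 0 t = fun l => t l.succ := by
    funext l; simp [algFace]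
  rw [e]
  simp [weight, Fin.sum_univ_succ (fun l => (t l).toNat), h, add_comm]

theorem weight_algFace_last {n : ℕ} {t : Fin (n + 1) → Bool} (h : t (Fin.last n) = true) :
    weight t = weight (algFace (· || ·) (Fin.last (n + 1)) t) + 1 := by
  have e : algFace (· || ·) (Fin.last (n + 1)) t = fun l => t l.castSucc := by
    funext l
    have := l.2
    simp [algFace]
  rw [e]
  simp [weight, Fin.sum_univ_castSucc (fun l => (t l).toNat), h]

/-- On `X ⊗ [M_p B_*]`, the component of `b` that preserves `p` depends on the actions of `B` on `X`
only. -/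
theorem vert_rTensor (f : X →ₗ[k] X') (hl : ∀ b x, f (S.incl b • x) = S.incl b • f x)
    (hr : ∀ b x, f (MulOpposite.op (S.incl b) • x) = MulOpposite.op (S.incl b) • f x) (p n : ℕ)
    {z : Chain k A X (n + 1)} (hz : z ∈ S.piece X p (n + 1)) :
    S.vert X' p n (f.rTensor _ z) = f.rTensor _ (S.vert X p n z) := by
  refine S.eq_on_piece (f := S.vert X' p n ∘ₗ f.rTensor _) (g := f.rTensor _ ∘ₗ S.vert X p n) ?_ hz
  intro x t a ht ha
  rw [LinearMap.comp_apply, LinearMap.comp_apply, LinearMap.rTensor_tmul, vert_apply, vert_apply,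
    boundary_apply, boundary_apply, map_sum, map_sum, map_sum]
  refine Finset.sum_congr rfl fun i _ => ?_
  rw [map_smul, map_smul, map_smul, face_pureTensor, face_pureTensor,
    S.gradeProj_of_typed (S.typed_algFace i ha), S.gradeProj_of_typed (S.typed_algFace i ha)]
  congr 1
  -- If the face keeps the weight, a letter that it absorbs must lie in B, where `f` is equivariant;
  -- otherwise both projections are zero.
  split_ifs with h
  · refine Eq.trans (congrArg (· ⊗ₜ[k] _) ?_) (LinearMap.rTensor_tmul _ _ _ _).symm
    simp only [coeffFace]
    split_ifs with h0 h1
    · obtain rfl : i = 0 := Fin.ext h0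
      rcases h2 : t 0 with _ | _
      · have e : a 0 = S.incl (S.retr (a 0)) := S.eq_incl_of_comp_false (by rw [← h2, ha 0])
        rw [e, hr]
      · have := weight_algFace_zero h2
        omega
    · obtain rfl : i = Fin.last (n + 1) := Fin.ext h1
      rcases h2 : t (Fin.last n) with _ | _
      · have e : a (Fin.last n) = S.incl (S.retr (a (Fin.last n))) :=
          S.eq_incl_of_comp_false (by rw [← h2, ha (Fin.last n)])
        rw [e, hl]
      · have := weight_algFace_last h2
        omega
    · rfl
  · exact (map_zero _).symm

theorem wordIncl_rTensor (f : X →ₗ[k] X') (p n : ℕ) (z) :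
    S.wordIncl X' p n (f.rTensor _ z) = f.rTensor _ (S.wordIncl X p n z) := by
  rw [wordIncl, wordIncl, ← LinearMap.comp_apply, ← LinearMap.comp_apply,
    LinearMap.lTensor_comp_rTensor, LinearMap.rTensor_comp_lTensor]

/-- Only compatibility with B is required of `f`. This matters for `idealAct` and `envAct`, which
are checked to commute with B only. -/
theorem wordBoundary_rTensor (f : X →ₗ[k] X') (hl : ∀ b x, f (S.incl b • x) = S.incl b • f x)
    (hr : ∀ b x, f (MulOpposite.op (S.incl b) • x) = MulOpposite.op (S.incl b) • f x) (p n : ℕ) (z) :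
    S.wordBoundary X' p n (f.rTensor _ z) = f.rTensor _ (S.wordBoundary X p n z) := by
  refine S.wordIncl_injective X' p n ?_
  rw [wordIncl_wordBoundary, wordIncl_rTensor, wordIncl_rTensor, wordIncl_wordBoundary,
    S.vert_rTensor f hl hr p n (S.wordIncl_mem X p _ z)]

end Vertical
end SplitExtension

/-! ### The coefficient bimodules B ⊗ B and M ⊗ B. -/

namespace SplitExtension
variable {k A B : Type u} [Field k] [Ring A] [Algebra k A] [Ring B] [Algebra k B]
  (S : SplitExtension k A B)
open HochschildComplex

instance : SMul Aᵐᵒᵖ S.ideal := ⟨fun a m => ⟨m * a.unop, by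
  rw [mem_ideal, map_mul, S.mem_ideal.1 m.2, zero_mul]⟩⟩

theorem coe_op_smul_ideal (a : Aᵐᵒᵖ) (m : S.ideal) : ((a • m : S.ideal) : A) = m * a.unop := rfl

/-- `M` as a right `A`-module. -/
instance : Module Aᵐᵒᵖ S.ideal where
  one_smul m := Subtype.ext (by simp [coe_op_smul_ideal])
  mul_smul b c m := Subtype.ext (by simp [coe_op_smul_ideal, mul_assoc])
  smul_zero b := Subtype.ext (by simp [coe_op_smul_ideal])
  smul_add b m n := Subtype.ext (by simp [coe_op_smul_ideal, add_mul])
  add_smul b c m := Subtype.ext (by simp [coe_op_smul_ideal, mul_add])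
  zero_smul m := Subtype.ext (by simp [coe_op_smul_ideal])

instance : IsScalarTower k Aᵐᵒᵖ S.ideal :=
  ⟨fun c b m => Subtype.ext (by simp [coe_op_smul_ideal])⟩

/-- `B` as a right `A`-module along the retraction. -/
def Base (_ : SplitExtension k A B) : Type u := B

instance : Ring S.Base := inferInstanceAs (Ring B)
instance : Algebra k S.Base := inferInstanceAs (Algebra k B)
instance : Module B S.Base := inferInstanceAs (Module B B)
instance : IsScalarTower k B S.Base := inferInstanceAs (IsScalarTower k B B)
noncomputable instance : Module Aᵐᵒᵖ S.Base := Module.compHom B (RingHom.op (S.retr : A →+* B))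

/-- The identity map `B → B`. -/
def toBase : B ≃ₗ[B] S.Base := LinearEquiv.refl B B

theorem op_smul_toBase (a : A) (b : B) :
    MulOpposite.op a • S.toBase b = S.toBase (b * S.retr a) := rfl

instance : IsScalarTower k Aᵐᵒᵖ S.Base := ⟨fun c a b => by
  change (show B from b) * S.retr (c • a.unop) = c • ((show B from b) * S.retr a.unop)
  rw [map_smul, mul_smul_comm]⟩

section Ind

variable (Y : Type u) [AddCommGroup Y] [Module k Y]

/-- The `A`-bimodule `Y ⊗ B`, where `A` acts on the right of `Y` and, along the retraction, on the
left of `B`. -/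
def Ind (_ : SplitExtension k A B) (Y : Type u) [AddCommGroup Y] [Module k Y] : Type u :=
  Y ⊗[k] Bᵐᵒᵖ

noncomputable instance : AddCommGroup (S.Ind Y) := inferInstanceAs (AddCommGroup (Y ⊗[k] Bᵐᵒᵖ))
noncomputable instance : Module k (S.Ind Y) := inferInstanceAs (Module k (Y ⊗[k] Bᵐᵒᵖ))

variable {Y} in
/-- The element `y ⊗ b` of `Y ⊗ B`. -/
noncomputable def indMk : Y →ₗ[k] Bᵐᵒᵖ →ₗ[k] S.Ind Y := TensorProduct.mk k Y Bᵐᵒᵖ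

variable {Y} in
theorem ind_induction {p : S.Ind Y → Prop} (zero : p 0) (mk : ∀ y c, p (S.indMk y c))
    (add : ∀ x x', p x → p x' → p (x + x')) (x : S.Ind Y) : p x :=
  TensorProduct.induction_on x zero mk add

variable {Y} in
theorem ind_ext {Z : Type*} [AddCommGroup Z] [Module k Z] {f g : S.Ind Y →ₗ[k] Z}
    (h : ∀ y c, f (S.indMk y c) = g (S.indMk y c)) : f = g :=
  TensorProduct.ext' h

/-- The left action of `A` on `Y ⊗ B`. -/
noncomputable def indLeft : A →ₐ[k] Module.End k (Y ⊗[k] Bᵐᵒᵖ) where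
  toFun a := (LinearMap.mulRight k (MulOpposite.op (S.retr a))).lTensor Y
  map_one' := TensorProduct.ext' fun y c => by simp
  map_mul' a a' := TensorProduct.ext' fun y c => by simp [mul_assoc]
  map_zero' := TensorProduct.ext' fun y c => by simp
  map_add' a a' := TensorProduct.ext' fun y c => by simp [mul_add, TensorProduct.tmul_add]
  commutes' c := TensorProduct.ext' fun y d => by simp [Algebra.algebraMap_eq_smul_one]

noncomputable instance : Module A (S.Ind Y) :=
  Module.compHom (Y ⊗[k] Bᵐᵒᵖ) (S.indLeft Y : A →+* Module.End k (Y ⊗[k] Bᵐᵒᵖ))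

variable {Y} in
theorem smul_indMk (a : A) (y : Y) (c : Bᵐᵒᵖ) :
    a • S.indMk y c = S.indMk y (c * MulOpposite.op (S.retr a)) := rfl

instance : IsScalarTower k A (S.Ind Y) := ⟨fun c a x =>
  LinearMap.congr_fun (map_smul (S.indLeft Y) c a) x⟩

section Right

variable [Module Aᵐᵒᵖ Y] [IsScalarTower k Aᵐᵒᵖ Y]

noncomputable instance : Module Aᵐᵒᵖ (S.Ind Y) := inferInstanceAs (Module Aᵐᵒᵖ (Y ⊗[k] Bᵐᵒᵖ))

variable {Y} in
theorem op_smul_indMk (a : Aᵐᵒᵖ) (y : Y) (c : Bᵐᵒᵖ) :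
    a • S.indMk y c = S.indMk (a • y) c := rfl

instance : IsScalarTower k Aᵐᵒᵖ (S.Ind Y) :=
  inferInstanceAs (IsScalarTower k Aᵐᵒᵖ (Y ⊗[k] Bᵐᵒᵖ))

instance : SMulCommClass A Aᵐᵒᵖ (S.Ind Y) := ⟨fun a a' x => by
  induction x using S.ind_induction with
  | zero => simp only [smul_zero]
  | mk y c => simp only [smul_indMk, op_smul_indMk]
  | add x x' h h' => simp only [smul_add, h, h']⟩

end Right

noncomputable instance : Module (Env k B) (S.Ind S.Base) :=
  inferInstanceAs (Module (Env k B) (Env k B))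

instance : IsScalarTower k (Env k B) (S.Ind S.Base) :=
  inferInstanceAs (IsScalarTower k (Env k B) (Env k B))

theorem env_smul_indMk (b : B) (c : Bᵐᵒᵖ) (b' : B) (c' : Bᵐᵒᵖ) :
    (b ⊗ₜ[k] c : Env k B) • S.indMk (S.toBase b') c' = S.indMk (S.toBase (b * b')) (c * c') :=
  Algebra.TensorProduct.tmul_mul_tmul b b' c c'

noncomputable instance : Module B (S.Ind S.Base) :=
  inferInstanceAs (Module B (B ⊗[k] Bᵐᵒᵖ))

instance : IsScalarTower k B (S.Ind S.Base) :=
  inferInstanceAs (IsScalarTower k B (B ⊗[k] Bᵐᵒᵖ))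

theorem base_smul_indMk (b b' : B) (c : Bᵐᵒᵖ) :
    b • S.indMk (S.toBase b') c = S.indMk (S.toBase (b * b')) c := rfl

end Ind

/-! ### Moving the first letter into and out of the coefficient. -/

section Cons

/-- The map `a ⊗ (a₁ ⊗ ⋯ ⊗ aₙ) ↦ a ⊗ a₁ ⊗ ⋯ ⊗ aₙ`. -/
noncomputable def consLin (k A : Type u) [Field k] [Ring A] [Algebra k A] (n : ℕ) :
    A →ₗ[k] (⨂[k] _ : Fin n, A) →ₗ[k] ⨂[k] _ : Fin (n + 1), A :=
  (PiTensorProduct.lift (R := k)).toLinearMap ∘ₗ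
    (PiTensorProduct.tprod k (s := fun _ : Fin (n + 1) => A)).curryLeft

theorem consLin_tprod {n : ℕ} (a : A) (w : Fin n → A) :
    consLin k A n a (PiTensorProduct.tprod k w) = PiTensorProduct.tprod k (Fin.cons a w) := by
  simp [consLin]

/-- The map `a₀ ⊗ a₁ ⊗ ⋯ ⊗ aₙ ↦ a₀ ⊗ (a₁ ⊗ ⋯ ⊗ aₙ)`. -/
noncomputable def unconsLin (k A : Type u) [Field k] [Ring A] [Algebra k A] (n : ℕ) :
    (⨂[k] _ : Fin (n + 1), A) →ₗ[k] A ⊗[k] (⨂[k] _ : Fin n, A) :=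
  PiTensorProduct.lift (LinearMap.uncurryLeft (M := fun _ : Fin (n + 1) => A)
    { toFun := fun a => (TensorProduct.mk k A _ a).compMultilinearMap (PiTensorProduct.tprod k)
      map_add' := fun a b => by ext w; simp
      map_smul' := fun c a => by ext w; simp [TensorProduct.smul_tmul'] })

theorem unconsLin_tprod {n : ℕ} (a : Fin (n + 1) → A) :
    unconsLin k A n (PiTensorProduct.tprod k a) =
      a 0 ⊗ₜ PiTensorProduct.tprod k fun i : Fin n => a i.succ := by
  simp [unconsLin, Fin.tail_def]

variable {Y : Type u} [AddCommGroup Y] [Module k Y]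

/-- The map `(y ⊗ c) ⊗ w ↦ (1 ⊗ c) ⊗ φ(y) ⊗ w`. -/
noncomputable def consMap (φ : Y →ₗ[k] A) (n : ℕ) :
    Chain k A (S.Ind Y) n →ₗ[k] Chain k A (S.Ind S.Base) (n + 1) :=
  TensorProduct.lift (TensorProduct.lift (LinearMap.mk₂ k
    (fun y c => TensorProduct.mk k (S.Ind S.Base) _ (S.indMk (S.toBase 1) c) ∘ₗ consLin k A n (φ y))
    (fun y y' c => by rw [map_add, map_add, LinearMap.comp_add])
    (fun r y c => by rw [map_smul, map_smul, LinearMap.comp_smul])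
    (fun y c c' => by rw [map_add, map_add, LinearMap.add_comp])
    (fun r y c => by rw [map_smul, map_smul, LinearMap.smul_comp])) :
      S.Ind Y →ₗ[k] _)

theorem consMap_pureTensor (φ : Y →ₗ[k] A) {n : ℕ} (y : Y) (c : Bᵐᵒᵖ) (a : Fin n → A) :
    S.consMap φ n (pureTensor k A _ (S.indMk y c) a) =
      pureTensor k A _ (S.indMk (S.toBase 1) c) (Fin.cons (φ y) a) :=
  congrArg (S.indMk (S.toBase 1) c ⊗ₜ[k] ·) (consLin_tprod (φ y) a)

/-- The map `(b ⊗ c) ⊗ a₀ ⊗ w ↦ (b (a₀)_M ⊗ c) ⊗ w`. -/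
noncomputable def unconsMap (n : ℕ) :
    Chain k A (S.Ind S.Base) (n + 1) →ₗ[k] Chain k A (S.Ind S.ideal) n :=
  TensorProduct.lift (TensorProduct.lift (LinearMap.mk₂ k
    (fun (b : S.Base) (c : Bᵐᵒᵖ) => LinearMap.rTensor _
      ((S.indMk (Y := S.ideal)).flip c ∘ₗ
        Module.toModuleEnd k (S := B) S.ideal (S.toBase.symm b) ∘ₗ S.projM) ∘ₗ unconsLin k A n)
    (fun b b' c => by
      rw [map_add, map_add, LinearMap.add_comp, LinearMap.comp_add, LinearMap.rTensor_add,
        LinearMap.add_comp])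
    (fun r b c => by
      have e : Module.toModuleEnd k (S := B) S.ideal (S.toBase.symm (r • b)) =
          r • Module.toModuleEnd k (S := B) S.ideal (S.toBase.symm b) :=
        LinearMap.ext fun m => smul_assoc r (S.toBase.symm b) m
      rw [e, LinearMap.smul_comp, LinearMap.comp_smul, LinearMap.rTensor_smul,
        LinearMap.smul_comp])
    (fun b c c' => by rw [map_add, LinearMap.add_comp, LinearMap.rTensor_add, LinearMap.add_comp])
    (fun r b c => by
      rw [map_smul, LinearMap.smul_comp, LinearMap.rTensor_smul, LinearMap.smul_comp])) :
      S.Ind S.Base →ₗ[k] _)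

theorem unconsMap_pureTensor {n : ℕ} (b : B) (c : Bᵐᵒᵖ) (a : Fin (n + 1) → A) :
    S.unconsMap n (pureTensor k A _ (S.indMk (S.toBase b) c) a) =
      pureTensor k A _ (S.indMk (b • S.projM (a 0)) c) fun i : Fin n => a i.succ :=
  (congrArg (LinearMap.rTensor _ ((S.indMk (Y := S.ideal)).flip c ∘ₗ
    Module.toModuleEnd k (S := B) S.ideal b ∘ₗ S.projM)) (unconsLin_tprod a)).trans rfl

theorem ind_chain_ext {n : ℕ} {Z : Type*} [AddCommGroup Z] [Module k Z]
    {f g : Chain k A (S.Ind Y) n →ₗ[k] Z}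
    (h : ∀ y c a, f (pureTensor k A _ (S.indMk y c) a) = g (pureTensor k A _ (S.indMk y c) a)) :
    f = g := by
  refine TensorProduct.ext (S.ind_ext fun y c => ?_)
  exact PiTensorProduct.ext (MultilinearMap.ext fun a => h y c a)

end Cons
end SplitExtension

/-! ### Faces of a word with a prepended letter. -/

namespace HochschildComplex

theorem algFace_zero_cons {α : Type*} (op : α → α → α) {n : ℕ} (a : α) (w : Fin n → α) :
    algFace op 0 (Fin.cons a w : Fin (n + 1) → α) = w := by
  funext j
  simp [algFace]

theorem algFace_one_cons {α : Type*} (op : α → α → α) {n : ℕ} (a : α) (w : Fin (n + 1) → α) :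
    algFace op 1 (Fin.cons a w : Fin (n + 2) → α) = Fin.cons (op a (w 0)) fun i : Fin n => w i.succ := by
  funext j
  cases j using Fin.cases with
  | zero => simp [algFace]
  | succ j => simp [algFace]

theorem algFace_succ_cons {α : Type*} (op : α → α → α) {n : ℕ} (i : Fin (n + 1)) (a : α)
    (w : Fin (n + 1) → α) :
    algFace op i.succ.succ (Fin.cons a w : Fin (n + 2) → α) = Fin.cons a (algFace op i.succ w) := by
  funext j
  cases j using Fin.cases with
  | zero => simp [algFace]
  | succ j => simp [algFace]

theorem algFace_zero {α : Type*} (op : α → α → α) {n : ℕ} (w : Fin (n + 1) → α) :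
    algFace op 0 w = fun i : Fin n => w i.succ := by
  funext j
  simp [algFace]

theorem algFace_succ_succ_succ {α : Type*} (op : α → α → α) {n : ℕ} (i : Fin (n + 1))
    (a : Fin (n + 2) → α) (l : Fin n) : algFace op i.succ.succ a l.succ =
      algFace op i.succ (fun j : Fin (n + 1) => a j.succ) l := by
  simp [algFace]

section
variable {R X : Type u} [Ring R] [AddCommGroup X] [Module R X] [Module Rᵐᵒᵖ X]

theorem coeffFace_zero {n : ℕ} (x : X) (a : Fin (n + 1) → R) :
    coeffFace 0 x a = MulOpposite.op (a 0) • x := by simp [coeffFace]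

theorem coeffFace_one {n : ℕ} (x : X) (a : Fin (n + 2) → R) : coeffFace 1 x a = x := by
  simp [coeffFace]

theorem coeffFace_succ {n : ℕ} (i : Fin (n + 1)) (x : X) (a : Fin (n + 1) → R) :
    coeffFace i.succ x a = if (i : ℕ) = n then a (Fin.last n) • x else x := by
  simp [coeffFace]

end
end HochschildComplex

/-! ### The homotopy formulas for the full boundary. -/

namespace SplitExtension
variable {k A B : Type u} [Field k] [Ring A] [Algebra k A] [Ring B] [Algebra k B]
  (S : SplitExtension k A B)
open HochschildComplex

section Homotopy

variable {Y : Type u} [AddCommGroup Y] [Module k Y] [Module Aᵐᵒᵖ Y] [IsScalarTower k Aᵐᵒᵖ Y]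

/-- Prepending a letter shifts the faces by one, so all faces that do not meet it cancel in pairs.
What remains is the face absorbing φ(y) into the coefficient, and the failure of φ to be right
A-linear. -/
theorem boundary_consMap (φ : Y →ₗ[k] A) {n : ℕ} (y : Y) (c : Bᵐᵒᵖ) (w : Fin (n + 1) → A) :
    boundary k A _ (n + 1) (S.consMap φ (n + 1) (pureTensor k A _ (S.indMk y c) w)) +
        S.consMap φ n (boundary k A _ n (pureTensor k A _ (S.indMk y c) w)) =
      pureTensor k A _ (S.indMk (S.toBase (S.retr (φ y))) c) w -
        pureTensor k A _ (S.indMk (S.toBase 1) c)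
          (Fin.cons (φ y * w 0 - φ (MulOpposite.op (w 0) • y)) fun i : Fin n => w i.succ) := by
  rw [boundary_apply, boundary_apply, map_sum, Fin.sum_univ_succ, Fin.sum_univ_succ,
    Fin.sum_univ_succ (n := n + 1)]
  have e : ∀ i : Fin (n + 1), face k i.succ.succ
      (S.consMap φ (n + 1) (pureTensor k A _ (S.indMk y c) w)) =
      S.consMap φ n (face k i.succ (pureTensor k A _ (S.indMk y c) w)) := by
    intro i
    rw [face_pureTensor, consMap_pureTensor, face_pureTensor, algFace_succ_cons, coeffFace_succ,
      coeffFace_succ]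
    split_ifs with h1 h2 h2
    · rw [smul_indMk, smul_indMk, consMap_pureTensor]
      rfl
    · simp at h1; omega
    · simp at h1; omega
    · rw [consMap_pureTensor]
  have e0 : face k 0 (S.consMap φ (n + 1) (pureTensor k A _ (S.indMk y c) w)) =
      pureTensor k A _ (S.indMk (S.toBase (S.retr (φ y))) c) w := by
    rw [consMap_pureTensor, face_pureTensor, algFace_zero_cons, coeffFace_zero, op_smul_indMk,
      Fin.cons_zero, op_smul_toBase, one_mul]
  have e1 : face k (Fin.succ 0) (S.consMap φ (n + 1) (pureTensor k A _ (S.indMk y c) w)) =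
      pureTensor k A _ (S.indMk (S.toBase 1) c)
          (Fin.cons (φ y * w 0) fun i : Fin n => w i.succ) := by
    rw [consMap_pureTensor, face_pureTensor, Fin.succ_zero_eq_one, algFace_one_cons, coeffFace_one]
  have e2 : S.consMap φ n (face k 0 (pureTensor k A _ (S.indMk y c) w)) =
      pureTensor k A _ (S.indMk (S.toBase 1) c)
          (Fin.cons (φ (MulOpposite.op (w 0) • y)) fun i : Fin n => w i.succ) := by
    rw [face_pureTensor, algFace_zero, coeffFace_zero, op_smul_indMk, consMap_pureTensor]
  have e3 : pureTensor k A _ (S.indMk (S.toBase 1) c)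
          (Fin.cons (φ y * w 0 - φ (MulOpposite.op (w 0) • y)) fun i : Fin n => w i.succ) =
      pureTensor k A _ (S.indMk (S.toBase 1) c)
          (Fin.cons (φ y * w 0) fun i : Fin n => w i.succ) -
      pureTensor k A _ (S.indMk (S.toBase 1) c)
          (Fin.cons (φ (MulOpposite.op (w 0) • y)) fun i : Fin n => w i.succ) := by
    simp only [pureTensor, ← consLin_tprod, map_sub, LinearMap.sub_apply, TensorProduct.tmul_sub]
  have e4 : ∑ i : Fin (n + 1), (-1 : k) ^ ((i.succ.succ : Fin (n + 3)) : ℕ) • face k i.succ.succ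
      (S.consMap φ (n + 1) (pureTensor k A _ (S.indMk y c) w)) =
      - ∑ i : Fin (n + 1), S.consMap φ n
        ((-1 : k) ^ ((i.succ : Fin (n + 2)) : ℕ) • face k i.succ (pureTensor k A _ (S.indMk y c) w)) := by
    rw [← Finset.sum_neg_distrib]
    refine Finset.sum_congr rfl fun i _ => ?_
    rw [e, map_smul, Fin.val_succ, Fin.val_succ, pow_succ, mul_neg_one, neg_smul]
  rw [e4, e3, ← e0, ← e1, ← e2]
  simp only [Fin.val_zero, pow_zero, one_smul, Fin.val_succ, zero_add, pow_one, neg_smul, map_smul]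
  abel

/-- The map `(b ⊗ c) ⊗ w ↦ (1 ⊗ c) ⊗ b ⊗ w`. -/
noncomputable abbrev consBase (n : ℕ) :
    Chain k A (S.Ind S.Base) n →ₗ[k] Chain k A (S.Ind S.Base) (n + 1) :=
  S.consMap (S.incl.toLinearMap ∘ₗ (S.toBase.symm.toLinearMap.restrictScalars k)) n

/-- The map `(m ⊗ c) ⊗ w ↦ (1 ⊗ c) ⊗ m ⊗ w`. -/
noncomputable abbrev consIdeal (n : ℕ) :
    Chain k A (S.Ind S.ideal) n →ₗ[k] Chain k A (S.Ind S.Base) (n + 1) :=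
  S.consMap S.ideal.subtype n

/-- Both error terms of `boundary_consMap` vanish: the retraction kills M, and the inclusion of M is
right A-linear. This is why M carries its full right A-action here rather than the one through the
retraction. -/
theorem boundary_consIdeal {n : ℕ} (z : Chain k A (S.Ind S.ideal) (n + 1)) :
    boundary k A _ (n + 1) (S.consIdeal (n + 1) z) = - S.consIdeal n (boundary k A _ n z) := by
  rw [eq_neg_iff_add_eq_zero]
  refine LinearMap.congr_fun (f := boundary k A _ (n + 1) ∘ₗ S.consIdeal (n + 1) +
    S.consIdeal n ∘ₗ boundary k A _ n) (g := 0) (S.ind_chain_ext fun y c w => ?_) z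
  refine (S.boundary_consMap S.ideal.subtype y c w).trans ?_
  have e1 : S.retr (S.ideal.subtype y) = 0 := y.2
  have e2 : S.ideal.subtype y * w 0 - S.ideal.subtype (MulOpposite.op (w 0) • y) = 0 := by
    simp [coe_op_smul_ideal]
  rw [e1, e2, map_zero, map_zero]
  simp [pureTensor, ← consLin_tprod]

/-- A acts on the base through the retraction, so the inclusion of B fails to be right A-linear by b
a₀ - b r(a₀) = b (a₀)_M, where r is the retraction. This is the term that `unconsMap` extracts. -/
theorem boundary_consBase {n : ℕ} (z : Chain k A (S.Ind S.Base) (n + 1)) :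
    boundary k A _ (n + 1) (S.consBase (n + 1) z) + S.consBase n (boundary k A _ n z) =
      z - S.consIdeal n (S.unconsMap n z) := by
  refine LinearMap.congr_fun (f := boundary k A _ (n + 1) ∘ₗ S.consBase (n + 1) +
    S.consBase n ∘ₗ boundary k A _ n) (g := LinearMap.id - S.consIdeal n ∘ₗ S.unconsMap n)
    (S.ind_chain_ext fun y c w => ?_) z
  obtain ⟨b, rfl⟩ := S.toBase.surjective y
  refine (S.boundary_consMap _ (S.toBase b) c w).trans ?_
  rw [LinearMap.sub_apply, LinearMap.comp_apply (S.consIdeal n), unconsMap_pureTensor, consIdeal,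
    consMap_pureTensor]
  congr 1
  · exact congrArg (fun b => pureTensor k A _ (S.indMk (S.toBase b) c) w) (S.retr_incl b)
  · congr 2
    change S.incl b * w 0 - S.incl (b * S.retr (w 0)) = S.incl b * (w 0 - S.incl (S.retr (w 0)))
    rw [mul_sub, map_mul]

theorem boundary_consBase_zero (b : B) (c : Bᵐᵒᵖ) (w : Fin 0 → A) :
    boundary k A _ 0 (S.consBase 0 (pureTensor k A _ (S.indMk (S.toBase b) c) w)) =
      pureTensor k A _ (S.indMk (S.toBase b) c) w -
        pureTensor k A _ (S.indMk (S.toBase 1) (c * MulOpposite.op b)) w := by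
  rw [boundary_apply, consBase, consMap_pureTensor, Fin.sum_univ_two, face_pureTensor,
    face_pureTensor, Subsingleton.elim (algFace _ _ _) w, Subsingleton.elim (algFace _ _ _) w,
    coeffFace_zero, ← Fin.succ_zero_eq_one, coeffFace_succ, if_pos (show ((0 : Fin 1) : ℕ) = 0 from rfl), op_smul_indMk, smul_indMk,
    show ((-1 : k) ^ ((0 : Fin 2) : ℕ)) = 1 from pow_zero _,
    show ((-1 : k) ^ ((Fin.succ 0 : Fin 2) : ℕ)) = -1 from pow_one _, one_smul, neg_one_smul,
    ← sub_eq_add_neg]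
  congr 1
  · have : MulOpposite.op (S.incl b) • S.toBase 1 = S.toBase b := by
      rw [op_smul_toBase, S.retr_incl, one_mul]
    exact congrArg (fun y => pureTensor k A _ (S.indMk y c) w) this
  · exact congrArg (fun b => pureTensor k A _ (S.indMk (S.toBase 1) (c * MulOpposite.op b)) w)
      (S.retr_incl b)

/-- The identity b (a₀a₁)_M = b r(a₀) (a₁)_M + b (a₀)_M a₁ combines the first two faces of `z` into
the first face of `unconsMap`. The other faces correspond with their index shifted by one, whence
the sign. -/
theorem boundary_unconsMap {n : ℕ} (z : Chain k A (S.Ind S.Base) (n + 2)) :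
    boundary k A _ n (S.unconsMap (n + 1) z) = - S.unconsMap n (boundary k A _ (n + 1) z) := by
  refine LinearMap.congr_fun (f := boundary k A _ n ∘ₗ S.unconsMap (n + 1))
    (g := -(S.unconsMap n ∘ₗ boundary k A _ (n + 1))) (S.ind_chain_ext fun y c a => ?_) z
  obtain ⟨b, rfl⟩ := S.toBase.surjective y
  rw [LinearMap.neg_apply, LinearMap.comp_apply, LinearMap.comp_apply, boundary_apply,
    boundary_apply, map_sum, Fin.sum_univ_succ, Fin.sum_univ_succ (n := n + 2),
    Fin.sum_univ_succ (n := n + 1)]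
  have e : ∀ i : Fin (n + 1), S.unconsMap n (face k i.succ.succ
      (pureTensor k A _ (S.indMk (S.toBase b) c) a)) =
      face k i.succ (S.unconsMap (n + 1) (pureTensor k A _ (S.indMk (S.toBase b) c) a)) := by
    intro i
    have e' : algFace (· * ·) i.succ.succ a 0 = a 0 := by simp [algFace]
    have e'' : (fun l : Fin n => algFace (· * ·) i.succ.succ a l.succ) =
        algFace (· * ·) i.succ (fun j : Fin (n + 1) => a j.succ) :=
      funext fun l => algFace_succ_succ_succ _ i a l
    rw [face_pureTensor, unconsMap_pureTensor, face_pureTensor, coeffFace_succ, coeffFace_succ]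
    split_ifs with h1 h2 h2
    · rw [smul_indMk, smul_indMk, unconsMap_pureTensor, e', e'']
      rfl
    · simp at h1; omega
    · simp at h1; omega
    · rw [unconsMap_pureTensor, e', e'']
  have e0 : S.unconsMap n (face k 0 (pureTensor k A _ (S.indMk (S.toBase b) c) a)) =
      pureTensor k A _ (S.indMk ((b * S.retr (a 0)) • S.projM (a 1)) c)
        fun l : Fin n => a l.succ.succ := by
    rw [face_pureTensor, algFace_zero, coeffFace_zero, op_smul_indMk, op_smul_toBase,
      unconsMap_pureTensor]
    rfl
  have e1 : S.unconsMap n (face k (Fin.succ 0) (pureTensor k A _ (S.indMk (S.toBase b) c) a)) =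
      pureTensor k A _ (S.indMk (b • S.projM (a 0 * a 1)) c)
        fun l : Fin n => a l.succ.succ := by
    rw [face_pureTensor, Fin.succ_zero_eq_one, coeffFace_one, unconsMap_pureTensor]
    have : algFace (· * ·) 1 a 0 = a 0 * a 1 := by simp [algFace]
    rw [this]
    rfl
  have e2 : face k 0 (S.unconsMap (n + 1) (pureTensor k A _ (S.indMk (S.toBase b) c) a)) =
      pureTensor k A _ (S.indMk (MulOpposite.op (a 1) • b • S.projM (a 0)) c)
        fun l : Fin n => a l.succ.succ := by
    rw [unconsMap_pureTensor, face_pureTensor, algFace_zero, coeffFace_zero, op_smul_indMk]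
    rfl
  have e3 : b • S.projM (a 0 * a 1) = (b * S.retr (a 0)) • S.projM (a 1) +
      MulOpposite.op (a 1) • b • S.projM (a 0) := by
    refine Subtype.ext ?_
    simp only [coe_smul, coe_projM, map_mul, Submodule.coe_add, coe_op_smul_ideal,
      MulOpposite.unop_op]
    noncomm_ring
  have e4 : ∑ i : Fin (n + 1), S.unconsMap n ((-1 : k) ^ ((i.succ.succ : Fin (n + 3)) : ℕ) •
      face k i.succ.succ (pureTensor k A _ (S.indMk (S.toBase b) c) a)) =
      - ∑ i : Fin (n + 1), (-1 : k) ^ ((i.succ : Fin (n + 2)) : ℕ) •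
        face k i.succ (S.unconsMap (n + 1) (pureTensor k A _ (S.indMk (S.toBase b) c) a)) := by
    rw [← Finset.sum_neg_distrib]
    refine Finset.sum_congr rfl fun i _ => ?_
    rw [map_smul, e, Fin.val_succ, Fin.val_succ, pow_succ, mul_neg_one, neg_smul]
  have e5 : pureTensor k A _ (S.indMk (b • S.projM (a 0 * a 1)) c)
        (fun l : Fin n => a l.succ.succ) =
      pureTensor k A _ (S.indMk ((b * S.retr (a 0)) • S.projM (a 1)) c)
        (fun l : Fin n => a l.succ.succ) +
      pureTensor k A _ (S.indMk (MulOpposite.op (a 1) • b • S.projM (a 0)) c)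
        (fun l : Fin n => a l.succ.succ) := by
    rw [e3, map_add, LinearMap.add_apply, pureTensor, TensorProduct.add_tmul]
  rw [e4, map_smul, map_smul, e0, e1, e2, e5]
  simp only [Fin.val_zero, pow_zero, one_smul, Fin.val_succ, zero_add, pow_one, neg_smul]
  abel

end Homotopy
end SplitExtension

/-! ### The homotopy on each weight, and exactness. -/

namespace SplitExtension
variable {k A B : Type u} [Field k] [Ring A] [Algebra k A] [Ring B] [Algebra k B]
  (S : SplitExtension k A B)
open HochschildComplex

section GradedHomotopy

theorem weight_cons {n : ℕ} (τ : Bool) (t : Fin n → Bool) :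
    weight (Fin.cons τ t : Fin (n + 1) → Bool) = τ.toNat + weight t := by
  simp [weight, Fin.sum_univ_succ]

section Generic

variable {Y : Type u} [AddCommGroup Y] [Module k Y] [Module Aᵐᵒᵖ Y] [IsScalarTower k Aᵐᵒᵖ Y]

theorem ind_piece_le {n p : ℕ} {N : Submodule k (Chain k A (S.Ind Y) n)}
    (h : ∀ (y : Y) (c : Bᵐᵒᵖ) (t : Fin n → Bool) (a : Fin n → A), weight t = p →
      (∀ i, S.comp (t i) (a i) = a i) → pureTensor k A _ (S.indMk y c) a ∈ N) :
    S.piece (S.Ind Y) p n ≤ N := by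
  refine S.piece_le fun x t a ht ha => ?_
  induction x using S.ind_induction with
  | zero => rw [pureTensor, TensorProduct.zero_tmul]; exact zero_mem _
  | mk y c => exact h y c t a ht ha
  | add x x' h h' => rw [pureTensor, TensorProduct.add_tmul]; exact add_mem h h'

theorem consMap_mem {φ : Y →ₗ[k] A} {τ : Bool} (hφ : ∀ y, S.comp τ (φ y) = φ y) {p n : ℕ}
    {z : Chain k A (S.Ind Y) n} (hz : z ∈ S.piece _ p n) :
    S.consMap φ n z ∈ S.piece _ (p + τ.toNat) (n + 1) := by
  refine S.ind_piece_le (N := (S.piece (S.Ind S.Base) (p + τ.toNat) (n + 1)).comap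
    (S.consMap φ n)) (fun y c t a ht ha => ?_) hz
  rw [Submodule.mem_comap, consMap_pureTensor]
  refine S.pureTensor_mem_piece (t := Fin.cons τ t) (by rw [weight_cons, ht, add_comm]) ?_ _
  intro i
  cases i using Fin.cases with
  | zero => exact hφ y
  | succ i => exact ha i

theorem gradeProj_consMap {φ : Y →ₗ[k] A} {τ : Bool} (hφ : ∀ y, S.comp τ (φ y) = φ y) (p n : ℕ)
    (z : Chain k A (S.Ind Y) n) :
    S.gradeProj _ (p + τ.toNat) (n + 1) (S.consMap φ n z) = S.consMap φ n (S.gradeProj _ p n z) :=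
  S.gradeProj_map _ (fun _ hz => S.consMap_mem hφ hz)
    (fun _ hr _ hz => S.gradeProj_of_mem_of_ne _ (by omega) (S.consMap_mem hφ hz)) z

end Generic

theorem consBase_mem {p n : ℕ} {z : Chain k A (S.Ind S.Base) n} (hz : z ∈ S.piece _ p n) :
    S.consBase n z ∈ S.piece _ p (n + 1) :=
  S.consMap_mem (τ := false) (fun y => by simp [comp, S.retr_incl]) hz

theorem gradeProj_consBase (p n : ℕ) (z : Chain k A (S.Ind S.Base) n) :
    S.gradeProj _ p (n + 1) (S.consBase n z) = S.consBase n (S.gradeProj _ p n z) :=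
  S.gradeProj_consMap (τ := false) (fun y => by simp [comp, S.retr_incl]) p n z

theorem consIdeal_mem {p n : ℕ} {z : Chain k A (S.Ind S.ideal) n} (hz : z ∈ S.piece _ p n) :
    S.consIdeal n z ∈ S.piece _ (p + 1) (n + 1) :=
  S.consMap_mem (φ := S.ideal.subtype) (τ := true) (fun y => congrArg Subtype.val (S.projM_coe y)) hz

theorem gradeProj_consIdeal (p n : ℕ) (z : Chain k A (S.Ind S.ideal) n) :
    S.gradeProj _ (p + 1) (n + 1) (S.consIdeal n z) = S.consIdeal n (S.gradeProj _ p n z) :=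
  S.gradeProj_consMap (φ := S.ideal.subtype) (τ := true) (fun y => congrArg Subtype.val (S.projM_coe y)) p n z

/-- The first letter of a word of weight 0 lies in B and has no M-component. So the homotopy is a
true contraction in weight 0. -/
theorem unconsMap_eq_zero {n : ℕ} {z : Chain k A (S.Ind S.Base) (n + 1)}
    (hz : z ∈ S.piece _ 0 (n + 1)) : S.unconsMap n z = 0 := by
  refine S.ind_piece_le (N := LinearMap.ker (S.unconsMap n)) (fun y c t a ht ha => ?_) hz
  obtain ⟨b, rfl⟩ := S.toBase.surjective y
  rw [weight_eq_zero_iff] at ht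
  subst ht
  rw [LinearMap.mem_ker, unconsMap_pureTensor, S.eq_incl_of_comp_false (ha 0), projM_incl, smul_zero,
    map_zero, LinearMap.zero_apply, pureTensor, TensorProduct.zero_tmul]

theorem unconsMap_mem {p n : ℕ} {z : Chain k A (S.Ind S.Base) (n + 1)}
    (hz : z ∈ S.piece _ (p + 1) (n + 1)) : S.unconsMap n z ∈ S.piece _ p n := by
  refine S.ind_piece_le (N := (S.piece (S.Ind S.ideal) p n).comap (S.unconsMap n))
    (fun y c t a ht ha => ?_) hz
  obtain ⟨b, rfl⟩ := S.toBase.surjective y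
  rw [Submodule.mem_comap, unconsMap_pureTensor]
  rcases h : t 0 with _ | _
  · have e : a 0 = S.incl (S.retr (a 0)) := S.eq_incl_of_comp_false (by rw [← h, ha 0])
    rw [e, projM_incl, smul_zero, map_zero, LinearMap.zero_apply, pureTensor,
      TensorProduct.zero_tmul]
    exact zero_mem _
  · refine S.pureTensor_mem_piece (t := fun i => t i.succ) ?_ (fun i => ha i.succ) _
    rw [weight, Fin.sum_univ_succ, h, Bool.toNat_true] at ht
    rw [weight]
    omega

/-- Extracting the M-component of the first letter lowers the weight by exactly one, and it kills
words that begin with a letter in B. -/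
theorem gradeProj_unconsMap (p n : ℕ) (z : Chain k A (S.Ind S.Base) (n + 1)) :
    S.gradeProj _ p n (S.unconsMap n z) = S.unconsMap n (S.gradeProj _ (p + 1) (n + 1) z) := by
  refine S.gradeProj_map _ (fun _ hz => S.unconsMap_mem hz) (fun r hr z hz => ?_) z
  rcases r with _ | r
  · rw [S.unconsMap_eq_zero hz, map_zero]
  · exact S.gradeProj_of_mem_of_ne _ (by omega) (S.unconsMap_mem hz)

theorem vert_consBase (p n : ℕ) {z : Chain k A (S.Ind S.Base) (n + 1)}
    (hz : z ∈ S.piece _ p (n + 1)) :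
    S.vert _ p (n + 1) (S.consBase (n + 1) z) + S.consBase n (S.vert _ p n z) =
      z - S.gradeProj _ p (n + 1) (S.consIdeal n (S.unconsMap n z)) := by
  rw [vert_apply, vert_apply, ← gradeProj_consBase, ← map_add, boundary_consBase, map_sub,
    S.gradeProj_of_mem _ hz]

theorem vert_consIdeal (p n : ℕ) (z : Chain k A (S.Ind S.ideal) (n + 1)) :
    S.vert _ (p + 1) (n + 1) (S.consIdeal (n + 1) z) = - S.consIdeal n (S.vert _ p n z) := by
  rw [vert_apply, vert_apply, ← gradeProj_consIdeal, boundary_consIdeal, map_neg]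

theorem vert_unconsMap (p n : ℕ) (z : Chain k A (S.Ind S.Base) (n + 2)) :
    S.vert _ p n (S.unconsMap (n + 1) z) = - S.unconsMap n (S.vert _ (p + 1) (n + 1) z) := by
  rw [vert_apply, vert_apply, boundary_unconsMap, map_neg, gradeProj_unconsMap]

end GradedHomotopy

section VertVert

variable (X : Type u) [AddCommGroup X] [Module k X] [Module A X] [Module Aᵐᵒᵖ X]
  [SMulCommClass A Aᵐᵒᵖ X] [IsScalarTower k A X] [IsScalarTower k Aᵐᵒᵖ X]

/-- In weight 0 nothing can be lowered, so `vert` is the full boundary there. In positive weight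
this is the weight-preserving part of b² = 0. -/
theorem vert_vert_eq_zero (p n : ℕ) {z : Chain k A X (n + 2)} (hz : z ∈ S.piece X p (n + 2)) :
    S.vert X p n (S.vert X p (n + 1) z) = 0 := by
  rcases p with _ | p
  · have h : boundary k A X (n + 1) z = S.gradeProj X 0 (n + 1) (boundary k A X (n + 1) z) := by
      conv_lhs => rw [S.eq_sum_gradeProj X le_rfl (boundary k A X (n + 1) z)]
      rw [Finset.sum_eq_single 0]
      · intro r _ hr
        rw [← S.bd_succ]
        exact S.gradeProj_bd_of_mem X hr (by omega) hz
      · intro h; exact absurd (Finset.mem_range.2 (by omega)) h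
    rw [vert_apply, vert_apply, ← h, ← LinearMap.comp_apply (boundary k A X n), boundary_boundary,
      LinearMap.zero_apply, map_zero]
  · have := S.vert_vert X (j := n + 1) (l := n) hz
    rwa [bd_succ, bd_succ] at this

/-- Exactness of `X ⊗ [M_p B_*]` in the degrees `n + 1` (total degrees, counted with `p`). -/
def VertExact (p n : ℕ) : Prop :=
  ∀ z ∈ S.piece X p (n + 1), S.vert X p n z = 0 →
    ∃ w ∈ S.piece X p (n + 2), S.vert X p (n + 1) w = z

theorem wordBoundary_exact_iff_vertExact (p n : ℕ) :
    Function.Exact (S.wordBoundary X p (n + 1)) (S.wordBoundary X p n) ↔ S.VertExact X p n := by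
  rw [wordBoundary_exact_iff]
  refine forall₂_congr fun z _ => ⟨fun h => h.1, fun h => ⟨h, ?_⟩⟩
  rintro ⟨w, hw, rfl⟩
  exact S.vert_vert_eq_zero X p n hw

end VertVert

theorem vertExact_base_zero (n : ℕ) : S.VertExact (S.Ind S.Base) 0 n := by
  intro z hz hd
  refine ⟨S.consBase (n + 1) z, S.consBase_mem hz, ?_⟩
  have := S.vert_consBase 0 n hz
  rwa [hd, S.unconsMap_eq_zero hz, map_zero, map_zero, map_zero, add_zero, sub_zero] at this

/-- Exactness of `(M ⊗ B) ⊗ [M_p B_*]` implies exactness of `(B ⊗ B) ⊗ [M_{p+1} B_*]`. -/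
theorem vertExact_base_succ {p n : ℕ} (h : S.VertExact (S.Ind S.ideal) p n) :
    S.VertExact (S.Ind S.Base) (p + 1) (n + 1) := by
  intro z hz hd
  -- `unconsMap` anticommutes with `vert`, so it carries the cycle `z` to a cycle of lower weight,
  -- to which the hypothesis applies.
  obtain ⟨y, hy, e⟩ := h (S.unconsMap (n + 1) z) (S.unconsMap_mem hz) (by
    rw [vert_unconsMap, hd, map_zero, neg_zero])
  -- The first term bounds `z` up to the image of `unconsMap` under `consIdeal`. The second corrects
  -- that error, with a minus sign because `consIdeal` anticommutes with `vert`.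
  refine ⟨S.consBase (n + 2) z - S.consIdeal (n + 2) y,
    sub_mem (S.consBase_mem hz) (S.consIdeal_mem hy), ?_⟩
  have := S.vert_consBase (p + 1) (n + 1) hz
  rw [hd, map_zero, add_zero, gradeProj_consIdeal, S.gradeProj_of_mem _ (S.unconsMap_mem hz),
    ← e] at this
  rw [map_sub, this, vert_consIdeal]
  abel

end SplitExtension

/-! ### The bottom of the columns. -/

namespace SplitExtension
variable {k A B : Type u} [Field k] [Ring A] [Algebra k A] [Ring B] [Algebra k B]
  (S : SplitExtension k A B)
open HochschildComplex

section Bottom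

variable {X : Type u} [AddCommGroup X] [Module k X] [Module A X] [Module Aᵐᵒᵖ X]
  [SMulCommClass A Aᵐᵒᵖ X] [IsScalarTower k A X] [IsScalarTower k Aᵐᵒᵖ X]

/-- The kernel of `κ` is generated by the tensors with an entry in `B` and by differences of
neighbouring faces. -/
theorem ker_kappaLin_le_of_faces {n : ℕ} {Z : Type*} [AddCommGroup Z] [Module k Z]
    (L : Chain k A X (n + 1) →ₗ[k] Z)
    (hL : ∀ (x : X) (a : Fin (n + 1) → A) (j : Fin (n + 1)), S.projM (a j) = 0 →
      L (pureTensor k A X x a) = 0)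
    (hLf : ∀ (x : X) (a : Fin (n + 2) → A) (j : Fin (n + 2)), S.projM (a j) = 0 →
      L (face k j.castSucc (pureTensor k A X x a)) = L (face k j.succ (pureTensor k A X x a))) :
    LinearMap.ker (S.kappaLin X n) ≤ LinearMap.ker L := by
  have hLM := S.map_pureTensor_projM L hL
  have hup : ∀ (m : Fin (n + 1) → S.ideal) (i : Fin (n + 1)) (m' : S.ideal) ,
      (fun l => (Function.update m i m' l : A)) = Function.update (fun l => (m l : A)) i m' := by
    intro m i m'
    funext l
    by_cases h : l = i
    · subst h; simp
    · simp [h]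
  -- Each relation of X ⊗_{B^e} M^{⊗_B (n+1)} equates two neighbouring faces of a word with one
  -- letter b inserted: in front of the word here, at its end in `r1`, and between two letters in
  -- `r2`.
  have r0 : ∀ (x : X) (m : Fin (n + 1) → S.ideal) (b : B),
      L (pureTensor k A X (MulOpposite.op (S.incl b) • x) fun l => (m l : A)) =
        L (pureTensor k A X x fun l => (Function.update m 0 (b • m 0) l : A)) := by
    intro x m b
    have := hLf x (insertAt 0 (S.incl b) fun l => (m l : A)) 0 (by
      rw [insertAt_self, S.projM_incl])
    rw [face_pureTensor, face_pureTensor, Fin.castSucc_zero, algFace_insertAt_zero] at this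
    have e := algFace_insertAt_succ (0 : Fin (n + 1)) (S.incl b) fun l => (m l : A)
    rw [Fin.castSucc_zero] at e
    rw [e] at this
    rw [hup]
    simpa [coeffFace, insertAt_self] using this
  have r1 : ∀ (x : X) (m : Fin (n + 1) → S.ideal) (b : B),
      L (pureTensor k A X (S.incl b • x) fun l => (m l : A)) =
        L (pureTensor k A X x fun l => (Function.update m (Fin.last n)
          (MulOpposite.op b • m (Fin.last n)) l : A)) := by
    intro x m b
    have := hLf x (insertAt (Fin.last (n + 1)) (S.incl b) fun l => (m l : A)) (Fin.last (n + 1)) (by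
      rw [insertAt_self, S.projM_incl])
    rw [face_pureTensor, face_pureTensor, Fin.succ_last, algFace_insertAt_last] at this
    have e := algFace_insertAt_castSucc (Fin.last n) (S.incl b) fun l => (m l : A)
    rw [Fin.succ_last] at e
    rw [e] at this
    rw [hup]
    simpa [coeffFace, insertAt_self] using this.symm
  have r2 : ∀ (x : X) (m : Fin (n + 1) → S.ideal) (b : B) (j : Fin n),
      L (pureTensor k A X x fun l => (Function.update m j.castSucc
          (MulOpposite.op b • m j.castSucc) l : A)) =
        L (pureTensor k A X x fun l => (Function.update m j.succ (b • m j.succ) l : A)) := by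
    intro x m b j
    have := hLf x (insertAt j.succ.castSucc (S.incl b) fun l => (m l : A)) j.succ.castSucc (by
      rw [insertAt_self, S.projM_incl])
    rw [face_pureTensor, face_pureTensor, algFace_insertAt_succ] at this
    have e := algFace_insertAt_castSucc j.castSucc (S.incl b) fun l => (m l : A)
    rw [Fin.succ_castSucc] at e
    rw [e] at this
    rw [hup, hup]
    have hj := j.2
    have h1 : ¬ ((j : ℕ) = n + 1) := by omega
    simpa [coeffFace, h1, hj.ne] using this
  let L1 : S.Res X ⊗[k] (⨂[k] _ : Fin (n + 1), S.ideal) →ₗ[k] Z :=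
    L ∘ₗ TensorProduct.map (S.toRes X).symm.toLinearMap
      (PiTensorProduct.map fun _ => S.ideal.subtype)
  have hL1 : ∀ (x : X) (m : Fin (n + 1) → S.ideal),
      L1 (S.toRes X x ⊗ₜ PiTensorProduct.tprod k m) =
        L (pureTensor k A X x fun l => (m l : A)) := by
    intro x m
    simp [L1]
  let L2 : S.Res X ⊗[k] S.MPow n →ₗ[k] Z :=
    TensorProduct.lift (TensorPow.lift (TensorProduct.curry L1).flip (by
      intro j m b
      ext x
      exact (hL1 x _).trans ((r2 x m b j).trans (hL1 x _).symm))).flip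
  have hL2 : ∀ (x : X) (m : Fin (n + 1) → S.ideal),
      L2 (S.toRes X x ⊗ₜ TensorPow.mk m) = L (pureTensor k A X x fun l => (m l : A)) :=
    fun x m => hL1 x m
  have key := EnvTensor.ker_mk_le k B L2 (by
    intro b x y
    refine LinearMap.congr_fun (f := TensorProduct.curry L2 (MulOpposite.op b • x))
      (g := TensorProduct.curry L2 x ∘ₗ TensorPow.lmul n b) (TensorPow.ext fun m => ?_) y
    simp only [LinearMap.comp_apply, TensorPow.lmul_mk, TensorProduct.curry_apply]
    exact (hL2 _ _).trans ((r0 x m b).trans (hL2 _ _).symm)) (by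
    intro b x y
    refine LinearMap.congr_fun (f := TensorProduct.curry L2 (b • x))
      (g := TensorProduct.curry L2 x ∘ₗ TensorPow.rmul n (MulOpposite.op b))
      (TensorPow.ext fun m => ?_) y
    simp only [LinearMap.comp_apply, TensorPow.rmul_mk, TensorProduct.curry_apply]
    exact (hL2 _ _).trans ((r1 x m b).trans (hL2 _ _).symm))
  -- `L` sees only the M-components of the letters, and on those it is the balanced map `L2`; hence
  -- it vanishes wherever κ does.
  have hfac : L = L2 ∘ₗ TensorProduct.map (S.toRes X).toLinearMap
      (TensorPow.proj k B S.ideal n ∘ₗ PiTensorProduct.map fun _ => S.projM) := by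
    refine chain_ext k fun x a => ?_
    rw [hLM, ← hL2]
    simp [TensorPow.mk]
  intro y hy
  rw [hfac]
  exact key hy

variable (X)

/-- Weight `n` on `n` letters forces every letter into M. -/
theorem gradeProj_top_eq_zero {n : ℕ} (x : X) (a : Fin n → A) (j : Fin n)
    (h : S.projM (a j) = 0) : S.gradeProj X n n (pureTensor k A X x a) = 0 := by
  rw [gradeProj, LinearMap.sum_apply]
  refine Finset.sum_eq_zero fun t ht => ?_
  have hj : t j = true := by
    by_contra hc
    have := (Finset.mem_filter.1 ht).2
    rw [weight, ← Finset.add_sum_erase Finset.univ _ (Finset.mem_univ j), Bool.eq_false_of_not_eq_true hc,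
      Bool.toNat_false, zero_add] at this
    have h2 : ∑ i ∈ Finset.univ.erase j, (t i).toNat ≤ ∑ i ∈ Finset.univ.erase j, 1 :=
      Finset.sum_le_sum fun i _ => Bool.toNat_le _
    rw [Finset.sum_const, Finset.card_erase_of_mem (Finset.mem_univ j), Finset.card_univ,
      Fintype.card_fin, smul_eq_mul, mul_one] at h2
    have := j.2
    omega
  rw [typeProj_pureTensor, pureTensor, MultilinearMap.map_coord_zero (PiTensorProduct.tprod k) j,
    TensorProduct.tmul_zero]
  rw [hj]
  exact congrArg Subtype.val h

theorem kappaLin_vert {p : ℕ} {w : Chain k A X (p + 2)} (hw : w ∈ S.piece X (p + 1) (p + 2)) :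
    S.kappaLin X p (S.vert X (p + 1) (p + 1) w) = 0 := by
  have := (S.vert_mem X (p + 1) 0 hw).2
  rwa [bd_succ] at this

/-- The image of `X ⊗ [M_p B_1]` in `X ⊗ M^{⊗ p}` is the kernel of the map to
`X ⊗_{B^e} M^{⊗_B p}`. -/
theorem exists_vert_eq {p : ℕ} {z : Chain k A X (p + 1)} (hz : z ∈ S.piece X (p + 1) (p + 1))
    (h : S.kappaLin X p z = 0) : ∃ w ∈ S.piece X (p + 1) (p + 2), S.vert X (p + 1) (p + 1) w = z := by
  let R := (S.piece X (p + 1) (p + 2)).map (S.vert X (p + 1) (p + 1))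
  -- Membership of `z` in the image `R` means `L z = 0`, so it suffices that `L` satisfies the two
  -- conditions of `ker_kappaLin_le_of_faces`.
  let L := R.mkQ ∘ₗ S.gradeProj X (p + 1) (p + 1)
  have hL : ∀ (x : X) (a : Fin (p + 1) → A) (j : Fin (p + 1)), S.projM (a j) = 0 →
      L (pureTensor k A X x a) = 0 := fun x a j hj => by
    rw [LinearMap.comp_apply, S.gradeProj_top_eq_zero X x a j hj, map_zero]
  -- Only the weights `p + 1` and `p + 2` could reach weight `p + 1` under b. The letter in B
  -- excludes the second, so the projected boundary is a value of `vert`.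
  have hLb : ∀ (x : X) (a : Fin (p + 2) → A) (j : Fin (p + 2)), S.projM (a j) = 0 →
      L (boundary k A X (p + 1) (pureTensor k A X x a)) = 0 := by
    intro x a j hj
    rw [LinearMap.comp_apply, Submodule.mkQ_apply, Submodule.Quotient.mk_eq_zero]
    refine ⟨_, S.gradeProj_mem X (p + 1) (p + 2) (pureTensor k A X x a), ?_⟩
    rw [vert_apply]
    conv_rhs => rw [S.eq_sum_gradeProj X le_rfl (pureTensor k A X x a), map_sum, map_sum]
    rw [Finset.sum_eq_single (p + 1)]
    · intro r _ hr
      by_cases hr' : r = p + 2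
      · subst hr'
        rw [S.gradeProj_top_eq_zero X x a j hj, map_zero, map_zero]
      · rw [← S.bd_succ]
        exact S.gradeProj_bd_of_mem X (Ne.symm hr) (Ne.symm hr') (S.gradeProj_mem X _ _ _)
    · intro h; exact absurd (Finset.mem_range.2 (by omega)) h
  have key := S.ker_kappaLin_le_of_faces L hL (by
    intro x a j hj
    have e := hLb x a j hj
    rw [boundary_apply, map_sum] at e
    simp only [map_smul] at e
    -- All faces that leave the letter `a j` untouched still contain it and are killed by `L`; the
    -- two remaining faces have opposite signs.
    rw [alternating_sum_split (fun i => L (face k i (pureTensor k A X x a))) j] at e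
    · rcases smul_eq_zero.1 e with h' | h'
      · exact absurd h' (pow_ne_zero _ (by simp))
      · exact sub_eq_zero.1 h'
    · intro i h1 h2
      obtain ⟨l, hl⟩ := S.exists_projM_algFace a j hj i h1 h2
      rw [face_pureTensor]
      exact hL _ _ l hl) h
  rw [LinearMap.mem_ker, LinearMap.comp_apply, S.gradeProj_of_mem X hz, Submodule.mkQ_apply,
    Submodule.Quotient.mk_eq_zero] at key
  exact key

end Bottom

end SplitExtension

/-! ### Linear structure and augmentation of (B ⊗ B) ⊗ [M_p B_*]. -/

namespace SplitExtension
variable {k A B : Type u} [Field k] [Ring A] [Algebra k A] [Ring B] [Algebra k B]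
  (S : SplitExtension k A B)
open HochschildComplex

section Linear

variable (R : Type u) [Ring R] [Algebra k R] (X : Type u) [AddCommGroup X] [Module k X] [Module A X]
  [Module Aᵐᵒᵖ X] [SMulCommClass A Aᵐᵒᵖ X] [IsScalarTower k A X] [IsScalarTower k Aᵐᵒᵖ X]
  [Module R X] [IsScalarTower k R X]

theorem rTensor_toModuleEnd {W : Type u} [AddCommGroup W] [Module k W] (r : R) (z : X ⊗[k] W) :
    (Module.toModuleEnd k (S := R) X r).rTensor W z = r • z := by
  induction z with
  | zero => rw [map_zero, smul_zero]
  | tmul x w => rfl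
  | add z z' h h' => rw [map_add, smul_add, h, h']

variable [SMulCommClass R A X] [SMulCommClass R Aᵐᵒᵖ X]

/-- The map `X ⊗ [M_p B_{n+1-p}] → X ⊗ [M_p B_{n-p}]` as a linear map over a ring that acts on the
bimodule `X`. -/
noncomputable def wordBoundaryLin (p n : ℕ) :
    X ⊗[k] S.Words p (n + 1) →ₗ[R] X ⊗[k] S.Words p n where
  toFun := S.wordBoundary X p n
  map_add' := map_add _
  map_smul' r z := by
    rw [← rTensor_toModuleEnd, RingHom.id_apply, ← rTensor_toModuleEnd]
    exact S.wordBoundary_rTensor (Module.toModuleEnd k (S := R) X r)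
      (fun b x => smul_comm r (S.incl b) x) (fun b x => smul_comm r (MulOpposite.op (S.incl b)) x)
      p n z

end Linear

section Base

/-- B^e acts on the outer sides of B ⊗ B, and A acts through the retraction on the inner sides. The
commutation makes the vertical differential B^e-linear. -/
instance : SMulCommClass (Env k B) A (S.Ind S.Base) := ⟨fun r a x => by
  induction x using S.ind_induction with
  | zero => simp only [smul_zero]
  | add x x' h h' => simp only [smul_add, h, h']
  | mk b' c' =>
    obtain ⟨b', rfl⟩ := S.toBase.surjective b'
    induction r using TensorProduct.induction_on with
    | zero =>
      exact (zero_smul (Env k B) _).trans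
        ((congrArg (fun x : S.Ind S.Base => a • x) (zero_smul (Env k B) _)).trans (smul_zero a)).symm
    | add r r' h h' => simp only [add_smul, smul_add, h, h']
    | tmul b c => simp only [smul_indMk, env_smul_indMk, mul_assoc]⟩

instance : SMulCommClass (Env k B) Aᵐᵒᵖ (S.Ind S.Base) := ⟨fun r a x => by
  induction x using S.ind_induction with
  | zero => simp only [smul_zero]
  | add x x' h h' => simp only [smul_add, h, h']
  | mk b' c' =>
    obtain ⟨b', rfl⟩ := S.toBase.surjective b'
    induction r using TensorProduct.induction_on with
    | zero =>
      exact (zero_smul (Env k B) _).trans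
        ((congrArg (fun x : S.Ind S.Base => a • x) (zero_smul (Env k B) _)).trans (smul_zero a)).symm
    | add r r' h h' => simp only [add_smul, smul_add, h, h']
    | tmul b c =>
      induction a using MulOpposite.rec' with
      | _ a => simp only [op_smul_indMk, op_smul_toBase, env_smul_indMk, mul_assoc]⟩

instance : SMulCommClass B A (S.Ind S.Base) := ⟨fun r a x => by
  induction x using S.ind_induction with
  | zero => simp only [smul_zero]
  | add x x' h h' => simp only [smul_add, h, h']
  | mk b' c' =>
    obtain ⟨b', rfl⟩ := S.toBase.surjective b'
    simp only [smul_indMk, base_smul_indMk]⟩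

instance : SMulCommClass B Aᵐᵒᵖ (S.Ind S.Base) := ⟨fun r a x => by
  induction x using S.ind_induction with
  | zero => simp only [smul_zero]
  | add x x' h h' => simp only [smul_add, h, h']
  | mk b' c' =>
    obtain ⟨b', rfl⟩ := S.toBase.surjective b'
    induction a using MulOpposite.rec' with
    | _ a => simp only [op_smul_indMk, op_smul_toBase, base_smul_indMk, mul_assoc]⟩

instance : Module.Free (Env k B) (S.Ind S.Base) :=
  inferInstanceAs (Module.Free (Env k B) (Env k B))

instance : Module.Free B (S.Ind S.Base) :=
  inferInstanceAs (Module.Free B (B ⊗[k] Bᵐᵒᵖ))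

theorem projective_env (W : Type u) [AddCommGroup W] [Module k W] :
    Module.Projective (Env k B) (S.Ind S.Base ⊗[k] W) := inferInstance

theorem projective_base (W : Type u) [AddCommGroup W] [Module k W] :
    Module.Projective B (S.Ind S.Base ⊗[k] W) := inferInstance

end Base

section Augmentation

/-- The augmentation `(b ⊗ c) ⊗ a₀ ⊗ ⋯ ⊗ aₚ ↦ b ((a₀)_M ⊗ ⋯ ⊗ (aₚ)_M) c`. -/
noncomputable def augment (p : ℕ) : Chain k A (S.Ind S.Base) (p + 1) →ₗ[k] S.MPow p :=
  TensorProduct.lift (TensorProduct.Algebra.moduleAux : B ⊗[k] Bᵐᵒᵖ →ₗ[k] S.MPow p →ₗ[k] S.MPow p) ∘ₗ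
    LinearMap.lTensor _ (TensorPow.proj k B S.ideal p ∘ₗ PiTensorProduct.map fun _ => S.projM)

theorem augment_pureTensor {p : ℕ} (b : B) (c : Bᵐᵒᵖ) (a : Fin (p + 1) → A) :
    S.augment p (pureTensor k A _ (S.indMk (S.toBase b) c) a) =
      b • c • (TensorPow.mk fun i => S.projM (a i) : S.MPow p) := by
  refine congrArg (fun t => b • c • TensorPow.proj k B S.ideal p t) ?_
  exact PiTensorProduct.map_tprod _ _

theorem augment_smul {p : ℕ} (r : Env k B) (z : Chain k A (S.Ind S.Base) (p + 1)) :
    S.augment p (r • z) = TensorProduct.Algebra.moduleAux r (S.augment p z) := by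
  let _ := leftEnvModule k B (S.MPow p)
  induction z using TensorProduct.induction_on with
  | zero => rw [smul_zero, map_zero, map_zero]
  | add z z' h h' => rw [smul_add, map_add, map_add, map_add, h, h']
  | tmul x w =>
    exact mul_smul r (show Env k B from x) (TensorPow.proj k B S.ideal p
      (PiTensorProduct.map (fun _ => S.projM) w))

theorem augment_base_smul {p : ℕ} (b : B) (z : Chain k A (S.Ind S.Base) (p + 1)) :
    S.augment p (b • z) = b • S.augment p z := by
  refine LinearMap.congr_fun (f := S.augment p ∘ₗ Module.toModuleEnd k (S := B) _ b)
    (g := Module.toModuleEnd k (S := B) _ b ∘ₗ S.augment p) (S.ind_chain_ext fun y c a => ?_) z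
  obtain ⟨b', rfl⟩ := S.toBase.surjective y
  refine (S.augment_pureTensor (b * b') c a).trans ?_
  rw [mul_smul]
  exact congrArg (b • ·) (S.augment_pureTensor b' c a).symm

theorem augment_surjective (p : ℕ) : Function.Surjective (S.augment p) := by
  rw [← LinearMap.range_eq_top, ← Submodule.ker_mkQ (LinearMap.range (S.augment p)),
    LinearMap.ker_eq_top]
  refine TensorPow.ext fun m => ?_
  rw [Submodule.mkQ_apply, LinearMap.zero_apply, Submodule.Quotient.mk_eq_zero]
  refine ⟨pureTensor k A _ (S.indMk (S.toBase 1) 1) fun i => (m i : A), ?_⟩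
  rw [augment_pureTensor, one_smul, one_smul]
  simp only [projM_coe]

/-- The augmentation only uses the M-components of the letters, so it factors through the all-M
type, the only one of top weight. -/
theorem augment_gradeProj (p : ℕ) (z : Chain k A (S.Ind S.Base) (p + 1)) :
    S.augment p (S.gradeProj _ (p + 1) (p + 1) z) = S.augment p z := by
  rw [gradeProj, LinearMap.sum_apply, map_sum]
  rw [Finset.sum_eq_single (fun _ => true)]
  · refine LinearMap.congr_fun (f := S.augment p ∘ₗ S.typeProj _ (fun _ => true))
      (S.ind_chain_ext fun y c a => ?_) z
    obtain ⟨b, rfl⟩ := S.toBase.surjective y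
    rw [LinearMap.comp_apply, typeProj_pureTensor, augment_pureTensor, augment_pureTensor]
    simp only [comp, LinearMap.comp_apply, Submodule.subtype_apply, projM_coe]
  · intro t ht hne
    refine absurd (funext fun i => ?_) hne
    by_contra hc
    have := (Finset.mem_filter.1 ht).2
    rw [weight, ← Finset.add_sum_erase Finset.univ _ (Finset.mem_univ i),
      Bool.eq_false_of_not_eq_true hc, Bool.toNat_false, zero_add] at this
    have h2 : ∑ i ∈ Finset.univ.erase i, (t i).toNat ≤ ∑ i ∈ Finset.univ.erase i, 1 :=
      Finset.sum_le_sum fun i _ => Bool.toNat_le _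
    rw [Finset.sum_const, Finset.card_erase_of_mem (Finset.mem_univ i), Finset.card_univ,
      Fintype.card_fin, smul_eq_mul, mul_one] at h2
    omega
  · intro h
    exact absurd (Finset.mem_filter.2 ⟨Finset.mem_univ _, by simp [weight]⟩) h

/-- In (B ⊗ B) ⊗_{B^e} M^{⊗_B (p+1)} the coefficient can be moved across the tensor sign. With
`augment_eq_zero_of_kappaLin` this shows that κ and the augmentation have the same kernel. -/
theorem kappaLin_eq_mk_augment {p : ℕ} (z : Chain k A (S.Ind S.Base) (p + 1)) :
    S.kappaLin (S.Ind S.Base) p z = S.relMk (S.indMk (S.toBase 1) 1) (S.augment p z) := by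
  refine LinearMap.congr_fun (g := EnvTensor.mk k B (S.Res (S.Ind S.Base)) (S.MPow p) ∘ₗ
    TensorProduct.mk k _ _ (S.toRes _ (S.indMk (S.toBase 1) 1)) ∘ₗ S.augment p)
    (S.ind_chain_ext fun y c a => ?_) z
  obtain ⟨b, rfl⟩ := S.toBase.surjective y
  refine (S.kappaLin_pureTensor _ a).trans ?_
  refine Eq.trans ?_ (congrArg (S.relMk (S.indMk (S.toBase 1) 1)) (S.augment_pureTensor b c a)).symm
  rw [← relMk_op_smul, op_smul_indMk, op_smul_toBase, one_mul, retr_incl]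
  refine Eq.trans ?_ (S.relMk_smul c.unop _ _)
  rw [smul_indMk, one_mul, retr_incl]
  rfl

theorem augment_eq_zero_of_kappaLin {p : ℕ} {z : Chain k A (S.Ind S.Base) (p + 1)}
    (h : S.kappaLin (S.Ind S.Base) p z = 0) : S.augment p z = 0 := by
  let L : S.Res (S.Ind S.Base) ⊗[k] S.MPow p →ₗ[k] S.MPow p :=
    TensorProduct.lift ((TensorProduct.Algebra.moduleAux : B ⊗[k] Bᵐᵒᵖ →ₗ[k] S.MPow p →ₗ[k] S.MPow p) :
      S.Ind S.Base →ₗ[k] _)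
  have hL : ∀ b c y, L (S.toRes _ (S.indMk (S.toBase b) c) ⊗ₜ y) = b • c • y := fun _ _ _ => rfl
  refine EnvTensor.ker_mk_le k B L ?_ ?_ h
  · intro b x y
    obtain ⟨x, rfl⟩ := (S.toRes _).surjective x
    induction x using S.ind_induction with
    | zero => simp only [map_zero, smul_zero, TensorProduct.zero_tmul]
    | add x x' h h' => simp only [map_add, smul_add, TensorProduct.add_tmul, h, h']
    | mk b' c' =>
      obtain ⟨b', rfl⟩ := S.toBase.surjective b'
      rw [op_smul_toRes, op_smul_indMk, op_smul_toBase, hL, hL, retr_incl, mul_smul,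
        smul_comm b c' y]
  · intro b x y
    obtain ⟨x, rfl⟩ := (S.toRes _).surjective x
    induction x using S.ind_induction with
    | zero => simp only [map_zero, smul_zero, TensorProduct.zero_tmul]
    | add x x' h h' => simp only [map_add, smul_add, TensorProduct.add_tmul, h, h']
    | mk b' c' =>
      obtain ⟨b', rfl⟩ := S.toBase.surjective b'
      rw [smul_toRes, smul_indMk, hL, hL, retr_incl, mul_smul]

/-- The augmentation on `(B ⊗ B) ⊗ M^{⊗ (p + 1)}`. -/
noncomputable def wordAugment (p : ℕ) :
    S.Ind S.Base ⊗[k] S.Words (p + 1) (p + 1) →ₗ[k] S.MPow p :=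
  S.augment p ∘ₗ S.wordIncl _ (p + 1) (p + 1)

theorem wordAugment_surjective (p : ℕ) : Function.Surjective (S.wordAugment p) := by
  intro y
  obtain ⟨z, rfl⟩ := S.augment_surjective p y
  refine ⟨S.wordRestrict _ (p + 1) (p + 1) z, ?_⟩
  rw [wordAugment, LinearMap.comp_apply, wordIncl_wordRestrict, augment_gradeProj]

/-- Since the augmentation has the kernel of κ, this is the exactness at the bottom of the column
with coefficients B ⊗ B. -/
theorem wordAugment_exact (p : ℕ) :
    Function.Exact (S.wordBoundary (S.Ind S.Base) (p + 1) (p + 1)) (S.wordAugment p) := by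
  intro z
  constructor
  · intro h
    obtain ⟨w, hw, e⟩ := S.exists_vert_eq _ (S.wordIncl_mem _ _ _ z) (by
      rw [kappaLin_eq_mk_augment]
      refine Eq.trans (congrArg (S.relMk _) h) ?_
      exact (congrArg (EnvTensor.mk k B _ _) (TensorProduct.tmul_zero _ _)).trans (map_zero _))
    obtain ⟨w, rfl⟩ := S.exists_wordIncl_eq _ hw
    exact ⟨w, S.wordIncl_injective _ _ _ ((S.wordIncl_wordBoundary _ _ _ w).trans e)⟩
  · rintro ⟨w, rfl⟩
    rw [wordAugment, LinearMap.comp_apply, wordIncl_wordBoundary]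
    exact S.augment_eq_zero_of_kappaLin (S.kappaLin_vert _ (S.wordIncl_mem _ _ _ w))

theorem wordIncl_smul {R : Type u} [Ring R] [Algebra k R] [Module R (S.Ind S.Base)]
    [IsScalarTower k R (S.Ind S.Base)] (p n : ℕ) (r : R) (z) :
    S.wordIncl (S.Ind S.Base) p n (r • z) = r • S.wordIncl (S.Ind S.Base) p n z := by
  rw [← rTensor_toModuleEnd, ← rTensor_toModuleEnd]
  exact S.wordIncl_rTensor _ p n z

end Augmentation
end SplitExtension

/-! ### The augmentation in weight 0. -/

namespace SplitExtension
variable {k A B : Type u} [Field k] [Ring A] [Algebra k A] [Ring B] [Algebra k B]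
  (S : SplitExtension k A B)
open HochschildComplex

section AugmentZero

/-- The augmentation `b ⊗ c ↦ b c` in degree `0`. -/
noncomputable def augmentZero : Chain k A (S.Ind S.Base) 0 →ₗ[k] B :=
  (TensorProduct.rid k B).toLinearMap ∘ₗ TensorProduct.map
    ((TensorProduct.Algebra.moduleAux : B ⊗[k] Bᵐᵒᵖ →ₗ[k] B →ₗ[k] B).flip 1 : S.Ind S.Base →ₗ[k] B)
    (PiTensorProduct.isEmptyEquiv (Fin 0)).toLinearMap

theorem augmentZero_pureTensor (b : B) (c : Bᵐᵒᵖ) (a : Fin 0 → A) :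
    S.augmentZero (pureTensor k A _ (S.indMk (S.toBase b) c) a) = b * c.unop := by
  refine (congrArg (fun t : k => TensorProduct.rid k B ((b • c • (1 : B)) ⊗ₜ[k] t))
    (PiTensorProduct.isEmptyEquiv_apply_tprod (Fin 0) a)).trans ?_
  simp

theorem augmentZero_base_smul (b : B) (z : Chain k A (S.Ind S.Base) 0) :
    S.augmentZero (b • z) = b • S.augmentZero z := by
  refine LinearMap.congr_fun (f := S.augmentZero ∘ₗ Module.toModuleEnd k (S := B) _ b)
    (g := Module.toModuleEnd k (S := B) _ b ∘ₗ S.augmentZero) (S.ind_chain_ext fun y c a => ?_) z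
  obtain ⟨b', rfl⟩ := S.toBase.surjective y
  refine (S.augmentZero_pureTensor (b * b') c a).trans ?_
  rw [mul_assoc]
  exact congrArg (b • ·) (S.augmentZero_pureTensor b' c a).symm

theorem augmentZero_surjective : Function.Surjective S.augmentZero := fun b =>
  ⟨pureTensor k A _ (S.indMk (S.toBase b) 1) Fin.elim0, by simp [augmentZero_pureTensor]⟩

theorem augmentZero_boundary (z : Chain k A (S.Ind S.Base) 1) :
    S.augmentZero (boundary k A _ 0 z) = 0 := by
  refine LinearMap.congr_fun (f := S.augmentZero ∘ₗ boundary k A _ 0) (g := 0)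
    (S.ind_chain_ext fun y c a => ?_) z
  obtain ⟨b, rfl⟩ := S.toBase.surjective y
  rw [LinearMap.comp_apply, boundary_apply, Fin.sum_univ_two, face_pureTensor, face_pureTensor,
    coeffFace_zero, ← Fin.succ_zero_eq_one, coeffFace_succ,
    if_pos (show ((0 : Fin 1) : ℕ) = 0 from rfl), op_smul_indMk, smul_indMk, op_smul_toBase,
    map_add, map_smul, map_smul, augmentZero_pureTensor, augmentZero_pureTensor,
    show ((-1 : k) ^ ((0 : Fin 2) : ℕ)) = 1 from pow_zero _,
    show ((-1 : k) ^ ((Fin.succ 0 : Fin 2) : ℕ)) = -1 from pow_one _, one_smul, neg_one_smul,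
    ← sub_eq_add_neg, LinearMap.zero_apply, sub_eq_zero, MulOpposite.unop_mul, MulOpposite.unop_op,
    mul_assoc]
  rfl

/-- This is the bottom of the bar contraction: b ⊗ c and 1 ⊗ bc differ by a boundary. Hence an
element with zero augmentation is itself a boundary. -/
theorem boundary_consBase_augmentZero (z : Chain k A (S.Ind S.Base) 0) :
    boundary k A _ 0 (S.consBase 0 z) = z -
      pureTensor k A _ (S.indMk (S.toBase 1) (MulOpposite.op (S.augmentZero z))) Fin.elim0 := by
  refine LinearMap.congr_fun (f := boundary k A _ 0 ∘ₗ S.consBase 0)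
    (g := LinearMap.id - (TensorProduct.mk k _ _).flip (PiTensorProduct.tprod k Fin.elim0) ∘ₗ
      S.indMk (S.toBase 1) ∘ₗ (MulOpposite.opLinearEquiv k).toLinearMap ∘ₗ S.augmentZero)
    (S.ind_chain_ext fun y c a => ?_) z
  obtain ⟨b, rfl⟩ := S.toBase.surjective y
  refine (S.boundary_consBase_zero b c a).trans ?_
  rw [LinearMap.sub_apply, LinearMap.id_apply]
  congr 1
  refine Eq.trans ?_ (congrArg (fun d : B => pureTensor k A _ (S.indMk (S.toBase 1)
    (MulOpposite.op d)) (Fin.elim0 : Fin 0 → A)) (S.augmentZero_pureTensor b c a)).symm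
  rw [Subsingleton.elim a Fin.elim0]
  rfl

theorem gradeProj_zero_zero (X : Type u) [AddCommGroup X] [Module k X] [Module A X] [Module Aᵐᵒᵖ X]
    [SMulCommClass A Aᵐᵒᵖ X] [IsScalarTower k A X] [IsScalarTower k Aᵐᵒᵖ X] (z : Chain k A X 0) :
    S.gradeProj X 0 0 z = z := by
  conv_rhs => rw [S.eq_sum_gradeProj X le_rfl z]
  simp

/-- The augmentation as a map of left `B`-modules. -/
noncomputable def wordAugmentZero : S.Ind S.Base ⊗[k] S.Words 0 0 →ₗ[B] B where
  toFun z := S.augmentZero (S.wordIncl _ 0 0 z)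
  map_add' z z' := by rw [map_add, map_add]
  map_smul' b z := by rw [wordIncl_smul, augmentZero_base_smul]; rfl

theorem wordAugmentZero_surjective : Function.Surjective S.wordAugmentZero := by
  intro b
  obtain ⟨z, rfl⟩ := S.augmentZero_surjective b
  refine ⟨S.wordRestrict _ 0 0 z, ?_⟩
  exact congrArg S.augmentZero ((S.wordIncl_wordRestrict _ 0 0 z).trans (S.gradeProj_zero_zero _ z))

theorem wordAugmentZero_exact :
    Function.Exact (S.wordBoundaryLin B (S.Ind S.Base) 0 0) S.wordAugmentZero := by
  have key : ∀ w, S.wordIncl _ 0 0 (S.wordBoundaryLin B (S.Ind S.Base) 0 0 w) =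
      boundary k A _ 0 (S.wordIncl _ 0 1 w) := fun w =>
    (S.wordIncl_wordBoundary (S.Ind S.Base) 0 0 w).trans (S.gradeProj_zero_zero _ _)
  intro z
  constructor
  · intro h
    have h' : S.augmentZero (S.wordIncl _ 0 0 z) = 0 := h
    obtain ⟨w, hw⟩ := S.exists_wordIncl_eq _ (S.consBase_mem (S.wordIncl_mem _ 0 0 z))
    refine ⟨w, S.wordIncl_injective _ 0 0 ?_⟩
    rw [key, hw, boundary_consBase_augmentZero, h', MulOpposite.op_zero, map_zero, pureTensor,
      TensorProduct.zero_tmul, sub_zero]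
  · rintro ⟨w, rfl⟩
    exact (congrArg S.augmentZero (key w)).trans (S.augmentZero_boundary _)

end AugmentZero

/-! ### Exactness from the vanishing of Tor over B. -/

section TorBase

/-- The map `b ⊗ c ↦ m b ⊗ c`. -/
noncomputable def idealAct : S.ideal →ₗ[k] S.Ind S.Base →ₗ[k] S.Ind S.ideal :=
  (LinearMap.rTensorHom Bᵐᵒᵖ ∘ₗ LinearMap.mk₂ k (fun (m : S.ideal) (b : B) => MulOpposite.op b • m)
    (fun m m' b => smul_add _ m m') (fun r m b => smul_comm _ r m)
    (fun m b b' => by rw [MulOpposite.op_add, add_smul])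
    (fun r m b => by rw [MulOpposite.op_smul, smul_assoc]) :
      S.ideal →ₗ[k] B ⊗[k] Bᵐᵒᵖ →ₗ[k] S.ideal ⊗[k] Bᵐᵒᵖ)

theorem idealAct_indMk (m : S.ideal) (b : B) (c : Bᵐᵒᵖ) :
    S.idealAct m (S.indMk (S.toBase b) c) = S.indMk (MulOpposite.op b • m) c := rfl

theorem idealAct_op_smul (m : S.ideal) (b : B) (x : S.Ind S.Base) :
    S.idealAct (MulOpposite.op b • m) x = S.idealAct m (b • x) := by
  induction x using S.ind_induction with
  | zero => simp only [smul_zero, map_zero]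
  | add x x' h h' => simp only [smul_add, map_add, h, h']
  | mk b' c =>
    obtain ⟨b', rfl⟩ := S.toBase.surjective b'
    rw [base_smul_indMk, idealAct_indMk, idealAct_indMk, MulOpposite.op_mul, mul_smul]

theorem idealAct_smul (m : S.ideal) (b : B) (x : S.Ind S.Base) :
    S.idealAct m (S.incl b • x) = S.incl b • S.idealAct m x := by
  induction x using S.ind_induction with
  | zero => simp only [smul_zero, map_zero]
  | add x x' h h' => simp only [smul_add, map_add, h, h']
  | mk b' c =>
    obtain ⟨b', rfl⟩ := S.toBase.surjective b'
    rw [smul_indMk, idealAct_indMk, idealAct_indMk, smul_indMk]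

theorem idealAct_smul_op (m : S.ideal) (b : B) (x : S.Ind S.Base) :
    S.idealAct m (MulOpposite.op (S.incl b) • x) = MulOpposite.op (S.incl b) • S.idealAct m x := by
  induction x using S.ind_induction with
  | zero => simp only [smul_zero, map_zero]
  | add x x' h h' => simp only [smul_add, map_add, h, h']
  | mk b' c =>
    obtain ⟨b', rfl⟩ := S.toBase.surjective b'
    rw [op_smul_indMk, op_smul_toBase, retr_incl, idealAct_indMk, idealAct_indMk, op_smul_indMk]
    refine congrArg (fun m => S.indMk m c) (Subtype.ext ?_)
    simp [coe_op_smul_ideal, mul_assoc]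

/-- If `(B ⊗ B) ⊗ [M_r B_*]` is a resolution of `Y` and `Tor^B_i(M, Y) = 0` for `i > 0`, then
`(M ⊗ B) ⊗ [M_r B_*]` is exact in positive degrees. -/
theorem vertExact_ideal {Y : Type u} [AddCommGroup Y] [Module B Y] (r : ℕ)
    (hex : ∀ q, S.VertExact (S.Ind S.Base) r (r + q))
    (ε : S.Ind S.Base ⊗[k] S.Words r r →ₗ[B] Y) (hε : Function.Surjective ε)
    (h₀ : Function.Exact (S.wordBoundaryLin B (S.Ind S.Base) r r) ε)
    (hY : ∀ i, 0 < i → Subsingleton (TorOver k B S.ideal Y i)) (q : ℕ) :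
    S.VertExact (S.Ind S.ideal) r (r + q) := by
  -- As a left B-module, (B ⊗ B) ⊗ W is generated by the k-space B^op ⊗ W, so tensoring with M over
  -- B gives (M ⊗ B) ⊗ W.
  obtain ⟨e⟩ := nonempty_torOverEquiv (k := k) (R := B) (X := S.ideal)
    (P := fun q => S.Ind S.Base ⊗[k] S.Words r (r + q))
    (U := fun q => Bᵐᵒᵖ ⊗[k] S.Words r (r + q))
    (T := fun q => S.Ind S.ideal ⊗[k] S.Words r (r + q))
    (fun q => S.wordBoundaryLin B (S.Ind S.Base) r (r + q)) ε
    (fun q => S.projective_base _) hε h₀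
    (fun q => (S.wordBoundary_exact_iff_vertExact _ _ _).2 (hex q))
    (fun q => LinearMap.rTensorHom _ ∘ₗ S.idealAct)
    (fun q m b y => by
      induction y with
      | zero => rw [smul_zero, map_zero, map_zero]
      | add y y' h h' => rw [smul_add, map_add, map_add, h, h']
      | tmul x w => exact congrArg (· ⊗ₜ w) (S.idealAct_op_smul m b x))
    (fun q => (S.indMk (S.toBase 1)).rTensor _)
    (fun q => by
      rw [eq_top_iff]
      rintro y -
      induction y with
      | zero => exact zero_mem _
      | add y y' h h' => exact add_mem h h'
      | tmul x w =>
        induction x using S.ind_induction with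
        | zero => rw [TensorProduct.zero_tmul]; exact zero_mem _
        | add x x' h h' => rw [TensorProduct.add_tmul]; exact add_mem h h'
        | mk b c =>
          obtain ⟨b, rfl⟩ := S.toBase.surjective b
          have : S.indMk (S.toBase b) c ⊗ₜ[k] w = b • (S.indMk (S.toBase 1)).rTensor _ (c ⊗ₜ[k] w) := by
            rw [LinearMap.rTensor_tmul, TensorProduct.smul_tmul', base_smul_indMk, mul_one]
          rw [this]
          exact Submodule.smul_mem _ _ (Submodule.subset_span ⟨_, rfl⟩))
    (fun q => by
      have : TensorProduct.lift ((LinearMap.rTensorHom (S.Words r (r + q)) ∘ₗ S.idealAct).compl₂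
          ((S.indMk (S.toBase 1)).rTensor _)) =
          (TensorProduct.assoc k S.ideal Bᵐᵒᵖ (S.Words r (r + q))).symm.toLinearMap := by
        refine TensorProduct.ext (LinearMap.ext fun m => TensorProduct.ext' fun c w => ?_)
        exact congrArg (fun m => S.indMk m c ⊗ₜ w) (one_smul Bᵐᵒᵖ m)
      rw [this]
      exact (TensorProduct.assoc k S.ideal Bᵐᵒᵖ (S.Words r (r + q))).symm.bijective)
    (fun q => S.wordBoundary (S.Ind S.ideal) r (r + q))
    (fun q m y => S.wordBoundary_rTensor (S.idealAct m) (fun b x => S.idealAct_smul m b x)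
      (fun b x => S.idealAct_smul_op m b x) r (r + q) y) q
  have := hY (q + 1) q.succ_pos
  -- The Tor group is zero, so every cycle is a boundary.
  have hle := le_of_subsingleton_subquotient e.toEquiv.subsingleton
  intro z hz hd
  obtain ⟨z, rfl⟩ := S.exists_wordIncl_eq _ hz
  obtain ⟨w, hw⟩ := hle (show z ∈ LinearMap.ker (S.wordBoundary (S.Ind S.ideal) r (r + q)) by
    rw [LinearMap.mem_ker]
    refine S.wordIncl_injective _ _ _ ?_
    rw [wordIncl_wordBoundary, hd, map_zero])
  exact ⟨_, S.wordIncl_mem _ _ _ w, (S.wordIncl_wordBoundary _ _ _ w).symm.trans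
    (congrArg (S.wordIncl _ _ _) hw)⟩

/-- The augmentation as a map of left `B`-modules. -/
noncomputable def wordAugmentBase (p : ℕ) :
    S.Ind S.Base ⊗[k] S.Words (p + 1) (p + 1) →ₗ[B] S.MPow p where
  toFun := S.wordAugment p
  map_add' := map_add _
  map_smul' b z := by
    rw [wordAugment, LinearMap.comp_apply, wordIncl_smul, augment_base_smul]; rfl

theorem subsingleton_torOver_projective (Z Y : Type u) [AddCommGroup Z] [Module k Z] [Module Bᵐᵒᵖ Z]
    [AddCommGroup Y] [Module B Y] [Module.Projective B Y] {i : ℕ} (hi : 0 < i) :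
    Subsingleton (TorOver k B Z Y i) := by
  obtain ⟨i, rfl⟩ := Nat.exists_eq_succ_of_ne_zero hi.ne'
  have : Projective (ModuleCat.of B Y) := (IsProjective.iff_projective Y).1 inferInstance
  exact ModuleCat.subsingleton_of_isZero
    (Functor.isZero_leftDerived_obj_projective_succ (tensorOverFunctor k B Z) i (ModuleCat.of B Y))

/-- `(B ⊗ B) ⊗ [M_r B_*]` is exact in positive degrees. -/
theorem vertExact_base
    (h : ∀ n i : ℕ, 0 < i → Subsingleton (TorOver k B S.ideal (S.MPow n) i)) (r q : ℕ) :
    S.VertExact (S.Ind S.Base) r (r + q) := by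
  induction r generalizing q with
  | zero => exact S.vertExact_base_zero _
  | succ r ih =>
    rw [Nat.add_right_comm]
    refine S.vertExact_base_succ ?_
    -- In weight 0 the resolved module is B itself, which `MPow` does not cover. There Tor vanishes
    -- because B is projective, without any hypothesis.
    rcases r with _ | r
    · exact S.vertExact_ideal 0 ih S.wordAugmentZero S.wordAugmentZero_surjective
        S.wordAugmentZero_exact (fun i hi => subsingleton_torOver_projective _ _ hi) q
    · exact S.vertExact_ideal (r + 1) ih (S.wordAugmentBase r) (S.wordAugment_surjective r)
        (S.wordAugment_exact r) (h r) q

end TorBase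
end SplitExtension

/-! ### Column homology as Tor over B^e. -/

namespace SplitExtension
variable {k A B : Type u} [Field k] [Ring A] [Algebra k A] [Ring B] [Algebra k B]
  (S : SplitExtension k A B)
open HochschildComplex

section EnvTor

variable (X : Type u) [AddCommGroup X] [Module k X] [Module A X] [Module Aᵐᵒᵖ X]
  [SMulCommClass A Aᵐᵒᵖ X] [IsScalarTower k A X] [IsScalarTower k Aᵐᵒᵖ X]

/-- The linear map underlying the anti-automorphism `b ⊗ b' ↦ b' ⊗ b` of `B^e`. -/
noncomputable def envSwapLin (k B : Type u) [Field k] [Ring B] [Algebra k B] :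
    Env k B →ₗ[k] Env k B :=
  (envSwap k B).toLinearMap.comp (MulOpposite.opLinearEquiv k).toLinearMap

/-- The map `b ⊗ c ↦ c x b`. -/
noncomputable def envAct : S.Res X →ₗ[k] S.Ind S.Base →ₗ[k] X :=
  ((TensorProduct.Algebra.moduleAux (R := k) (A := B) (B := Bᵐᵒᵖ) (M := S.Res X)).comp
    (envSwapLin k B)).flip

variable {X}

theorem envAct_indMk (x : X) (b : B) (c : Bᵐᵒᵖ) :
    S.envAct X (S.toRes X x) (S.indMk (S.toBase b) c) =
      S.incl c.unop • MulOpposite.op (S.incl b) • x := by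
  induction c using MulOpposite.rec' with
  | _ c =>
    exact congrArg (fun t : Env k B => TensorProduct.Algebra.moduleAux t (S.toRes X x))
      (envSwap_op_tmul k B b c)

/-- With B ⊗ B identified with B^e, `envAct` is the right action of B^e on X, so balancedness is
associativity of that action. -/
theorem envAct_op_smul (x : S.Res X) (r : Env k B) (y : S.Ind S.Base) :
    letI := rightEnvModule k B (S.Res X)
    S.envAct X (MulOpposite.op r • x) y = S.envAct X x (r • y) :=
  letI := rightEnvModule k B (S.Res X)
  (mul_smul (MulOpposite.op (show Env k B from y)) (MulOpposite.op r) x).symm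

theorem envAct_smul (x : S.Res X) (b : B) (y : S.Ind S.Base) :
    S.envAct X x (S.incl b • y) = S.incl b • S.envAct X x y := by
  obtain ⟨x, rfl⟩ := (S.toRes X).surjective x
  induction y using S.ind_induction with
  | zero => simp only [smul_zero, map_zero]
  | add x x' h h' => simp only [smul_add, map_add, h, h']
  | mk b' c =>
    obtain ⟨b', rfl⟩ := S.toBase.surjective b'
    rw [smul_indMk, envAct_indMk, envAct_indMk, MulOpposite.unop_mul, MulOpposite.unop_op,
      retr_incl, map_mul, mul_smul]

theorem envAct_smul_op (x : S.Res X) (b : B) (y : S.Ind S.Base) :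
    S.envAct X x (MulOpposite.op (S.incl b) • y) = MulOpposite.op (S.incl b) • S.envAct X x y := by
  obtain ⟨x, rfl⟩ := (S.toRes X).surjective x
  induction y using S.ind_induction with
  | zero => simp only [smul_zero, map_zero]
  | add x x' h h' => simp only [smul_add, map_add, h, h']
  | mk b' c =>
    obtain ⟨b', rfl⟩ := S.toBase.surjective b'
    rw [op_smul_indMk, op_smul_toBase, envAct_indMk, envAct_indMk, retr_incl, map_mul,
      MulOpposite.op_mul, mul_smul, smul_comm (S.incl c.unop) (MulOpposite.op (S.incl b))]

variable (X)

/-- The homology of `X ⊗ [M_{p+1} B_*]` in positive degrees. -/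
theorem nonempty_envTorEquiv
    (h : ∀ n i : ℕ, 0 < i → Subsingleton (TorOver k B S.ideal (S.MPow n) i)) (p q : ℕ) :
    Nonempty ((LinearMap.ker (S.wordBoundary X (p + 1) (p + 1 + q)) ⧸
      (LinearMap.range (S.wordBoundary X (p + 1) (p + 1 + (q + 1)))).comap
        (LinearMap.ker (S.wordBoundary X (p + 1) (p + 1 + q))).subtype) ≃ₗ[k]
      EnvTor k B (S.Res X) (S.MPow p) (q + 1)) := by
  let _ := rightEnvModule k B (S.Res X)
  let _ := leftEnvModule k B (S.MPow p)
  let ε : S.Ind S.Base ⊗[k] S.Words (p + 1) (p + 1) →ₗ[Env k B] S.MPow p :=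
    { toFun := S.wordAugment p
      map_add' := map_add _
      map_smul' := fun r z =>
        (congrArg (S.augment p) (S.wordIncl_smul (p + 1) (p + 1) r z)).trans (S.augment_smul r _) }
  refine nonempty_torOverEquiv (k := k) (R := Env k B) (X := S.Res X)
    (P := fun q => S.Ind S.Base ⊗[k] S.Words (p + 1) (p + 1 + q))
    (U := fun q => S.Words (p + 1) (p + 1 + q))
    (T := fun q => X ⊗[k] S.Words (p + 1) (p + 1 + q))
    (fun q => S.wordBoundaryLin (Env k B) (S.Ind S.Base) (p + 1) (p + 1 + q)) ε
    (fun q => S.projective_env _) (S.wordAugment_surjective p) (S.wordAugment_exact p)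
    (fun q => (S.wordBoundary_exact_iff_vertExact _ _ _).2 (S.vertExact_base h (p + 1) q))
    (fun q => LinearMap.rTensorHom _ ∘ₗ S.envAct X)
    (fun q x r y => by
      induction y using TensorProduct.induction_on with
      | zero => rw [smul_zero, map_zero, map_zero]
      | add y y' h h' => rw [smul_add, map_add, map_add, h, h']
      | tmul y w => exact congrArg (· ⊗ₜ w) (S.envAct_op_smul x r y))
    (fun q => TensorProduct.mk k _ _ (S.indMk (S.toBase 1) 1))
    (fun q => by
      rw [eq_top_iff]
      rintro y -
      induction y using TensorProduct.induction_on with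
      | zero => exact zero_mem _
      | add y y' h h' => exact add_mem h h'
      | tmul x w =>
        -- B ⊗ B is B^e as a module over itself, generated by 1 ⊗ 1.
        have e : x = (show Env k B from x) • S.indMk (S.toBase 1) 1 :=
          (mul_one (show Env k B from x)).symm
        have : x ⊗ₜ[k] w = (show Env k B from x) • (S.indMk (S.toBase 1) 1 ⊗ₜ[k] w) :=
          (congrArg (· ⊗ₜ[k] w) e).trans (TensorProduct.smul_tmul' _ _ _).symm
        rw [this]
        exact Submodule.smul_mem _ _ (Submodule.subset_span ⟨w, rfl⟩))
    (fun q => by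
      have : TensorProduct.lift ((LinearMap.rTensorHom (S.Words (p + 1) (p + 1 + q)) ∘ₗ
          S.envAct X).compl₂ (TensorProduct.mk k _ _ (S.indMk (S.toBase 1) 1))) =
          (TensorProduct.congr (S.toRes X).symm (LinearEquiv.refl k _)).toLinearMap := by
        refine TensorProduct.ext' fun x w => ?_
        obtain ⟨x, rfl⟩ := (S.toRes X).surjective x
        refine congrArg (· ⊗ₜ w) ((S.envAct_indMk x 1 1).trans ?_)
        rw [MulOpposite.unop_one, map_one, MulOpposite.op_one, one_smul, one_smul]
        rfl
      rw [this]
      exact (TensorProduct.congr (S.toRes X).symm (LinearEquiv.refl k _)).bijective)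
    (fun q => S.wordBoundary X (p + 1) (p + 1 + q))
    (fun q x y => S.wordBoundary_rTensor (S.envAct X x) (fun b y => S.envAct_smul x b y)
      (fun b y => S.envAct_smul_op x b y) (p + 1) (p + 1 + q) y) q

end EnvTor
end SplitExtension

/-! ### The first page of the column filtration of C_{*,*}. -/

namespace SplitExtension
variable {k A B : Type u} [Field k] [Ring A] [Algebra k A] [Ring B] [Algebra k B]
  (S : SplitExtension k A B)
open HochschildComplex
variable (X : Type u) [AddCommGroup X] [Module k X] [Module A X] [Module Aᵐᵒᵖ X]
  [SMulCommClass A Aᵐᵒᵖ X] [IsScalarTower k A X] [IsScalarTower k Aᵐᵒᵖ X]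

section ColumnPages

/-- `X ⊗ [M_{p+1} B_{q+1}]` as a term of the double complex. -/
noncomputable def wordGap (p q : ℕ) :
    X ⊗[k] S.Words (p + 1) (p + 1 + (q + 1)) →ₗ[k] S.gapTerm X (p + 1) (q + 1) :=
  LinearMap.codRestrict (S.gapTerm X (p + 1) (q + 1)) (S.wordIncl X (p + 1) (p + 1 + (q + 1)))
    fun z => S.wordIncl_mem X _ _ z

theorem wordGap_bijective (p q : ℕ) : Function.Bijective (S.wordGap X p q) := by
  refine ⟨fun z z' h => S.wordIncl_injective X _ _ (congrArg Subtype.val h), fun y => ?_⟩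
  obtain ⟨z, hz⟩ := S.exists_wordIncl_eq X (p := p + 1) (n := p + 1 + (q + 1)) y.2
  exact ⟨z, Subtype.ext hz⟩

theorem coe_gapVert_wordGap (p q : ℕ) (z) : (S.gapVert X (p + 1) q (S.wordGap X p q z) :
    Chain k A X (p + 1 + q)) =
      S.wordIncl X (p + 1) (p + 1 + q) (S.wordBoundary X (p + 1) (p + 1 + q) z) := by
  rw [wordIncl_wordBoundary, vert_apply, ← S.bd_succ]
  rfl

theorem gapVert_wordGap_eq_zero_iff (p q : ℕ) (z) : S.gapVert X (p + 1) q (S.wordGap X p q z) = 0 ↔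
    S.wordBoundary X (p + 1) (p + 1 + q) z = 0 := by
  rw [← (S.wordIncl_injective X _ _).eq_iff, ← coe_gapVert_wordGap, map_zero]
  exact ⟨fun h => congrArg Subtype.val h, fun h => Subtype.ext h⟩

theorem gapVert_wordGap (p q : ℕ) (z) : S.gapVert X (p + 1) (q + 1) (S.wordGap X p (q + 1) z) =
    S.wordGap X p q (S.wordBoundary X (p + 1) (p + 1 + (q + 1)) z) :=
  Subtype.ext (S.coe_gapVert_wordGap X p (q + 1) z)

theorem neg_one_pow_smul_eq_zero_iff {V : Type*} [AddCommGroup V] [Module k V] (p : ℕ) (v : V) :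
    (-1 : k) ^ p • v = 0 ↔ v = 0 := by
  rw [smul_eq_zero]
  exact or_iff_right (pow_ne_zero _ (by simp))

theorem neg_one_pow_smul_smul {V : Type*} [AddCommGroup V] [Module k V] (p : ℕ) (v : V) :
    (-1 : k) ^ p • (-1 : k) ^ p • v = v := by
  rw [smul_smul, ← pow_add, Even.neg_one_pow ⟨p, rfl⟩, one_smul]

/-- The homology of the columns of `C_{*,*}` in positive degrees. -/
theorem nonempty_gapColumn_homologyEquiv (p q : ℕ) :
    Nonempty ((LinearMap.ker (S.wordBoundary X (p + 1) (p + 1 + q)) ⧸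
      (LinearMap.range (S.wordBoundary X (p + 1) (p + 1 + (q + 1)))).comap
        (LinearMap.ker (S.wordBoundary X (p + 1) (p + 1 + q))).subtype) ≃ₗ[k]
      (((S.gapDoubleComplex X).X (p + 1)).cycleSubmodule (q + 1) ⧸
        (((S.gapDoubleComplex X).X (p + 1)).boundarySubmodule (q + 1)).comap
          (((S.gapDoubleComplex X).X (p + 1)).cycleSubmodule (q + 1)).subtype)) := by
  have hd : ∀ q z, (((S.gapDoubleComplex X).X (p + 1)).d (q + 1) q).hom (S.wordGap X p q z) =
      (-1 : k) ^ (p + 1) • S.gapVert X (p + 1) q (S.wordGap X p q z) :=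
    fun q z => S.gapDoubleComplex_X_d X (p + 1) q (S.wordGap X p q z)
  have hc : ∀ z, S.wordGap X p q z ∈ ((S.gapDoubleComplex X).X (p + 1)).cycleSubmodule (q + 1) ↔
      S.wordBoundary X (p + 1) (p + 1 + q) z = 0 := fun z =>
    (HomologicalComplex.mem_cycleSubmodule_succ _).trans
      (Iff.trans (Eq.congr_left (hd q z)) ((neg_one_pow_smul_eq_zero_iff _ _).trans
        (S.gapVert_wordGap_eq_zero_iff X p q z)))
  have hb : ∀ z, S.wordGap X p q z ∈ ((S.gapDoubleComplex X).X (p + 1)).boundarySubmodule (q + 1) ↔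
      z ∈ LinearMap.range (S.wordBoundary X (p + 1) (p + 1 + (q + 1))) := by
    intro z
    refine (HomologicalComplex.mem_boundarySubmodule _).trans ⟨?_, ?_⟩
    -- The columns of C_{*,*} carry a sign, which does not change the boundaries; the preimages are
    -- rescaled by it.
    · rintro ⟨y, hy⟩
      obtain ⟨w, rfl⟩ := (S.wordGap_bijective X p (q + 1)).2 y
      have h : (-1 : k) ^ (p + 1) • S.gapVert X (p + 1) (q + 1) (S.wordGap X p (q + 1) w) =
          S.wordGap X p q z := (hd (q + 1) w).symm.trans hy
      rw [gapVert_wordGap, ← map_smul] at h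
      exact ⟨(-1 : k) ^ (p + 1) • w, (map_smul _ _ _).trans ((S.wordGap_bijective X p q).1 h)⟩
    · rintro ⟨w, rfl⟩
      have h : (-1 : k) ^ (p + 1) • S.gapVert X (p + 1) (q + 1)
          (S.wordGap X p (q + 1) ((-1 : k) ^ (p + 1) • w)) =
          S.wordGap X p q (S.wordBoundary X (p + 1) (p + 1 + (q + 1)) w) := by
        rw [map_smul, map_smul]
        exact (neg_one_pow_smul_smul (k := k) _ _).trans (S.gapVert_wordGap X p q w)
      exact ⟨S.wordGap X p (q + 1) ((-1 : k) ^ (p + 1) • w), (hd _ _).trans h⟩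
  refine nonempty_subquotientEquiv (S.wordGap X p q) (fun z hz => (hc z).2 hz) (fun y hy => ?_)
    fun z _ => hb z
  obtain ⟨z, rfl⟩ := (S.wordGap_bijective X p q).2 y
  exact ⟨z, (hc z).1 hy, (sub_self (S.wordGap X p q z)).symm ▸ zero_mem _⟩

theorem boundarySubmodule_gapColumn_zero (p : ℕ) (z : S.gapTerm X (p + 1) 0) :
    z ∈ ((S.gapDoubleComplex X).X (p + 1)).boundarySubmodule 0 := by
  obtain ⟨w, hw, e⟩ := S.exists_vert_eq X z.2.1 z.2.2
  let w' : S.gapTerm X (p + 1) 1 := ⟨w, hw⟩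
  have h : S.gapVert X (p + 1) 0 w' = z := by
    refine Subtype.ext (Eq.trans ?_ e)
    rw [vert_apply, ← S.bd_succ]
    rfl
  have h' : (-1 : k) ^ (p + 1) • S.gapVert X (p + 1) 0 ((-1 : k) ^ (p + 1) • w') = z := by
    rw [map_smul]
    exact (neg_one_pow_smul_smul (k := k) _ _).trans h
  exact (HomologicalComplex.mem_boundarySubmodule _).2
    ⟨(-1 : k) ^ (p + 1) • w', (S.gapDoubleComplex_X_d X (p + 1) 0 _).trans h'⟩

/-- There are three reasons. For `p ≤ 0` only column 0 could contribute, and it is zero; for `p = n`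
the spot is the bottom of its column, where every element is a vertical boundary; for `p > n` the
filtration is already exhausted at `p - 1`. -/
theorem subsingleton_colPage {p : ℤ} {n : ℕ} (h : ¬(0 < p ∧ p < n)) :
    Subsingleton (DoubleComplex.colPage (S.gapDoubleComplex X) 1 p n) := by
  by_cases hp : 0 < p
  · by_cases hn : p = n
    · obtain ⟨m, rfl⟩ : ∃ m, n = m + 1 := ⟨n - 1, by omega⟩
      subst hn
      obtain ⟨e⟩ := DoubleComplex.nonempty_colPageEquiv (S.gapDoubleComplex X) (p := m + 1) (q := 0)
        (n := m + 1) rfl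
      have := subsingleton_subquotient (Z := ((S.gapDoubleComplex X).X (m + 1)).cycleSubmodule 0)
        (B := ((S.gapDoubleComplex X).X (m + 1)).boundarySubmodule 0)
        fun z _ => S.boundarySubmodule_gapColumn_zero X m z
      exact e.toEquiv.subsingleton
    · refine subsingleton_subquotient fun z hz => ?_
      refine FilteredComplex.mem_boundaries .. |>.2 ⟨0, zero_mem _, ?_⟩
      rw [map_zero, sub_zero]
      refine FilteredComplex.mem_cycles .. |>.2
        ⟨(DoubleComplex.mem_colFiltration _).2 fun i j _ _ => by omega, fun j => ?_⟩
      by_cases hj : j + 1 = n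
      · exact (DoubleComplex.mem_colFiltration _).2 fun i j _ _ => by omega
      · rw [HomologicalComplex.shape _ _ _ hj]
        exact zero_mem _
  · refine subsingleton_subquotient fun z hz => ?_
    have hz' := (DoubleComplex.mem_colFiltration _).1 (FilteredComplex.mem_cycles .. |>.1 hz).1
    have : z = 0 := by
      refine DoubleComplex.ext_proj _ fun i j hij => ?_
      rw [map_zero]
      rcases i with _ | i
      · have h₀ : ∀ y : S.gapTerm X 0 j, y = 0 := fun y => Subtype.ext y.2
        exact h₀ _
      · exact hz' (i + 1) j hij (by omega)
    rw [this]
    exact zero_mem _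

/-- The first page of the column filtration of `C_{*,*}`. -/
theorem nonempty_colPageEquiv_envTor
    (h : ∀ n i : ℕ, 0 < i → Subsingleton (TorOver k B S.ideal (S.MPow n) i)) (p q : ℕ) :
    Nonempty (DoubleComplex.colPage (S.gapDoubleComplex X) 1 (p + 1 : ℕ) (p + 1 + (q + 1)) ≃ₗ[k]
      EnvTor k B (S.Res X) (S.MPow p) (q + 1)) := by
  obtain ⟨e₁⟩ := DoubleComplex.nonempty_colPageEquiv (S.gapDoubleComplex X) (p := p + 1) (q := q + 1)
    (n := p + 1 + (q + 1)) rfl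
  obtain ⟨e₂⟩ := S.nonempty_gapColumn_homologyEquiv X p q
  obtain ⟨e₃⟩ := S.nonempty_envTorEquiv X h p q
  exact ⟨(e₁.trans e₂.symm).trans e₃⟩

end ColumnPages
end SplitExtension

/-- Indices: `S.MPow p` has `p + 1` factors and so belongs to column `p + 1`, and a page is indexed
by filtration degree and total degree. Thus `n` and `n + 1` describe column 1, row `n` of the
sequence, and `0 < p ∧ p < n` describes the spots with p, q > 0. -/
theorem mainTheorem8 {k A B X : Type u} [Field k] [Ring A] [Algebra k A] [Ring B] [Algebra k B]
    (S : SplitExtension k A B) [AddCommGroup X] [Module k X] [Module A X] [Module Aᵐᵒᵖ X]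
    [SMulCommClass A Aᵐᵒᵖ X] [IsScalarTower k A X] [IsScalarTower k Aᵐᵒᵖ X] :
    (∀ n : ℕ, Nonempty (DoubleComplex.rowPage (S.sequenceDoubleComplex X) 2 n (n + 1) ≃ₗ[k]
      ((DoubleComplex.tot (S.gapDoubleComplex X)).homology n : ModuleCat.{u} k))) ∧
    ((∀ n i : ℕ, 0 < i → Subsingleton (TorOver k B S.ideal (S.MPow n) i)) →
      (∀ p q : ℕ, 0 < q →
        Nonempty (DoubleComplex.colPage (S.gapDoubleComplex X) 1 (p + 1 : ℕ) (p + 1 + q) ≃ₗ[k]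
          EnvTor k B (S.Res X) (S.MPow p) q)) ∧
      (∀ (p : ℤ) (n : ℕ), ¬(0 < p ∧ p < n) →
        Subsingleton (DoubleComplex.colPage (S.gapDoubleComplex X) 1 p n))) := by
  refine ⟨fun n => S.nonempty_rowPageEquiv_homology X n, fun h => ⟨fun p q hq => ?_, fun p n hn =>
    S.subsingleton_colPage X hn⟩⟩
  obtain ⟨q, rfl⟩ := Nat.exists_eq_succ_of_ne_zero hq.ne'
  exact S.nonempty_colPageEquiv_envTor X h p q
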